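/- Conventions. A finite poset $P$ is graded if, for all $p<q$, all maximal chains of the closed interval $[p,q]$ have the same length; for $p\le q$ this common length is denoted $\operatorname{rk}[p,q]$ (conditions such as $\operatorname{rk}[p,q]=1$ include $p\le q$). The oriented Hasse diagram $Q(P)$ is the quiver with vertex set $P$ and exactly one arrow $q\leftarrow p$ from $p$ to $q$ whenever $q$ covers $p$. For a field $K$ and a finite quiver $Q$, the path algebra $KQ$ has the paths of $Q$ (including the empty path $\varepsilon_v$ at each vertex $v$) as a basis, paths being composed from right to left; it is graded by path length, with degree $n$ part $KQ_n$, and $J$ denotes the ideal generated by the arrows. An ideal $I$ of $KQ$ is admissible if $J^n\subseteq I\subseteq J^2$ for some $n\ge 2$; a system of relations for $I$ is a finite subset of $\bigcup_{v,w}\varepsilon_wI\varepsilon_v$ generating $I$ as an ideal; $(Q,R)$ is a quiver presentation of a $K$-algebra $A$ if $R$ is a system of relations for an admissible ideal $I$ and $A\cong KQ/I$ as $K$-algebras. A $K$-algebra is quadratic if it is isomorphic to $KQ/I$ for a finite quiver $Q$ and an ideal $I$ generated by elements of $KQ_2$. A finite dimensional $K$-algebra $A$ is split basic if $A/\operatorname{rad}(A)\cong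 K^n$ as $K$-algebras for some $n\ge 1$. Modules are left modules. Theorem. Let $P$ be a finite nonempty graded poset, let $K$ be a field, and put $$R=\{r_{p,q}\mid \operatorname{rk}[p,q]=2\},\qquad r_{p,q}=\sum_{p<z<q}(q\leftarrow z\leftarrow p)\in KQ(P).$$ Let $A$ be a split basic $K$-algebra such that there is a bijection $p\mapsto S_p$ from $P$ to the set of isomorphism classes of simple $A$-modules such that: (1) $\operatorname{Ext}^1_A(S_p,S_q)\cong K$ if $\operatorname{rk}[p,q]=1$, and $\operatorname{Ext}^1_A(S_p,S_q)=0$ otherwise; (2) $\operatorname{Ext}^2_A(S_p,S_q)\cong K$ if $\operatorname{rk}[p,q]=2$, and $\operatorname{Ext}^2_A(S_p,S_q)=0$ otherwise; (3) there is a decomposition $1=\sum_{p\in P}\eta_p$ into orthogonal primitive idempotents with $A\eta_p/\operatorname{rad}(A)\eta_p\cong S_p$ for all $p\in P$, and an $A$-module homomorphism $\partial\colon A\to A$ such that (a) $\partial^2=0$; (b) $\partial(\eta_p)\eta_p=0$ for all $p\in P$; (c) $\partial(\eta_q)\eta_p\ne 0$ whenever $\operatorname{rk}[p,q]=1$. Then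 $(Q(P),R)$ is a quiver presentation of $A$. In particular, the ideal $I$ generated by $R$ is homogeneous, it is generated by elements of degree $2$, and $A\cong KQ(P)/I$ is a quadratic algebra. Conversely, the algebra $KQ(P)/I$, where $I$ is the ideal generated by $R$, is split basic and satisfies (1)--(3) for a suitable bijection from $P$ to the set of isomorphism classes of its simple modules. -/

import Mathlib

universe u v w x

open CategoryTheory

/-! ## Graded posets -/

/-- A poset is graded if, for all `p < q`, all maximal chains of the closed interval `[p, q]`
have the same length. -/
def IsGradedPoset (P : Type w) [PartialOrder P] : Prop :=
  ∀ p q : P, p < q → ∀ s t : Flag (Set.Icc p q),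
    (s : Set (Set.Icc p q)).ncard = (t : Set (Set.Icc p q)).ncard

/-- `RankEq p q n` says that `[p, q]` is a closed interval (`p ≤ q`) of rank `n`: all its
maximal chains have length `n`, i.e. consist of `n + 1` elements. -/
def RankEq {P : Type w} [PartialOrder P] (p q : P) (n : ℕ) : Prop :=
  p ≤ q ∧ ∀ s : Flag (Set.Icc p q), (s : Set (Set.Icc p q)).ncard = n + 1

/-- The vertex set of the Hasse diagram of `P`, oriented upwards (a synonym of `P`). -/
def HasseQuiver (P : Type w) : Type w := P

/-- There is exactly one arrow `p ⟶ q` if `q` covers `p`, and none otherwise. -/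
instance HasseQuiver.instQuiver (P : Type w) [PartialOrder P] : Quiver.{0} (HasseQuiver P) where
  Hom p q := PLift (@CovBy P _ p q)

/-- The arrow `q ← p` of the Hasse diagram. -/
def HasseQuiver.hom {P : Type w} [PartialOrder P] {p q : P} (h : p ⋖ q) :
    @Quiver.Hom (HasseQuiver P) _ p q :=
  PLift.up h

instance HasseQuiver.instFintype (P : Type w) [h : Fintype P] : Fintype (HasseQuiver P) := h

/-! ## Path algebras -/

/-- The set of all directed paths of a quiver, as triples (source, target, path). -/
abbrev QuiverPath (Q : Type w) [Quiver.{x} Q] : Type (max w x) :=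
  Σ a b : Q, Quiver.Path a b

/-- The path algebra `KQ`: the vector space with basis the paths of `Q`. -/
def PathAlgebra (K : Type u) (Q : Type w) [Field K] [Quiver.{x} Q] : Type (max u w x) :=
  QuiverPath Q →₀ K

namespace PathAlgebra

noncomputable section

variable (K : Type u) {Q : Type w} [Field K] [Quiver.{x} Q]

instance instAddCommGroup : AddCommGroup (PathAlgebra K Q) :=
  inferInstanceAs (AddCommGroup (QuiverPath Q →₀ K))

instance instModule : Module K (PathAlgebra K Q) :=
  inferInstanceAs (Module K (QuiverPath Q →₀ K))

/-- A path, as a basis element of the path algebra. -/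
def ofPath (p : QuiverPath Q) : PathAlgebra K Q := Finsupp.single p 1

/-- The empty path `ε_v`. -/
def vertex (v : Q) : PathAlgebra K Q := ofPath K ⟨v, v, Quiver.Path.nil⟩

/-- An arrow, as an element of the path algebra. -/
def arrow {a b : Q} (f : a ⟶ b) : PathAlgebra K Q := ofPath K ⟨a, b, f.toPath⟩

open Classical in
/-- The product `q * p` of two paths, composed from right to left: first `p`, then `q`.
It is zero if `q` does not start where `p` ends. -/
def pathProd (q p : QuiverPath Q) : PathAlgebra K Q :=
  if h : q.1 = p.2.1 then ofPath K ⟨p.1, q.2.1, p.2.2.comp (q.2.2.cast h rfl)⟩ else 0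

variable {K} in
/-- The linear map on the path algebra with prescribed values on the paths. -/
def lin {M : Type*} [AddCommGroup M] [Module K M] (φ : QuiverPath Q → M) :
    PathAlgebra K Q →ₗ[K] M :=
  Finsupp.linearCombination K φ

variable {K} in
theorem lin_ofPath {M : Type*} [AddCommGroup M] [Module K M] (φ : QuiverPath Q → M)
    (p : QuiverPath Q) : lin φ (ofPath K p) = φ p :=
  (Finsupp.linearCombination_single K (1 : K) p).trans (one_smul K (φ p))

/-- The bilinear extension of the product of paths. -/
def mulLin : PathAlgebra K Q →ₗ[K] PathAlgebra K Q →ₗ[K] PathAlgebra K Q :=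
  lin (fun q => lin (pathProd K q))

instance instMul : Mul (PathAlgebra K Q) := ⟨fun f g => mulLin K f g⟩

theorem mul_eq_mulLin (f g : PathAlgebra K Q) : f * g = mulLin K f g := rfl

theorem ofPath_mul_ofPath (q p : QuiverPath Q) :
    ofPath K q * ofPath K p = pathProd K q p := by
  rw [mul_eq_mulLin, mulLin, lin_ofPath, lin_ofPath]

theorem pathProd_comp {a b c : Q} (p : Quiver.Path a b) (q : Quiver.Path b c) :
    pathProd K ⟨b, c, q⟩ ⟨a, b, p⟩ = ofPath K ⟨a, c, p.comp q⟩ := by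
  simp [pathProd]

theorem pathProd_of_ne {q p : QuiverPath Q} (h : q.1 ≠ p.2.1) : pathProd K q p = 0 := by
  simp [pathProd, h]

variable {K} in
theorem induction_paths {motive : PathAlgebra K Q → Prop} (f : PathAlgebra K Q)
    (zero : motive 0) (add : ∀ f g, motive f → motive g → motive (f + g))
    (smul : ∀ (c : K) p, motive (c • ofPath K p)) : motive f := by
  refine Finsupp.induction_linear (motive := motive) f zero add fun p c => ?_
  have h := smul c p
  have e : c • ofPath K p = (Finsupp.single p c : QuiverPath Q →₀ K) := by
    have := Finsupp.smul_single c p (1 : K)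
    rwa [smul_eq_mul, mul_one] at this
  rwa [e] at h

theorem add_mul' (f g h : PathAlgebra K Q) : (f + g) * h = f * h + g * h := by
  simp [mul_eq_mulLin]

theorem mul_add' (f g h : PathAlgebra K Q) : f * (g + h) = f * g + f * h := by
  simp [mul_eq_mulLin]

theorem smul_mul' (c : K) (f g : PathAlgebra K Q) : (c • f) * g = c • (f * g) := by
  simp [mul_eq_mulLin]

theorem mul_smul' (c : K) (f g : PathAlgebra K Q) : f * (c • g) = c • (f * g) := by
  simp [mul_eq_mulLin]

theorem zero_mul' (f : PathAlgebra K Q) : 0 * f = 0 := by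
  simp [mul_eq_mulLin]

theorem mul_zero' (f : PathAlgebra K Q) : f * 0 = 0 := by
  simp [mul_eq_mulLin]

theorem ofPath_mul_assoc (r q p : QuiverPath Q) :
    ofPath K r * ofPath K q * ofPath K p = ofPath K r * (ofPath K q * ofPath K p) := by
  obtain ⟨a, b, p⟩ := p
  obtain ⟨b', c, q⟩ := q
  obtain ⟨c', d, r⟩ := r
  rw [ofPath_mul_ofPath, ofPath_mul_ofPath]
  by_cases hb : b' = b
  · subst hb
    by_cases hc : c' = c
    · subst hc
      simp [pathProd_comp, ofPath_mul_ofPath]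
    · rw [pathProd_comp, pathProd_of_ne K (by exact hc), ofPath_mul_ofPath,
        pathProd_of_ne K (by exact hc), zero_mul']
  · rw [pathProd_of_ne K (p := ⟨a, b, p⟩) (by exact hb), mul_zero']
    by_cases hc : c' = c
    · subst hc
      rw [pathProd_comp, ofPath_mul_ofPath, pathProd_of_ne K (by exact hb)]
    · rw [pathProd_of_ne K (by exact hc), zero_mul']

theorem mul_assoc' (f g h : PathAlgebra K Q) : f * g * h = f * (g * h) := by
  induction f using induction_paths with
  | zero => simp [zero_mul']
  | add f₁ f₂ h₁ h₂ => simp [add_mul', h₁, h₂]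
  | smul c r =>
    induction g using induction_paths with
    | zero => simp [zero_mul', mul_zero']
    | add f₁ f₂ h₁ h₂ => simp [add_mul', mul_add', h₁, h₂]
    | smul d q =>
      induction h using induction_paths with
      | zero => simp [mul_zero']
      | add f₁ f₂ h₁ h₂ => simp [mul_add', h₁, h₂]
      | smul e p => simp [smul_mul', mul_smul', ofPath_mul_assoc]

variable [Fintype Q]

/-- The identity is the sum of all empty paths. -/
instance instOne : One (PathAlgebra K Q) := ⟨∑ v : Q, vertex K v⟩

theorem one_eq_sum : (1 : PathAlgebra K Q) = ∑ v : Q, vertex K v := rfl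

theorem one_mul' (f : PathAlgebra K Q) : 1 * f = f := by
  induction f using induction_paths with
  | zero => rw [mul_zero']
  | add f g hf hg => rw [mul_add', hf, hg]
  | smul c p =>
    obtain ⟨a, b, p⟩ := p
    rw [mul_smul', one_eq_sum, mul_eq_mulLin, map_sum, LinearMap.sum_apply,
      Finset.sum_eq_single b]
    · rw [← mul_eq_mulLin, vertex, ofPath_mul_ofPath, pathProd_comp, Quiver.Path.comp_nil]
    · intro v _ hv
      rw [← mul_eq_mulLin, vertex, ofPath_mul_ofPath, pathProd_of_ne K (by exact hv)]
    · simp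

theorem mul_one' (f : PathAlgebra K Q) : f * 1 = f := by
  induction f using induction_paths with
  | zero => rw [zero_mul']
  | add f g hf hg => rw [add_mul', hf, hg]
  | smul c p =>
    obtain ⟨a, b, p⟩ := p
    rw [smul_mul', one_eq_sum, mul_eq_mulLin, map_sum, Finset.sum_eq_single a]
    · rw [← mul_eq_mulLin, vertex, ofPath_mul_ofPath, pathProd_comp, Quiver.Path.nil_comp]
    · intro v _ hv
      rw [← mul_eq_mulLin, vertex, ofPath_mul_ofPath,
        pathProd_of_ne K (by exact fun h => hv h.symm)]
    · simp

instance instRing : Ring (PathAlgebra K Q) :=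
  { instAddCommGroup K, instMul K, instOne K with
    left_distrib := mul_add' K
    right_distrib := add_mul' K
    zero_mul := zero_mul' K
    mul_zero := mul_zero' K
    mul_assoc := mul_assoc' K
    one_mul := one_mul' K
    mul_one := mul_one' K }

instance instAlgebra : Algebra K (PathAlgebra K Q) :=
  Algebra.ofModule (smul_mul' K) (mul_smul' K)

variable (Q) in
/-- The degree `n` part `KQ_n`: the span of the paths of length `n`. -/
def degreePart (n : ℕ) : Submodule K (PathAlgebra K Q) :=
  Submodule.span K {f | ∃ p : QuiverPath Q, p.2.2.length = n ∧ f = ofPath K p}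

variable {K} in
open Classical in
/-- The degree `n` component of an element of the path algebra. -/
def component (n : ℕ) (f : PathAlgebra K Q) : PathAlgebra K Q :=
  Finsupp.filter (fun p : QuiverPath Q => p.2.2.length = n) f

variable {K} in
/-- The two-sided ideal generated by a set of elements of the path algebra. -/
def idealOf (R : Set (PathAlgebra K Q)) : Ideal (PathAlgebra K Q) :=
  (TwoSidedIdeal.span R).asIdeal

instance idealOf_isTwoSided (R : Set (PathAlgebra K Q)) : (idealOf R).IsTwoSided :=
  inferInstanceAs ((TwoSidedIdeal.span R).asIdeal).IsTwoSided

variable (Q) in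
/-- The arrow ideal `J`. -/
def arrowIdeal : Ideal (PathAlgebra K Q) :=
  idealOf {f | ∃ (a b : Q) (e : a ⟶ b), f = arrow K e}

variable {K} in
/-- `I` is admissible if `J ^ n ⊆ I ⊆ J ^ 2` for some `n ≥ 2`. -/
def IsAdmissible (I : Ideal (PathAlgebra K Q)) : Prop :=
  ∃ n : ℕ, 2 ≤ n ∧ arrowIdeal K Q ^ n ≤ I ∧ I ≤ arrowIdeal K Q ^ 2

variable {K} in
/-- `R` is a system of relations for `I`: a finite subset of the union of the `ε_w I ε_v` that
generates `I` as a two-sided ideal. -/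
def IsSystemOfRelations (R : Set (PathAlgebra K Q)) (I : Ideal (PathAlgebra K Q)) : Prop :=
  R.Finite ∧ (∀ r ∈ R, ∃ v w : Q, ∃ f ∈ I, r = vertex K w * f * vertex K v) ∧ idealOf R = I

variable {K} in
/-- An ideal is homogeneous if it contains the components of all its elements. -/
def IsHomogeneousIdeal (I : Ideal (PathAlgebra K Q)) : Prop :=
  ∀ f ∈ I, ∀ n : ℕ, component n f ∈ I

end

end PathAlgebra

/-- The quotient `KQ / I` of the path algebra by the two-sided ideal `I` generated by `R`. -/
abbrev BoundQuiverAlgebra (K : Type u) {Q : Type w} [Field K] [Quiver.{x} Q] [Fintype Q]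
    (R : Set (PathAlgebra K Q)) : Type (max u w x) :=
  PathAlgebra K Q ⧸ PathAlgebra.idealOf R

/-- `(Q, R)` is a quiver presentation of `A`: `R` is a system of relations for an admissible
ideal `I`, and `A ≅ KQ / I` as `K`-algebras. -/
def IsQuiverPresentation (K : Type u) (A : Type v) [Field K] [Ring A] [Algebra K A]
    (Q : Type w) [Quiver.{x} Q] [Fintype Q] (R : Set (PathAlgebra K Q)) : Prop :=
  PathAlgebra.IsAdmissible (PathAlgebra.idealOf R) ∧
    PathAlgebra.IsSystemOfRelations R (PathAlgebra.idealOf R) ∧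
      Nonempty (A ≃ₐ[K] BoundQuiverAlgebra K R)

/-- `A` is a quadratic algebra: `A ≅ KQ / I` for a finite quiver `Q` and a two-sided ideal `I`
generated by homogeneous elements of degree two. -/
def IsQuadraticAlgebra (K : Type u) (A : Type v) [Field K] [Ring A] [Algebra K A] : Prop :=
  ∃ (Q : Type w) (_ : Quiver.{x} Q) (_ : Fintype Q) (R : Set (PathAlgebra K Q)),
    (∀ a b : Q, Finite (a ⟶ b)) ∧ R ⊆ PathAlgebra.degreePart K Q 2 ∧
      Nonempty (A ≃ₐ[K] BoundQuiverAlgebra K R)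

open Classical in
/-- The sum `r_{p,q}` of all paths `q ← z ← p` of length two from `p` to `q` in the Hasse
diagram (in an interval of rank two, `p ⋖ z ⋖ q` is the same as `p < z < q`). -/
noncomputable def rankTwoRelation (K : Type u) {P : Type w} [Field K] [PartialOrder P]
    [Fintype P] (p q : P) : PathAlgebra K (HasseQuiver P) :=
  ∑ z : P, if h : p ⋖ z ∧ z ⋖ q then
    PathAlgebra.ofPath K (Q := HasseQuiver P)
      ⟨p, q, (HasseQuiver.hom h.1).toPath.cons (HasseQuiver.hom h.2)⟩ else 0

/-- The relations `r_{p,q}` for all intervals `[p, q]` of rank two. -/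
def hasseRelations (K : Type u) (P : Type w) [Field K] [PartialOrder P] [Fintype P] :
    Set (PathAlgebra K (HasseQuiver P)) :=
  {r | ∃ p q : P, RankEq p q 2 ∧ r = rankTwoRelation K p q}

/-! ## Algebras and their simple modules -/

/-- A finite dimensional `K`-algebra `A` is split basic if `A / rad A ≅ K ^ n` for some
`n ≥ 1`. -/
def IsSplitBasic (K : Type u) (A : Type v) [Field K] [Ring A] [Algebra K A] : Prop :=
  FiniteDimensional K A ∧
    ∃ n : ℕ, 1 ≤ n ∧ Nonempty ((A ⧸ Ring.jacobson A) ≃ₐ[K] (Fin n → K))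

/-- An idempotent is primitive if it is nonzero and not the sum of two nonzero orthogonal
idempotents. -/
def IsPrimitiveIdempotent {A : Type v} [Ring A] (e : A) : Prop :=
  IsIdempotentElem e ∧ e ≠ 0 ∧ ∀ f g : A, IsIdempotentElem f → IsIdempotentElem g →
    f * g = 0 → g * f = 0 → f + g = e → f = 0 ∨ g = 0

/-- The left ideal `A e`. -/
def leftIdealOf {A : Type v} [Ring A] (e : A) : Submodule A A :=
  LinearMap.range (LinearMap.toSpanSingleton A A e)

/-- The submodule `rad(A) e` of the left ideal `A e`. -/
def radPart {A : Type v} [Ring A] (e : A) : Submodule A (leftIdealOf e) :=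
  ((Ring.jacobson A).map (LinearMap.toSpanSingleton A A e)).submoduleOf (leftIdealOf e)

/-- `p ↦ S p` induces a bijection from `P` to the set of isomorphism classes of simple
`A`-modules. -/
def IsSimpleLabelling {A : Type v} [Ring A] {P : Type w} (S : P → ModuleCat.{v} A) : Prop :=
  (∀ p, IsSimpleModule A (S p)) ∧ (∀ p q, Nonempty (S p ≃ₗ[A] S q) → p = q) ∧
    ∀ M : ModuleCat.{v} A, IsSimpleModule A M → ∃ p, Nonempty (M ≃ₗ[A] S p)

/-- `Ext ^ n (S p) (S q) ≅ K` if `[p, q]` is an interval of rank `n`, and it is zero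
otherwise. -/
def ExtConcentrated (K : Type u) {A : Type v} [Field K] [Ring A] [Algebra K A] {P : Type w}
    [PartialOrder P] (S : P → ModuleCat.{v} A) (n : ℕ) : Prop :=
  ∀ p q : P,
    (RankEq p q n → Nonempty (Abelian.Ext.{v} (S p) (S q) n ≃ₗ[K] K)) ∧
    (¬ RankEq p q n → Subsingleton (Abelian.Ext.{v} (S p) (S q) n))

/-- The simple `A`-modules are labelled by `P` in such a way that `Ext ^ 1` and `Ext ^ 2` between
them are concentrated on the intervals of rank one and two, and there are a compatible
decomposition of `1` into orthogonal primitive idempotents and a differential on `A`. -/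
def HasHasseDifferential (K : Type u) (A : Type v) (P : Type w) [Field K] [Ring A] [Algebra K A]
    [PartialOrder P] [Fintype P] : Prop :=
  ∃ S : P → ModuleCat.{v} A, IsSimpleLabelling S ∧
    ExtConcentrated K S 1 ∧
    ExtConcentrated K S 2 ∧
    ∃ η : P → A, CompleteOrthogonalIdempotents η ∧ (∀ p, IsPrimitiveIdempotent (η p)) ∧
      (∀ p, Nonempty ((leftIdealOf (η p) ⧸ radPart (η p)) ≃ₗ[A] S p)) ∧
      ∃ d : A →ₗ[A] A, d ∘ₗ d = 0 ∧ (∀ p, d (η p) * η p = 0) ∧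
        ∀ p q, RankEq p q 1 → d (η q) * η p ≠ 0

/-! The differential is right multiplication by y = ∂(1). So (3) says that y² = 0, that η_p y η_p =
0, and that η_q y η_p ≠ 0 for every cover p ⋖ q. Sending the arrow q ← p to η_q y η_p defines a
homomorphism φ : KQ(P) → A, and the point is that φ is onto with kernel generated by R.

Surjectivity comes from Ext¹. Split basicness gives characters χ_p : A → K dual to the η_p, with
common kernel rad A, and S_p is K with A acting through χ_p (`isSplitSystem_of_isSplitBasic`). From
the projective cover A η_p → S_p, Ext¹(S_p, S_q) is the space of functionals on rad A transforming
by χ_q on the left and χ_p on the right, that is, the dual of η_q (rad A / rad² A) η_p. With (1)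
this forces η_q (rad A) η_p = 0 unless p < q (`IsSplitSystem.mul_mul_eq_zero`), hence η_q (rad² A)
η_p = 0 for p ⋖ q, as nothing lies strictly between. So η_q y η_p, being nonzero, lies outside rad²
and spans its Peirce component modulo rad². It follows that φ is onto with kernel I ⊆ J².

The kernel is controlled by Ext². The radical of A η_p is covered by the sum of the A η_z over the
arrows z ← p, and stripping the first arrow from elements of I reaches the whole second syzygy. This
identifies Ext²(S_p, S_q) with the functionals on I transforming by χ_q and χ_p, that is, the dual
of ε_q (I / (JI + IJ)) ε_p (`IsPathPresentation.nonempty_extTwoEquiv`). Expanding η_q y² η_p = 0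
along 1 = ∑ η_z puts r_{p,q} into I for intervals of rank two. Since I ⊆ J², the coefficient of a
path of length two is a functional of this kind, with value 1 on r_{p,q}. By (2) the relations
therefore span I / (JI + IJ), and nilpotency of J gives I = (R) (`eq_idealOf_hasseRelations`).

For the converse the same two Ext computations apply to KQ(P)/(R), where the functionals on J and on
(R) are read off from generators. The differential is right multiplication by the sum of all arrows,
whose square has the r_{p,q} as Peirce components; gradedness makes every nonzero one a member of R.
-/

/-! ### Ext¹ and Ext² by dimension shift -/

section ExtDimensionShift

variable (K : Type u) [Field K] {C : Type w} [Category.{x} C] [Abelian C] [Linear K C]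
  [HasExt.{v} C] {T : ShortComplex C}

/-- If `T.X₂` is projective and every morphism `T.X₂ ⟶ Y` vanishes on `T.X₁`, then
`Ext¹(T.X₃, Y)` is the space of morphisms `T.X₁ ⟶ Y`. -/
noncomputable def extOneEquivHom (hT : T.ShortExact) [Projective T.X₂] (Y : C)
    (hY : ∀ f : T.X₂ ⟶ Y, T.f ≫ f = 0) : (T.X₁ ⟶ Y) ≃ₗ[K] Abelian.Ext.{v} T.X₃ Y 1 :=
  (Abelian.Ext.linearEquiv₀ (R := K)).symm ≪≫ₗ
    -- In Hom(X₂, Y) → Hom(X₁, Y) → Ext¹(X₃, Y) → Ext¹(X₂, Y) the first map is zero by `hY` and the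
    -- last term vanishes by projectivity.
    LinearEquiv.ofBijective (hT.extClass.precompOfLinear K Y (add_zero 1)) (by
      constructor
      · rw [injective_iff_map_eq_zero]
        intro f hf
        obtain ⟨g, rfl⟩ := Abelian.Ext.contravariant_sequence_exact₁ hT Y f (add_zero 1) hf
        obtain ⟨g, rfl⟩ := (Abelian.Ext.linearEquiv₀ (R := K)).symm.surjective g
        rw [Abelian.Ext.linearEquiv₀_symm_apply, Abelian.Ext.mk₀_comp_mk₀, hY,
          Abelian.Ext.mk₀_zero]
      · intro f
        exact Abelian.Ext.contravariant_sequence_exact₃ hT Y f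
          (Abelian.Ext.eq_zero_of_projective _) (add_zero 1))

/-- Dimension shift along a short exact sequence with projective middle term. -/
noncomputable def extSuccEquiv (hT : T.ShortExact) [Projective T.X₂] (Y : C) :
    Abelian.Ext.{v} T.X₁ Y 1 ≃ₗ[K] Abelian.Ext.{v} T.X₃ Y 2 :=
  LinearEquiv.ofBijective (hT.extClass.precompOfLinear K Y (show 1 + 1 = 2 from rfl)) (by
      constructor
      · rw [injective_iff_map_eq_zero]
        intro f hf
        obtain ⟨g, rfl⟩ := Abelian.Ext.contravariant_sequence_exact₁ hT Y f rfl hf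
        rw [Abelian.Ext.eq_zero_of_projective g, Abelian.Ext.comp_zero]
      · intro f
        exact Abelian.Ext.contravariant_sequence_exact₃ hT Y f
          (Abelian.Ext.eq_zero_of_projective _) rfl)

end ExtDimensionShift

/-! ### One-dimensional modules and spaces of functionals -/

section CharacterModules

variable {K : Type u} [Field K] {A : Type v} [Ring A] [Algebra K A]

/-- The additive maps `N →+ K` on which `A` acts through the character `χ`. -/
def charSpace (χ : A →ₐ[K] K) (N : Type*) [AddCommGroup N] [Module A N] :
    Submodule K (N →+ K) where
  carrier := {f | ∀ (a : A) (n : N), f (a • n) = χ a * f n}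
  zero_mem' := by simp
  add_mem' hf hg a n := by simp [hf a n, hg a n, mul_add]
  smul_mem' c f hf a n := by simp [hf a n, mul_left_comm]

/-- The additive maps `I →+ K` on which `A` acts from the left through `χ` and from the right
through `ψ`. -/
def bicharSpace (χ ψ : A →ₐ[K] K) (I : Ideal A) : Submodule K (I →+ K) where
  carrier := {f | ∀ (a b : A) (m m' : I), (m' : A) = a * m * b → f m' = χ a * ψ b * f m}
  zero_mem' := by simp
  add_mem' hf hg a b m m' h := by simp [hf a b m m' h, hg a b m m' h, mul_add]
  smul_mem' c f hf a b m m' h := by simp [hf a b m m' h, mul_left_comm]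

/-- An identification of `M` with `K` on which `A` acts through the character `χ`. -/
structure CharModuleEquiv (χ : A →ₐ[K] K) (M : Type*) [AddCommGroup M] [Module A M] extends
    M ≃+ K where
  map_act (a : A) (m : M) : toFun (a • m) = χ a * toFun m

variable {χ : A →ₐ[K] K}

open scoped ModuleCat in
/-- Morphisms to a one-dimensional module are functionals. -/
noncomputable def homEquivCharSpace {M : ModuleCat.{v} A} (σ : CharModuleEquiv χ M)
    (N : ModuleCat.{v} A) : (N ⟶ M) ≃ₗ[K] charSpace χ N where
  toFun h := ⟨(σ.toAddEquiv : M →+ K).comp h.hom.toAddMonoidHom, fun a n => by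
    simpa using σ.map_act a (h.hom n)⟩
  map_add' h h' := by
    ext n
    simp
  map_smul' c h := by
    ext n
    -- The scalar `c` acts on morphisms through `algebraMap`, which the character sends back to `c`.
    have := σ.map_act (algebraMap K A c) (h.hom n)
    simpa using this
  invFun f := ModuleCat.ofHom
    { toFun n := σ.symm (f.1 n)
      map_add' := by simp
      map_smul' a n := by
        apply σ.toAddEquiv.injective
        have := σ.map_act a (σ.symm (f.1 n))
        rw [f.2 a n]
        simpa using this.symm }
  left_inv h := by
    ext n
    simp
  right_inv f := by
    ext n
    simp

/-- The short exact sequence of a surjection. -/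
def kerComplex {L : ModuleCat.{v} A} {M : Type v} [AddCommGroup M] [Module A M]
    (π : M →ₗ[A] L) : ShortComplex (ModuleCat.{v} A) :=
  ShortComplex.mk (ModuleCat.ofHom (LinearMap.ker π).subtype) (ModuleCat.ofHom π)
    (by ext x; exact x.2)

theorem kerComplex_shortExact {L : ModuleCat.{v} A} {M : Type v} [AddCommGroup M] [Module A M]
    (π : M →ₗ[A] L) (hπ : Function.Surjective π) : (kerComplex π).ShortExact where
  exact := by
    rw [ShortComplex.moduleCat_exact_iff]
    intro x hx
    exact ⟨⟨x, hx⟩, rfl⟩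
  mono_f := (ModuleCat.mono_iff_injective _).2 Subtype.val_injective
  epi_g := (ModuleCat.epi_iff_surjective _).2 hπ

/-- `Ext¹` into a one-dimensional module, from a projective cover. -/
noncomputable def extOneEquivCharSpace {L S : ModuleCat.{v} A} {M : Type v} [AddCommGroup M]
    [Module A M] [Module.Projective A M] (π : M →ₗ[A] L) (hπ : Function.Surjective π)
    (σ : CharModuleEquiv χ S)
    (hS : ∀ f ∈ charSpace χ M, ∀ m ∈ LinearMap.ker π, f m = 0) :
    Abelian.Ext.{v} L S 1 ≃ₗ[K] charSpace χ (LinearMap.ker π) :=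
  haveI : Projective (kerComplex π).X₂ :=
    (IsProjective.iff_projective _).1 (inferInstanceAs (Module.Projective A M))
  (extOneEquivHom K (kerComplex_shortExact π hπ) S (fun f => by
    ext x
    apply σ.toAddEquiv.injective
    exact (hS _ (homEquivCharSpace σ (ModuleCat.of A M) f).2 x.1 x.2).trans
      (map_zero σ.toAddEquiv).symm)).symm ≪≫ₗ
    homEquivCharSpace σ _

/-- Dimension shift for modules. -/
noncomputable def extTwoEquivExtOne {L : ModuleCat.{v} A} (S : ModuleCat.{v} A) {M : Type v}
    [AddCommGroup M] [Module A M] [Module.Projective A M] (π : M →ₗ[A] L)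
    (hπ : Function.Surjective π) :
    Abelian.Ext.{v} L S 2 ≃ₗ[K]
      Abelian.Ext.{v} (ModuleCat.of A (LinearMap.ker π)) S 1 :=
  haveI : Projective (kerComplex π).X₂ :=
    (IsProjective.iff_projective _).1 (inferInstanceAs (Module.Projective A M))
  (extSuccEquiv K (kerComplex_shortExact π hπ) S).symm

end CharacterModules

/-! ### Left ideals of idempotents and their simple quotients -/

theorem mem_leftIdealOf {A : Type v} [Ring A] {e : A} (he : IsIdempotentElem e) {a : A} :
    a ∈ leftIdealOf e ↔ a * e = a := by
  constructor
  · rintro ⟨b, rfl⟩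
    simp [mul_assoc, he.eq]
  · exact fun h => ⟨a, h⟩

theorem mul_self_mem_leftIdealOf {A : Type v} [Ring A] (a e : A) : a * e ∈ leftIdealOf e :=
  ⟨a, rfl⟩

theorem mem_radPart {A : Type v} [Ring A] {e : A} (he : IsIdempotentElem e)
    {x : leftIdealOf e} : x ∈ radPart e ↔ (x : A) ∈ Ring.jacobson A := by
  have hx : x ∈ radPart e ↔
      (x : A) ∈ Ideal.span (LinearMap.toSpanSingleton A A e '' (Ring.jacobson A : Set A)) := Iff.rfl
  rw [hx]
  constructor
  · refine fun h => Submodule.span_le.2 ?_ h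
    rintro _ ⟨y, hy, rfl⟩
    exact Ideal.mul_mem_right _ _ hy
  · exact fun h => Ideal.subset_span ⟨x, h, (mem_leftIdealOf he).1 x.2⟩

section CharModule

variable {K : Type u} [Field K] {A : Type v} [Ring A] [Algebra K A] {χ : A →ₐ[K] K}

/-- Transport along an isomorphism of modules. -/
def CharModuleEquiv.congr {M N : Type*} [AddCommGroup M] [Module A M] [AddCommGroup N]
    [Module A N] (σ : CharModuleEquiv χ N) (e : M ≃ₗ[A] N) : CharModuleEquiv χ M where
  toAddEquiv := e.toAddEquiv.trans σ.toAddEquiv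
  map_act a m := by
    have := σ.map_act a (e m)
    simpa using this

/-- The scalars in `A` alone already carry any nonzero vector to any other vector. -/
theorem CharModuleEquiv.isSimpleModule {M : Type*} [AddCommGroup M] [Module A M]
    (σ : CharModuleEquiv χ M) : IsSimpleModule A M := by
  rw [isSimpleModule_iff_toSpanSingleton_surjective]
  refine ⟨σ.toAddEquiv.toEquiv.nontrivial, fun x hx y => ?_⟩
  have hx' : σ.toAddEquiv x ≠ 0 := by simpa using hx
  refine ⟨algebraMap K A (σ.toAddEquiv y * (σ.toAddEquiv x)⁻¹), σ.toAddEquiv.injective ?_⟩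
  have := σ.map_act (algebraMap K A (σ.toAddEquiv y * (σ.toAddEquiv x)⁻¹)) x
  rw [AlgHom.commutes] at this
  refine this.trans ?_
  change σ.toAddEquiv y * (σ.toAddEquiv x)⁻¹ * σ.toAddEquiv x = σ.toAddEquiv y
  field_simp

/-- The restriction of `χ` to `A e` is onto `K` because `χ e = 1`, and by `hJ` its kernel is `rad(A)
e`. -/
theorem nonempty_charModuleEquiv_quotient {e : A} (he : IsIdempotentElem e) (h1 : χ e = 1)
    (hJ : ∀ a ∈ leftIdealOf e, χ a = 0 ↔ a ∈ Ring.jacobson A) :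
    Nonempty (CharModuleEquiv χ (leftIdealOf e ⧸ radPart e)) := by
  let _ : Module A K := Module.compHom K χ.toRingHom
  let f : leftIdealOf e →ₗ[A] K :=
    { toFun x := χ x
      map_add' := by simp
      map_smul' a x := by
        simp only [SetLike.val_smul, smul_eq_mul, map_mul, RingHom.id_apply]
        rfl }
  have hf : Function.Surjective f := fun c =>
    ⟨⟨algebraMap K A c * e, mul_self_mem_leftIdealOf _ _⟩, by simp [f, h1]⟩
  have hk : radPart e = LinearMap.ker f := by
    ext x
    rw [mem_radPart he, ← hJ _ x.2]
    rfl
  let g := (Submodule.quotEquivOfEq _ _ hk).trans (f.quotKerEquivOfSurjective hf)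
  exact ⟨{ g.toAddEquiv with map_act := fun a m => g.map_smul a m }⟩

end CharModule

/-- For `f` in the radical, `1 - f` has a left inverse, and `(1 - f) * f = 0`. -/
theorem IsIdempotentElem.eq_zero_of_mem_jacobson {A : Type v} [Ring A] {f : A}
    (hf : IsIdempotentElem f) (hJ : f ∈ Ring.jacobson A) : f = 0 := by
  rw [← Ideal.jacobson_bot, Ideal.mem_jacobson_iff] at hJ
  obtain ⟨z, hz⟩ := hJ (-1)
  have hz' : z * (1 - f) = 1 := by
    rw [Ideal.mem_bot, sub_eq_zero] at hz
    refine Eq.trans ?_ hz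
    rw [mul_sub, mul_one, mul_neg_one, neg_mul, add_comm, sub_eq_add_neg, add_comm]
  calc f = z * (1 - f) * f := by rw [hz', one_mul]
    _ = 0 := by rw [mul_assoc, sub_mul, one_mul, hf.eq, sub_self, mul_zero]

/-- Complete orthogonal idempotents together with dual characters whose common kernel is the
Jacobson radical. -/
structure IsSplitSystem {K : Type u} [Field K] {A : Type v} [Ring A] [Algebra K A] {P : Type w}
    [Fintype P] (η : P → A) (χ : P → A →ₐ[K] K) : Prop where
  complete : CompleteOrthogonalIdempotents η
  chi_self (p : P) : χ p (η p) = 1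
  mem_jacobson_iff (a : A) : a ∈ Ring.jacobson A ↔ ∀ p, χ p a = 0

/-! ### Idempotents with dual characters, and the simple modules -/

section SplitSystem

variable {K : Type u} [Field K] {A : Type v} [Ring A] [Algebra K A] {P : Type w} [Fintype P]
  {η : P → A} {χ : P → A →ₐ[K] K}

/-- The isomorphism A / rad A ≅ Kⁿ supplies n characters, not yet matched with the idempotents. As
η_p is not in the radical, some character is nonzero on it. The kernel of that character on A η_p is
proper and contains the maximal submodule rad(A) η_p, so the two agree. Thus one character per
idempotent detects the radical on A η_p, and a = ∑ a η_p shows that the chosen characters detect it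
on all of A. -/
theorem isSplitSystem_of_isSplitBasic (hA : IsSplitBasic K A) {S : P → ModuleCat.{v} A}
    (hS : ∀ p, IsSimpleModule A (S p)) (hη : CompleteOrthogonalIdempotents η)
    (e : ∀ p, Nonempty ((leftIdealOf (η p) ⧸ radPart (η p)) ≃ₗ[A] S p)) :
    ∃ χ : P → A →ₐ[K] K, IsSplitSystem η χ ∧ ∀ p, Nonempty (CharModuleEquiv (χ p) (S p)) := by
  obtain ⟨hfd, n, -, ⟨ρ⟩⟩ := hA
  let χ₀ (i : Fin n) : A →ₐ[K] K :=
    ((Pi.evalAlgHom K (fun _ => K) i).comp ρ.toAlgHom).comp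
      (Ideal.Quotient.mkₐ K (Ring.jacobson A))
  have hχ₀ (a : A) : a ∈ Ring.jacobson A ↔ ∀ i, χ₀ i a = 0 := by
    rw [← Ideal.Quotient.eq_zero_iff_mem, ← map_eq_zero_iff ρ ρ.injective, funext_iff]
    rfl
  have hlift (c : Fin n → K) : ∃ a : A, ∀ i, χ₀ i a = c i := by
    obtain ⟨a, ha⟩ := Ideal.Quotient.mk_surjective (ρ.symm c)
    refine ⟨a, fun i => ?_⟩
    change ρ (Ideal.Quotient.mk _ a) i = c i
    rw [ha, AlgEquiv.apply_symm_apply]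
  have hne (p : P) : η p ∉ Ring.jacobson A := by
    intro h
    have : IsSimpleModule A (leftIdealOf (η p) ⧸ radPart (η p)) :=
      (hS p).congr (e p).some
    have hc : IsCoatom (radPart (η p)) := isSimpleModule_iff_isCoatom.1 this
    apply hc.1
    rw [eq_top_iff]
    rintro x -
    rw [mem_radPart (hη.idem p), ← (mem_leftIdealOf (hη.idem p)).1 x.2]
    exact Ideal.mul_mem_left _ _ h
  have hex (p : P) : ∃ i, χ₀ i (η p) ≠ 0 := by
    by_contra! h
    exact hne p ((hχ₀ _).2 h)
  choose i hi using hex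
  -- A nonzero idempotent of a field is 1.
  have hone (p : P) : χ₀ (i p) (η p) = 1 := by
    have h := congrArg (χ₀ (i p)) (hη.idem p).eq
    rw [map_mul] at h
    exact mul_left_cancel₀ (hi p) (by rw [h, mul_one])
  have hmem (p : P) (a : A) (ha : a ∈ leftIdealOf (η p)) :
      χ₀ (i p) a = 0 ↔ a ∈ Ring.jacobson A := by
    refine ⟨fun h => ?_, fun h => (hχ₀ a).1 h _⟩
    have : IsSimpleModule A (leftIdealOf (η p) ⧸ radPart (η p)) :=
      (hS p).congr (e p).some
    have hc : IsCoatom (radPart (η p)) := isSimpleModule_iff_isCoatom.1 this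
    let N : Submodule A (leftIdealOf (η p)) :=
      { carrier := {x | χ₀ (i p) x = 0}
        zero_mem' := by simp
        add_mem' := fun {x y} hx hy => by
          simp only [Set.mem_ofPred_eq] at hx hy ⊢
          simp [hx, hy]
        smul_mem' := fun c x hx => by
          simp only [Set.mem_ofPred_eq] at hx ⊢
          simp [hx] }
    have hle : radPart (η p) ≤ N := fun x hx =>
      (hχ₀ _).1 ((mem_radPart (hη.idem p)).1 hx) _
    have hN : N = radPart (η p) := by
      rcases hc.le_iff.1 hle with h | h
      · exfalso
        have : (⟨1 * η p, mul_self_mem_leftIdealOf _ _⟩ : leftIdealOf (η p)) ∈ N :=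
          h ▸ Submodule.mem_top
        have h2 : χ₀ (i p) (1 * η p) = 0 := this
        rw [one_mul] at h2
        exact hi p h2
      · exact h
    have : (⟨a, ha⟩ : leftIdealOf (η p)) ∈ N := h
    rw [hN, mem_radPart (hη.idem p)] at this
    exact this
  refine ⟨fun p => χ₀ (i p), ⟨hη, hone, fun a => ⟨fun h p => (hχ₀ a).1 h _, fun h => ?_⟩⟩,
    fun p => ?_⟩
  · rw [← mul_one a, ← hη.complete, Finset.mul_sum]
    refine sum_mem fun p _ => ?_
    rw [← hmem p _ (mul_self_mem_leftIdealOf _ _), map_mul, h p, zero_mul]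
  · obtain ⟨σ⟩ := nonempty_charModuleEquiv_quotient (hη.idem p) (hone p) (hmem p)
    exact ⟨σ.congr (e p).some.symm⟩

namespace IsSplitSystem

variable (h : IsSplitSystem η χ)
include h

theorem chi_of_ne {p q : P} (hpq : p ≠ q) : χ p (η q) = 0 := by
  have := congrArg (χ p) (h.complete.ortho hpq)
  rwa [map_mul, h.chi_self, one_mul, map_zero] at this

theorem mem_jacobson_of_chi {p : P} {a : A} (ha : a * η p = a) (h0 : χ p a = 0) :
    a ∈ Ring.jacobson A := by
  rw [h.mem_jacobson_iff]
  intro q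
  by_cases hq : q = p
  · rw [hq, h0]
  · rw [← ha, map_mul, h.chi_of_ne hq, mul_zero]

theorem mul_sub_mem_jacobson (p : P) (a : A) :
    a * η p - algebraMap K A (χ p a) * η p ∈ Ring.jacobson A :=
  h.mem_jacobson_of_chi (p := p) (by simp [sub_mul, mul_assoc, (h.complete.idem p).eq])
    (by simp [h.chi_self])

theorem nonempty_charModuleEquiv (p : P) :
    Nonempty (CharModuleEquiv (χ p) (leftIdealOf (η p) ⧸ radPart (η p))) :=
  nonempty_charModuleEquiv_quotient (h.complete.idem p) (h.chi_self p) fun _ ha =>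
    ⟨h.mem_jacobson_of_chi ((mem_leftIdealOf (h.complete.idem p)).1 ha),
      fun h' => (h.mem_jacobson_iff _).1 h' p⟩

theorem ne_zero (p : P) : η p ≠ 0 := fun h0 => by
  simpa [h0] using h.chi_self p

/-- If η_p = f + g orthogonally, then χ_p(f) χ_p(g) = 0. So one of f, g lies in the radical, and an
idempotent there is zero. -/
theorem isPrimitiveIdempotent (p : P) : IsPrimitiveIdempotent (η p) := by
  refine ⟨h.complete.idem p, h.ne_zero p, fun f g hf hg hfg hgf hsum => ?_⟩
  have hfη : f * η p = f := by rw [← hsum, mul_add, hf.eq, hfg, add_zero]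
  have hgη : g * η p = g := by rw [← hsum, mul_add, hg.eq, hgf, zero_add]
  have h0 : χ p f * χ p g = 0 := by rw [← map_mul, hfg, map_zero]
  rcases mul_eq_zero.1 h0 with h0 | h0
  · exact .inl (hf.eq_zero_of_mem_jacobson (h.mem_jacobson_of_chi hfη h0))
  · exact .inr (hg.eq_zero_of_mem_jacobson (h.mem_jacobson_of_chi hgη h0))

/-- The idempotent η_p acts as the identity on a module with character χ_p, and as zero if the
character is χ_q with q ≠ p. -/
theorem eq_of_linearEquiv {p q : P} {M N : Type*} [AddCommGroup M] [Module A M]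
    [AddCommGroup N] [Module A N] (σ : CharModuleEquiv (χ p) M) (τ : CharModuleEquiv (χ q) N)
    (e : M ≃ₗ[A] N) : p = q := by
  by_contra hpq
  have h1 := σ.map_act (η p) (σ.toAddEquiv.symm 1)
  have h2 := τ.map_act (η p) (e (σ.toAddEquiv.symm 1))
  rw [h.chi_self, one_mul] at h1
  rw [h.chi_of_ne (Ne.symm hpq), zero_mul] at h2
  have h3 : η p • σ.toAddEquiv.symm 1 = σ.toAddEquiv.symm 1 := σ.toAddEquiv.injective h1
  have h4 : e (η p • σ.toAddEquiv.symm 1) = 0 := by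
    rw [map_smul]
    exact τ.toAddEquiv.injective (h2.trans (map_zero τ.toAddEquiv).symm)
  rw [h3, map_eq_zero_iff e e.injective] at h4
  have h5 := σ.toAddEquiv.apply_symm_apply 1
  rw [h4, map_zero] at h5
  exact zero_ne_one h5

/-- Since 1 = ∑ η_p, some η_p moves a chosen vector m to a nonzero one. Then a ↦ a m on A η_p kills
the radical part and is nonzero, so Schur's lemma applies. -/
theorem exists_linearEquiv_of_isSimpleModule (M : Type*) [AddCommGroup M] [Module A M]
    [IsSimpleModule A M] : ∃ p, Nonempty (M ≃ₗ[A] (leftIdealOf (η p) ⧸ radPart (η p))) := by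
  have := IsSimpleModule.nontrivial A M
  obtain ⟨m, hm⟩ := exists_ne (0 : M)
  obtain ⟨p, hp⟩ : ∃ p, η p • m ≠ 0 := by
    by_contra! h0
    apply hm
    rw [← one_smul A m, ← h.complete.complete, Finset.sum_smul]
    exact Finset.sum_eq_zero fun p _ => h0 p
  obtain ⟨σ⟩ := h.nonempty_charModuleEquiv p
  have hs := σ.isSimpleModule
  let f : leftIdealOf (η p) →ₗ[A] M :=
    (LinearMap.toSpanSingleton A M m).comp (leftIdealOf (η p)).subtype
  have hf : radPart (η p) ≤ LinearMap.ker f := fun x hx =>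
    Module.mem_annihilator.1 (IsSemisimpleModule.jacobson_le_annihilator A M
      ((mem_radPart (h.complete.idem p)).1 hx)) m
  refine ⟨p, ⟨(LinearEquiv.ofBijective ((radPart (η p)).liftQ f hf) ?_).symm⟩⟩
  apply LinearMap.bijective_of_ne_zero
  intro h0
  apply hp
  have := LinearMap.congr_fun h0
    (Submodule.Quotient.mk ⟨1 * η p, mul_self_mem_leftIdealOf _ _⟩)
  simpa [f] using this

theorem isSimpleLabelling :
    IsSimpleLabelling fun p => ModuleCat.of A (leftIdealOf (η p) ⧸ radPart (η p)) := by
  refine ⟨fun p => ?_, fun p q e => ?_, fun M hM => ?_⟩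
  · obtain ⟨σ⟩ := h.nonempty_charModuleEquiv p
    exact σ.isSimpleModule
  · obtain ⟨σ⟩ := h.nonempty_charModuleEquiv p
    obtain ⟨τ⟩ := h.nonempty_charModuleEquiv q
    exact h.eq_of_linearEquiv σ τ e.some
  · exact h.exists_linearEquiv_of_isSimpleModule M

end IsSplitSystem

end SplitSystem

theorem projective_leftIdealOf {A : Type v} [Ring A] {e : A} (he : IsIdempotentElem e) :
    Module.Projective A (leftIdealOf e) :=
  Module.Projective.of_split (leftIdealOf e).subtype
    ((LinearMap.toSpanSingleton A A e).codRestrict _ fun a => mul_self_mem_leftIdealOf a e) (by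
      ext x
      exact (mem_leftIdealOf he).1 x.2)

/-- The direct sum of the left ideals `A u_i`, as a submodule of a free module. -/
def leftIdealSum {A : Type v} [Ring A] {ι : Type} (u : ι → A) : Submodule A (ι → A) where
  carrier := {v | ∀ i, v i * u i = v i}
  zero_mem' := by simp
  add_mem' hv hw i := by simp [add_mul, hv i, hw i]
  smul_mem' c v hv i := by simp [mul_assoc, hv i]

theorem projective_leftIdealSum {A : Type v} [Ring A] {ι : Type} [Finite ι] {u : ι → A}
    (hu : ∀ i, IsIdempotentElem (u i)) : Module.Projective A (leftIdealSum u) :=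
  Module.Projective.of_split (leftIdealSum u).subtype
    (LinearMap.codRestrict _
      { toFun v i := v i * u i
        map_add' v w := by ext; simp [add_mul]
        map_smul' c v := by ext; simp [mul_assoc] }
      fun v i => by simp [mul_assoc, (hu i).eq]) (by
      ext x i
      exact x.2 i)

/-! ### Projective covers of the simples and Ext¹ -/

namespace IsSplitSystem

variable {K : Type u} [Field K] {A : Type v} [Ring A] [Algebra K A] {P : Type w} [Fintype P]
  {η : P → A} {χ : P → A →ₐ[K] K}

/-- The projective cover `A η_p → S_p`. -/
noncomputable def cover {p : P} {S : ModuleCat.{v} A} (σ : CharModuleEquiv (χ p) S) :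
    leftIdealOf (η p) →ₗ[A] S :=
  (LinearMap.toSpanSingleton A S (σ.toAddEquiv.symm 1)).comp (leftIdealOf (η p)).subtype

omit [Fintype P] in
theorem apply_cover {p : P} {S : ModuleCat.{v} A} (σ : CharModuleEquiv (χ p) S)
    (a : leftIdealOf (η p)) : σ.toAddEquiv (cover σ a) = χ p a := by
  refine (σ.map_act (a : A) (σ.toAddEquiv.symm 1)).trans ?_
  rw [show σ.toFun (σ.toAddEquiv.symm 1) = 1 from σ.toAddEquiv.apply_symm_apply 1, mul_one]

omit [Fintype P] in
theorem mem_ker_cover {p : P} {S : ModuleCat.{v} A} (σ : CharModuleEquiv (χ p) S)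
    {a : leftIdealOf (η p)} : a ∈ LinearMap.ker (cover σ) ↔ χ p a = 0 := by
  rw [← apply_cover σ a, LinearMap.mem_ker]
  exact (map_eq_zero_iff σ.toAddEquiv σ.toAddEquiv.injective).symm

variable (h : IsSplitSystem η χ)
include h

theorem cover_surjective {p : P} {S : ModuleCat.{v} A} (σ : CharModuleEquiv (χ p) S) :
    Function.Surjective (cover (η := η) σ) := fun m => by
  refine ⟨⟨algebraMap K A (σ.toAddEquiv m) * η p, mul_self_mem_leftIdealOf _ _⟩, ?_⟩
  apply σ.toAddEquiv.injective
  rw [apply_cover]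
  simp [h.chi_self]

theorem mem_ker_cover_iff {p : P} {S : ModuleCat.{v} A} (σ : CharModuleEquiv (χ p) S)
    {a : leftIdealOf (η p)} : a ∈ LinearMap.ker (cover σ) ↔ (a : A) ∈ Ring.jacobson A := by
  rw [mem_ker_cover]
  exact ⟨h.mem_jacobson_of_chi ((mem_leftIdealOf (h.complete.idem p)).1 a.2),
    fun h' => (h.mem_jacobson_iff _).1 h' p⟩

/-- Functionals on `rad(A) η_p` are functionals on `rad(A)`. -/
noncomputable def charSpaceKerEquiv {p : P} {S : ModuleCat.{v} A} (σ : CharModuleEquiv (χ p) S)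
    (q : P) : charSpace (χ q) (LinearMap.ker (cover (η := η) σ)) ≃ₗ[K]
      bicharSpace (χ q) (χ p) (Ring.jacobson A) where
  toFun f := ⟨
    { toFun m := f.1 ⟨⟨m * η p, mul_self_mem_leftIdealOf _ _⟩,
        (h.mem_ker_cover_iff σ).2 (Ideal.mul_mem_right _ _ m.2)⟩
      map_zero' := by
        rw [← map_zero f.1]
        congr 1
        ext
        simp
      map_add' m m' := by
        rw [← map_add f.1]
        congr 1
        ext
        simp [add_mul] }, fun a b m m' hm => by
      -- Modulo the radical, b η_p is χ_p(b) η_p. The error term j contributes f(a m j) = χ_q(a m)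
      -- f(j) = 0 because m is in the radical.
      have hj := h.mul_sub_mem_jacobson p b
      have hj' : b * η p - algebraMap K A (χ p b) * η p ∈ leftIdealOf (η p) :=
        sub_mem (mul_self_mem_leftIdealOf _ _) (mul_self_mem_leftIdealOf _ _)
      have h1 := f.2 (a * m) ⟨⟨_, hj'⟩, (h.mem_ker_cover_iff σ).2 hj⟩
      have h2 := f.2 (a * algebraMap K A (χ p b))
        ⟨⟨m * η p, mul_self_mem_leftIdealOf _ _⟩,
        (h.mem_ker_cover_iff σ).2 (Ideal.mul_mem_right _ _ m.2)⟩
      rw [map_mul, (h.mem_jacobson_iff _).1 m.2 q, mul_zero, zero_mul] at h1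
      rw [map_mul, AlgHom.commutes] at h2
      refine Eq.trans ?_ h2
      refine Eq.trans ?_ ((map_add f.1 _ _).trans ((congrArg (· + _) h1).trans (zero_add _)))
      refine congrArg f.1 ?_
      ext
      have hc : algebraMap K A (χ p b) * m = m * algebraMap K A (χ p b) :=
        Algebra.commutes _ _
      simp only [Submodule.coe_add, SetLike.val_smul, smul_eq_mul, hm, mul_sub, mul_assoc]
      rw [← mul_assoc (algebraMap K A (χ p b)) m.1, hc]
      simp only [mul_assoc, sub_add_cancel]⟩
  map_add' f g := rfl
  map_smul' c f := rfl
  invFun g := ⟨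
    { toFun m := g.1 ⟨m.1.1, (h.mem_ker_cover_iff σ).1 m.2⟩
      map_zero' := map_zero g.1
      map_add' m m' := map_add g.1 ⟨m.1.1, (h.mem_ker_cover_iff σ).1 m.2⟩
        ⟨m'.1.1, (h.mem_ker_cover_iff σ).1 m'.2⟩ }, fun a m => by
      have := g.2 a 1 ⟨m.1.1, (h.mem_ker_cover_iff σ).1 m.2⟩
        ⟨(a • m).1.1, (h.mem_ker_cover_iff σ).1 (a • m).2⟩ (by simp)
      rw [map_one, mul_one] at this
      exact this⟩
  left_inv f := by
    ext m
    refine congrArg f.1 ?_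
    ext
    exact (mem_leftIdealOf (h.complete.idem p)).1 m.1.2
  right_inv g := by
    ext m
    have := g.2 1 (η p) m ⟨m * η p, Ideal.mul_mem_right _ _ m.2⟩ (by simp)
    rw [map_one, one_mul, h.chi_self, one_mul] at this
    exact this

/-- This is the minimality of the cover: a radical element m = m η_p of A η_p has f(m) = χ_q(m)
f(η_p) = 0. -/
theorem charSpace_leftIdealOf_ker {p q : P} {S : ModuleCat.{v} A}
    (σ : CharModuleEquiv (χ p) S) (f : leftIdealOf (η p) →+ K)
    (hf : f ∈ charSpace (χ q) (leftIdealOf (η p))) (m : leftIdealOf (η p))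
    (hm : m ∈ LinearMap.ker (cover σ)) : f m = 0 := by
  have h1 := hf m ⟨1 * η p, mul_self_mem_leftIdealOf _ _⟩
  rw [(h.mem_jacobson_iff _).1 ((h.mem_ker_cover_iff σ).1 hm) q, zero_mul] at h1
  rw [← h1]
  congr 1
  ext
  simp [(mem_leftIdealOf (h.complete.idem p)).1 m.2]

/-- `Ext¹` between simple modules in terms of the radical. -/
noncomputable def extOneEquiv {p q : P} {S T : ModuleCat.{v} A}
    (σ : CharModuleEquiv (χ p) S) (τ : CharModuleEquiv (χ q) T) :
    Abelian.Ext.{v} S T 1 ≃ₗ[K] bicharSpace (χ q) (χ p) (Ring.jacobson A) :=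
  haveI := projective_leftIdealOf (h.complete.idem p)
  (extOneEquivCharSpace (cover σ) (h.cover_surjective σ) τ
    (h.charSpace_leftIdealOf_ker σ)).trans (h.charSpaceKerEquiv σ q)

/-- `Ext²` between simple modules from the second syzygy. -/
noncomputable def extTwoEquivCharSpace {p q : P} {S T : ModuleCat.{v} A}
    (σ : CharModuleEquiv (χ p) S) (τ : CharModuleEquiv (χ q) T) {M : Type v} [AddCommGroup M]
    [Module A M] [Module.Projective A M] (π : M →ₗ[A] LinearMap.ker (cover (η := η) σ))
    (hπ : Function.Surjective π)
    (hq : ∀ f ∈ charSpace (χ q) M, ∀ m ∈ LinearMap.ker π, f m = 0) :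
    Abelian.Ext.{v} S T 2 ≃ₗ[K] charSpace (χ q) (LinearMap.ker π) :=
  haveI := projective_leftIdealOf (h.complete.idem p)
  (extTwoEquivExtOne T (cover σ) (h.cover_surjective σ)).trans
    (extOneEquivCharSpace (L := ModuleCat.of A (LinearMap.ker (cover (η := η) σ))) π hπ τ hq)

end IsSplitSystem

/-! ### Intervals of rank one and two -/

section RankedIntervals

variable {P : Type w} [PartialOrder P] {p q z : P} {n : ℕ}

theorem ncard_image_flag (s : Flag (Set.Icc p q)) :
    (Subtype.val '' (s : Set (Set.Icc p q))).ncard = (s : Set (Set.Icc p q)).ncard :=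
  Set.ncard_image_of_injective _ Subtype.val_injective

theorem left_mem_image_flag (s : Flag (Set.Icc p q)) (h : p ≤ q) :
    p ∈ Subtype.val '' (s : Set (Set.Icc p q)) :=
  ⟨⟨p, le_rfl, h⟩, s.mem_iff_forall_le_or_ge.2 fun y _ => .inl y.2.1, rfl⟩

theorem right_mem_image_flag (s : Flag (Set.Icc p q)) (h : p ≤ q) :
    q ∈ Subtype.val '' (s : Set (Set.Icc p q)) :=
  ⟨⟨q, h, le_rfl⟩, s.mem_iff_forall_le_or_ge.2 fun y _ => .inr y.2.2, rfl⟩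

theorem exists_flag_Icc_of_isChain {c : Set P} (hc : IsChain (· ≤ ·) c) (hs : c ⊆ Set.Icc p q) :
    ∃ s : Flag (Set.Icc p q), c ⊆ Subtype.val '' (s : Set (Set.Icc p q)) := by
  have h : IsChain (· ≤ ·) (Subtype.val ⁻¹' c : Set (Set.Icc p q)) := fun x hx y hy hxy =>
    hc hx hy fun h => hxy (Subtype.ext h)
  obtain ⟨s, hs'⟩ := h.exists_subset_flag
  exact ⟨s, fun x hx => ⟨⟨x, hs hx⟩, hs' hx, rfl⟩⟩

variable [Finite P]

theorem RankEq.ncard_le (h : RankEq p q n) {c : Set P} (hc : IsChain (· ≤ ·) c)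
    (hs : c ⊆ Set.Icc p q) : c.ncard ≤ n + 1 := by
  obtain ⟨s, hs⟩ := exists_flag_Icc_of_isChain hc hs
  rw [← h.2 s, ← ncard_image_flag]
  exact Set.ncard_le_ncard hs (Set.toFinite _)

omit [Finite P] in
theorem isChain_triple (hpz : p ≤ z) (hzq : z ≤ q) : IsChain (· ≤ ·) ({p, z, q} : Set P) := by
  have := hpz.trans hzq
  rintro x hx y hy -
  rcases hx with rfl | rfl | rfl <;> rcases hy with rfl | rfl | rfl <;> simp [*]

omit [Finite P] in
theorem triple_subset_Icc (hpz : p ≤ z) (hzq : z ≤ q) : ({p, z, q} : Set P) ⊆ Set.Icc p q := by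
  rintro x (rfl | rfl | rfl)
  · exact ⟨le_rfl, hpz.trans hzq⟩
  · exact ⟨hpz, hzq⟩
  · exact ⟨hpz.trans hzq, le_rfl⟩

theorem ncard_triple (hpz : p < z) (hzq : z < q) : ({p, z, q} : Set P).ncard = 3 := by
  rw [Set.ncard_insert_of_notMem (by simp [hpz.ne, (hpz.trans hzq).ne]),
    Set.ncard_pair hzq.ne]

theorem rankEq_one_iff : RankEq p q 1 ↔ p ⋖ q := by
  constructor
  · intro h
    refine ⟨lt_of_le_of_ne h.1 ?_, fun z hpz hzq => ?_⟩
    · rintro rfl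
      obtain ⟨s, -⟩ := Flag.exists_mem (⟨p, le_rfl, le_rfl⟩ : Set.Icc p p)
      have h1 := h.2 s
      have h2 : (Subtype.val '' (s : Set (Set.Icc p p))) ⊆ {p} := by
        rintro _ ⟨x, -, rfl⟩
        exact le_antisymm x.2.2 x.2.1
      have h3 := Set.ncard_le_ncard h2 (Set.toFinite _)
      rw [ncard_image_flag, Set.ncard_singleton] at h3
      omega
    · have := h.ncard_le (isChain_triple hpz.le hzq.le) (triple_subset_Icc hpz.le hzq.le)
      rw [ncard_triple hpz hzq] at this
      omega
  · intro h
    refine ⟨h.le, fun s => ?_⟩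
    have hs : Subtype.val '' (s : Set (Set.Icc p q)) = {p, q} := by
      refine Set.Subset.antisymm ?_ ?_
      · rintro _ ⟨x, -, rfl⟩
        exact h.eq_or_eq x.2.1 x.2.2
      · rintro x (rfl | rfl)
        · exact left_mem_image_flag s h.le
        · exact right_mem_image_flag s h.le
    rw [← ncard_image_flag, hs, Set.ncard_pair h.lt.ne]

theorem RankEq.exists_between (h : RankEq p q 2) : ∃ z, p < z ∧ z < q := by
  obtain ⟨s, -⟩ := Flag.exists_mem (⟨p, le_rfl, h.1⟩ : Set.Icc p q)
  by_contra! hz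
  have hs : Subtype.val '' (s : Set (Set.Icc p q)) ⊆ {p, q} := by
    rintro _ ⟨x, -, rfl⟩
    by_contra hx
    rw [Set.mem_insert_iff, Set.mem_singleton_iff, not_or] at hx
    exact hz x (lt_of_le_of_ne x.2.1 (Ne.symm hx.1)) (lt_of_le_of_ne x.2.2 hx.2)
  have h1 := Set.ncard_le_ncard hs (Set.toFinite _)
  have h2 := Set.ncard_insert_le p {q}
  rw [Set.ncard_singleton] at h2
  rw [ncard_image_flag, h.2 s] at h1
  omega

/-- A further element between p and z, or between z and q, would give a chain of four elements,
while chains in an interval of rank two have at most three. -/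
theorem RankEq.covBy_of_lt (h : RankEq p q 2) (hpz : p < z) (hzq : z < q) : p ⋖ z ∧ z ⋖ q := by
  have key : ∀ a b : P, p < a → a < b → b < q → False := by
    intro a b hpa hab hbq
    have hc : IsChain (· ≤ ·) ({p, a, b, q} : Set P) := by
      refine (isChain_triple hab.le hbq.le).insert ?_
      rintro y (rfl | rfl | rfl) -
      · exact .inl hpa.le
      · exact .inl (hpa.trans hab).le
      · exact .inl h.1
    have hs : ({p, a, b, q} : Set P) ⊆ Set.Icc p q := by
      rintro y (rfl | rfl | rfl | rfl)
      · exact ⟨le_rfl, h.1⟩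
      · exact ⟨hpa.le, (hab.trans hbq).le⟩
      · exact ⟨(hpa.trans hab).le, hbq.le⟩
      · exact ⟨h.1, le_rfl⟩
    have := h.ncard_le hc hs
    rw [Set.ncard_insert_of_notMem
        (by simp [hpa.ne, (hpa.trans hab).ne, (hpa.trans (hab.trans hbq)).ne]),
      ncard_triple hab hbq] at this
    omega
  exact ⟨⟨hpz, fun a ha ha' => key a z ha ha' hzq⟩, ⟨hzq, fun b hb hb' => key z b hpz hb hb'⟩⟩

/-- The chain p ⋖ z ⋖ q cannot be refined, so it is a maximal chain with three elements; gradedness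
gives every other maximal chain the same size. -/
theorem IsGradedPoset.rankEq_two (hP : IsGradedPoset P) (hpz : p ⋖ z) (hzq : z ⋖ q) :
    RankEq p q 2 := by
  refine ⟨hpz.le.trans hzq.le, fun s => ?_⟩
  obtain ⟨t, ht⟩ := exists_flag_Icc_of_isChain (isChain_triple hpz.le hzq.le)
    (triple_subset_Icc hpz.le hzq.le)
  have htc : Subtype.val '' (t : Set (Set.Icc p q)) = {p, z, q} := by
    refine Set.Subset.antisymm ?_ ht
    rintro _ ⟨x, hx, rfl⟩
    obtain ⟨y, hy, hyz⟩ : z ∈ Subtype.val '' (t : Set (Set.Icc p q)) := ht (by simp)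
    rcases t.le_or_le hx hy with h | h
    · have h : x.1 ≤ y.1 := h
      rcases hpz.eq_or_eq x.2.1 (hyz ▸ h) with h | h <;> simp [h]
    · have h : y.1 ≤ x.1 := h
      rcases hzq.eq_or_eq (hyz ▸ h) x.2.2 with h | h <;> simp [h]
  rw [hP p q (hpz.lt.trans hzq.lt) s t, ← ncard_image_flag, htc, ncard_triple hpz.lt hzq.lt]

end RankedIntervals

/-! ### The filtration of the path algebra by path length -/

namespace PathAlgebra

variable {K : Type u} [Field K] {Q : Type w} [Quiver.{x} Q]

/-- The coefficient of a path. -/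
noncomputable def coeff (s : QuiverPath Q) : PathAlgebra K Q →ₗ[K] K :=
  Finsupp.lapply (M := K) (R := K) s

open Classical in
theorem coeff_ofPath (s t : QuiverPath Q) : coeff s (ofPath K t) = if t = s then 1 else 0 :=
  Finsupp.single_apply

theorem ext_coeff {f g : PathAlgebra K Q} (h : ∀ s, coeff s f = coeff s g) : f = g :=
  Finsupp.ext h

theorem span_ofPath : Submodule.span K (Set.range (ofPath K : QuiverPath Q → _)) = ⊤ := by
  rw [eq_top_iff]
  intro f _
  induction f using induction_paths with
  | zero => exact zero_mem _
  | add f g hf hg => exact add_mem (hf trivial) (hg trivial)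
  | smul c p => exact Submodule.smul_mem _ _ (Submodule.subset_span ⟨p, rfl⟩)

theorem linearMap_ext {M : Type*} [AddCommGroup M] [Module K M]
    {f g : PathAlgebra K Q →ₗ[K] M} (h : ∀ s, f (ofPath K s) = g (ofPath K s)) : f = g :=
  LinearMap.ext_on_range span_ofPath h

variable (K Q) in
/-- The span of the paths of length at least `n`. -/
noncomputable def filtration (n : ℕ) : Submodule K (PathAlgebra K Q) :=
  Submodule.span K (ofPath K '' {s | n ≤ s.2.2.length})

theorem ofPath_mem_filtration {n : ℕ} {s : QuiverPath Q} (h : n ≤ s.2.2.length) :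
    ofPath K s ∈ filtration K Q n :=
  Submodule.subset_span ⟨s, h, rfl⟩

theorem mem_filtration_iff {n : ℕ} {f : PathAlgebra K Q} :
    f ∈ filtration K Q n ↔ ∀ s : QuiverPath Q, s.2.2.length < n → coeff s f = 0 := by
  have h : filtration K Q n = Finsupp.supported K K {s : QuiverPath Q | n ≤ s.2.2.length} :=
    (Finsupp.supported_eq_span_single K _).symm
  rw [h]
  refine (Finsupp.mem_supported' K _).trans ?_
  simp only [Set.mem_ofPred_eq, not_le]
  rfl

theorem filtration_mono {m n : ℕ} (h : m ≤ n) : filtration K Q n ≤ filtration K Q m :=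
  Submodule.span_mono (Set.image_mono fun _ hs => h.trans hs)

theorem mem_filtration_zero (f : PathAlgebra K Q) : f ∈ filtration K Q 0 :=
  mem_filtration_iff.2 fun _ h => absurd h (Nat.not_lt_zero _)

theorem mul_mem_of_span {s t : Set (QuiverPath Q)} {N : Submodule K (PathAlgebra K Q)}
    (h : ∀ a ∈ s, ∀ b ∈ t, pathProd K a b ∈ N) {f g : PathAlgebra K Q}
    (hf : f ∈ Submodule.span K (ofPath K '' s)) (hg : g ∈ Submodule.span K (ofPath K '' t)) :
    f * g ∈ N := by
  have h1 : ∀ a ∈ s, ∀ g ∈ Submodule.span K (ofPath K '' t), ofPath K a * g ∈ N := by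
    intro a ha g hg
    have : Submodule.span K (ofPath K '' t) ≤ N.comap (mulLin K (ofPath K a)) := by
      rw [Submodule.span_le]
      rintro _ ⟨b, hb, rfl⟩
      change ofPath K a * ofPath K b ∈ N
      rw [ofPath_mul_ofPath]
      exact h a ha b hb
    exact this hg
  have : Submodule.span K (ofPath K '' s) ≤ N.comap ((mulLin K).flip g) := by
    rw [Submodule.span_le]
    rintro _ ⟨a, ha, rfl⟩
    exact h1 a ha g hg
  exact this hf

theorem pathProd_mem_filtration (a b : QuiverPath Q) :
    pathProd K a b ∈ filtration K Q (a.2.2.length + b.2.2.length) := by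
  obtain ⟨b₁, b₂, b⟩ := b
  obtain ⟨a₁, a₂, a⟩ := a
  by_cases h : a₁ = b₂
  · subst h
    rw [pathProd_comp]
    apply ofPath_mem_filtration
    simp [Quiver.Path.length_comp, add_comm]
  · rw [pathProd_of_ne K h]
    exact zero_mem _

theorem mul_mem_filtration {m n : ℕ} {f g : PathAlgebra K Q} (hf : f ∈ filtration K Q m)
    (hg : g ∈ filtration K Q n) : f * g ∈ filtration K Q (m + n) :=
  mul_mem_of_span (fun a ha b hb => filtration_mono (add_le_add ha hb)
    (pathProd_mem_filtration a b)) hf hg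

theorem mul_mem_filtration_left {n : ℕ} (f : PathAlgebra K Q) {g : PathAlgebra K Q}
    (hg : g ∈ filtration K Q n) : f * g ∈ filtration K Q n := by
  simpa using mul_mem_filtration (mem_filtration_zero f) hg

theorem mul_mem_filtration_right {n : ℕ} {f : PathAlgebra K Q} (g : PathAlgebra K Q)
    (hf : f ∈ filtration K Q n) : f * g ∈ filtration K Q n := by
  simpa using mul_mem_filtration hf (mem_filtration_zero g)

theorem arrow_mem_filtration {a b : Q} (e : a ⟶ b) : arrow K e ∈ filtration K Q 1 :=
  ofPath_mem_filtration (s := ⟨a, b, e.toPath⟩) (by simp)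

theorem ofPath_cons {a b c : Q} (s : Quiver.Path a b) (e : b ⟶ c) :
    ofPath K ⟨a, c, s.cons e⟩ = arrow K e * ofPath K ⟨a, b, s⟩ := by
  rw [arrow, ofPath_mul_ofPath, pathProd_comp]
  rfl

theorem vertex_mul_ofPath {a b : Q} (s : Quiver.Path a b) :
    vertex K b * ofPath K ⟨a, b, s⟩ = ofPath K ⟨a, b, s⟩ := by
  rw [vertex, ofPath_mul_ofPath, pathProd_comp, Quiver.Path.comp_nil]

theorem vertex_mul_ofPath_of_ne {v : Q} {s : QuiverPath Q} (h : v ≠ s.2.1) :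
    vertex K v * ofPath K s = 0 := by
  rw [vertex, ofPath_mul_ofPath, pathProd_of_ne K h]

theorem ofPath_mul_vertex {a b : Q} (s : Quiver.Path a b) :
    ofPath K ⟨a, b, s⟩ * vertex K a = ofPath K ⟨a, b, s⟩ := by
  rw [vertex, ofPath_mul_ofPath, pathProd_comp, Quiver.Path.nil_comp]

theorem ofPath_mul_vertex_of_ne {v : Q} {s : QuiverPath Q} (h : s.1 ≠ v) :
    ofPath K s * vertex K v = 0 := by
  rw [vertex, ofPath_mul_ofPath, pathProd_of_ne K h]

section Fintype

variable [Fintype Q]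

theorem mem_idealOf_iff {R : Set (PathAlgebra K Q)} {f : PathAlgebra K Q} :
    f ∈ idealOf R ↔ f ∈ TwoSidedIdeal.span R := TwoSidedIdeal.mem_asIdeal

theorem subset_idealOf (R : Set (PathAlgebra K Q)) : R ⊆ idealOf R := fun _ hr =>
  mem_idealOf_iff.2 (TwoSidedIdeal.subset_span hr)

theorem idealOf_le {R : Set (PathAlgebra K Q)} {I : Ideal (PathAlgebra K Q)} [I.IsTwoSided]
    (h : R ⊆ I) : idealOf R ≤ I := fun f hf => by
  have h1 : TwoSidedIdeal.span R ≤ I.toTwoSided := TwoSidedIdeal.span_le.2 fun r hr =>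
    Ideal.mem_toTwoSided.2 (h hr)
  exact Ideal.mem_toTwoSided.1 (h1 (mem_idealOf_iff.1 hf))

theorem algebraMap_mul (c : K) (f : PathAlgebra K Q) :
    algebraMap K (PathAlgebra K Q) c * f = c • f := (Algebra.smul_def c f).symm

/-- The ideal generated by `R` is spanned by the products of paths and elements of `R`. -/
theorem mem_span_of_mem_idealOf (R : Set (PathAlgebra K Q)) {f : PathAlgebra K Q}
    (hf : f ∈ idealOf R) : f ∈ Submodule.span K
      {g | ∃ s t : QuiverPath Q, ∃ r ∈ R, g = ofPath K s * r * ofPath K t} := by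
  obtain ⟨N, hN⟩ : ∃ N, N = Submodule.span K
      {g | ∃ s t : QuiverPath Q, ∃ r ∈ R, g = ofPath K s * r * ofPath K t} := ⟨_, rfl⟩
  have hgen (s t : QuiverPath Q) (r) (hr : r ∈ R) : ofPath K s * r * ofPath K t ∈ N :=
    hN ▸ Submodule.subset_span ⟨s, t, r, hr, rfl⟩
  have hmap (T : PathAlgebra K Q →ₗ[K] PathAlgebra K Q)
      (hT : ∀ s t : QuiverPath Q, ∀ r ∈ R, T (ofPath K s * r * ofPath K t) ∈ N) {b}
      (hb : b ∈ N) : T b ∈ N := by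
    rw [hN] at hb
    refine (Submodule.span_le (p := N.comap T)).2 ?_ hb
    rintro _ ⟨s, t, r, hr, rfl⟩
    exact hT s t r hr
  have hpl (u s t : QuiverPath Q) (r) (hr : r ∈ R) :
      ofPath K u * (ofPath K s * r * ofPath K t) ∈ N := by
    rw [← mul_assoc, ← mul_assoc, ofPath_mul_ofPath]
    unfold pathProd
    split_ifs with h
    · exact hgen _ t r hr
    · rw [zero_mul, zero_mul]
      exact zero_mem _
  have hpr (u s t : QuiverPath Q) (r) (hr : r ∈ R) :
      ofPath K s * r * ofPath K t * ofPath K u ∈ N := by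
    rw [mul_assoc, ofPath_mul_ofPath]
    unfold pathProd
    split_ifs with h
    · exact hgen s _ r hr
    · rw [mul_zero]
      exact zero_mem _
  have hl (a : PathAlgebra K Q) {b : PathAlgebra K Q} (hb : b ∈ N) : a * b ∈ N := by
    induction a using induction_paths with
    | zero => rw [zero_mul]; exact zero_mem _
    | add f g hf hg => rw [add_mul]; exact add_mem hf hg
    | smul c u =>
      rw [smul_mul_assoc]
      exact Submodule.smul_mem _ _ (hmap (mulLin K (ofPath K u)) (hpl u) hb)
  have hr' {b : PathAlgebra K Q} (a : PathAlgebra K Q) (hb : b ∈ N) : b * a ∈ N := by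
    induction a using induction_paths with
    | zero => rw [mul_zero]; exact zero_mem _
    | add f g hf hg => rw [mul_add]; exact add_mem hf hg
    | smul c u =>
      rw [mul_smul_comm]
      exact Submodule.smul_mem _ _ (hmap ((mulLin K).flip (ofPath K u)) (hpr u) hb)
  -- The span is closed under multiplication by paths on both sides, hence a two-sided ideal. It
  -- contains R because r is the sum of the ε_w r ε_v.
  let I : Ideal (PathAlgebra K Q) :=
    { carrier := N
      zero_mem' := zero_mem N
      add_mem' := add_mem
      smul_mem' := fun a _ hb => hl a hb }
  have : I.IsTwoSided := ⟨fun b hb => hr' b hb⟩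
  rw [← hN]
  refine idealOf_le (I := I) (fun r hr => ?_) hf
  change r ∈ N
  rw [← mul_one r, ← one_mul r, one_eq_sum, Finset.sum_mul, Finset.sum_mul]
  refine sum_mem fun v _ => ?_
  rw [Finset.mul_sum]
  exact sum_mem fun w _ => hgen _ _ r hr

variable (K Q) in
/-- The filtration as ideals. -/
noncomputable def filtrationIdeal (n : ℕ) : Ideal (PathAlgebra K Q) where
  carrier := filtration K Q n
  zero_mem' := zero_mem _
  add_mem' := add_mem
  smul_mem' := fun a _ hb => mul_mem_filtration_left a hb

instance arrowIdeal_isTwoSided : (arrowIdeal K Q).IsTwoSided :=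
  idealOf_isTwoSided K _

instance filtrationIdeal_isTwoSided (n : ℕ) : (filtrationIdeal K Q n).IsTwoSided :=
  ⟨fun b hb => mul_mem_filtration_right b hb⟩

theorem arrow_mem_arrowIdeal {a b : Q} (e : a ⟶ b) : arrow K e ∈ arrowIdeal K Q :=
  subset_idealOf _ ⟨a, b, e, rfl⟩

theorem smul_mem_ideal (I : Ideal (PathAlgebra K Q)) (c : K) {f : PathAlgebra K Q}
    (hf : f ∈ I) : c • f ∈ I := by
  rw [← algebraMap_mul]
  exact I.mul_mem_left _ hf

theorem ofPath_mem_arrowIdeal_pow (n : ℕ) {a b : Q} (s : Quiver.Path a b)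
    (h : n ≤ s.length) : ofPath K ⟨a, b, s⟩ ∈ arrowIdeal K Q ^ n := by
  induction s generalizing n with
  | nil =>
    obtain rfl : n = 0 := Nat.le_zero.1 h
    rw [Submodule.pow_zero, Ideal.one_eq_top]
    trivial
  | cons s e ih =>
    rw [ofPath_cons]
    cases n with
    | zero =>
      rw [Submodule.pow_zero, Ideal.one_eq_top]
      trivial
    | succ n =>
      rw [Ideal.IsTwoSided.pow_succ]
      exact Ideal.mul_mem_mul (arrow_mem_arrowIdeal e) (ih n (by simpa using h))

/-- Translates powers of the arrow ideal into bounds on path length, so that admissibility can be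
read off from coefficients. -/
theorem arrowIdeal_pow_eq (n : ℕ) : arrowIdeal K Q ^ n = filtrationIdeal K Q n := by
  apply le_antisymm
  · induction n with
    | zero => exact fun f _ => mem_filtration_zero f
    | succ n ih =>
      rw [Submodule.pow_succ, Ideal.mul_le]
      intro f hf g hg
      refine mul_mem_filtration (ih hf) ?_
      have : arrowIdeal K Q ≤ filtrationIdeal K Q 1 := idealOf_le (by
        rintro _ ⟨a, b, e, rfl⟩
        exact arrow_mem_filtration e)
      exact this hg
  · intro f hf
    change f ∈ Submodule.span K _ at hf
    induction hf using Submodule.span_induction with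
    | mem _ h =>
      obtain ⟨s, hs, rfl⟩ := h
      exact ofPath_mem_arrowIdeal_pow n s.2.2 hs
    | zero => exact zero_mem _
    | add _ _ _ _ hf hg => exact add_mem hf hg
    | smul c _ _ hf => exact smul_mem_ideal _ c hf

end Fintype

/-! ### Homomorphisms out of the path algebra -/

section Lift

variable {A : Type v} [Ring A] (η : Q → A) (X : ∀ a b : Q, (a ⟶ b) → A)

/-- The value of a path under an assignment of elements to vertices and arrows. -/
def pathValue {a : Q} : ∀ {b : Q}, Quiver.Path a b → A
  | _, .nil => η a
  | _, .cons s e => X _ _ e * pathValue s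

variable {η X}

theorem pathValue_mul (hη : ∀ a, IsIdempotentElem (η a)) {a b : Q} (s : Quiver.Path a b) :
    pathValue η X s * η a = pathValue η X s := by
  induction s with
  | nil => exact hη a
  | cons s e ih => rw [pathValue, mul_assoc, ih]

theorem mul_pathValue (hη : ∀ a, IsIdempotentElem (η a))
    (hl : ∀ a b e, η b * X a b e = X a b e) {a b : Q} (s : Quiver.Path a b) :
    η b * pathValue η X s = pathValue η X s := by
  cases s with
  | nil => exact hη a
  | cons s e => rw [pathValue, ← mul_assoc, hl]

theorem pathValue_comp (hη : ∀ a, IsIdempotentElem (η a))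
    (hl : ∀ a b e, η b * X a b e = X a b e) {a b c : Q} (s : Quiver.Path a b)
    (t : Quiver.Path b c) :
    pathValue η X (s.comp t) = pathValue η X t * pathValue η X s := by
  induction t with
  | nil => exact (mul_pathValue hη hl s).symm
  | cons t e ih =>
    rw [Quiver.Path.comp_cons, pathValue, ih, pathValue, mul_assoc]

variable [Algebra K A] [Fintype Q]

/-- The homomorphism out of the path algebra with prescribed values on vertices and arrows. -/
noncomputable def lift (hη : CompleteOrthogonalIdempotents η)
    (hl : ∀ a b e, η b * X a b e = X a b e) :
    PathAlgebra K Q →ₐ[K] A :=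
  AlgHom.ofLinearMap (lin fun s => pathValue η X s.2.2)
    (by
      rw [one_eq_sum, map_sum, ← hη.complete]
      exact Finset.sum_congr rfl fun v _ => lin_ofPath _ _)
    (fun f g => by
      induction f using induction_paths with
      | zero => simp
      | add f₁ f₂ h₁ h₂ => simp [add_mul, h₁, h₂]
      | smul c r =>
        induction g using induction_paths with
        | zero => simp
        | add f₁ f₂ h₁ h₂ => simp only [mul_add, map_add, h₁, h₂]
        | smul d q =>
          obtain ⟨a, b, q⟩ := q
          obtain ⟨b', c', r⟩ := r
          rw [smul_mul_smul_comm, ofPath_mul_ofPath, map_smul, map_smul, map_smul,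
            smul_mul_smul_comm, lin_ofPath, lin_ofPath]
          congr 1
          by_cases h : b' = b
          · subst h
            rw [pathProd_comp, lin_ofPath]
            exact pathValue_comp hη.idem hl q r
          · rw [pathProd_of_ne K h, map_zero]
            -- For non-composable paths the values are separated by two distinct orthogonal
            -- idempotents, so their product vanishes.
            have h1 := pathValue_mul (X := X) hη.idem r
            have h2 := mul_pathValue hη.idem hl q
            change 0 = pathValue η X r * pathValue η X q
            rw [← h1, ← h2, mul_assoc, ← mul_assoc (η b'), hη.ortho h, zero_mul, mul_zero])

theorem lift_ofPath (hη : CompleteOrthogonalIdempotents η)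
    (hl : ∀ a b e, η b * X a b e = X a b e)
    (s : QuiverPath Q) : lift (K := K) hη hl (ofPath K s) = pathValue η X s.2.2 :=
  lin_ofPath _ s

theorem lift_vertex (hη : CompleteOrthogonalIdempotents η)
    (hl : ∀ a b e, η b * X a b e = X a b e)
    (a : Q) : lift (K := K) hη hl (vertex K a) = η a :=
  lin_ofPath _ _

theorem lift_arrow (hη : CompleteOrthogonalIdempotents η)
    (hl : ∀ a b e, η b * X a b e = X a b e) (hr : ∀ a b e, X a b e * η a = X a b e)
    {a b : Q} (e : a ⟶ b) : lift (K := K) hη hl (arrow K e) = X a b e :=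
  (lift_ofPath hη hl _).trans (hr a b e)

end Lift

/-! ### Characters of the path algebra -/

section Character

variable [Fintype Q]

open Classical in
variable (K) in
/-- The character of the path algebra at a vertex. -/
noncomputable def character (v : Q) : PathAlgebra K Q →ₐ[K] K :=
  lift (η := fun a : Q => if a = v then (1 : K) else 0) (X := fun _ _ _ => 0)
    { idem := fun a => by by_cases h : a = v <;> simp [h, IsIdempotentElem]
      ortho := fun a b hab => by
        by_cases h : a = v
        · have : b ≠ v := fun h' => hab (h.trans h'.symm)
          simp [this]
        · simp [h]
      complete := by simp }
    (by simp)

open Classical in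
theorem character_vertex (v a : Q) :
    character K v (vertex K a) = if a = v then (1 : K) else 0 :=
  lift_vertex _ _ _

theorem character_of_mem_filtration (v : Q) {f : PathAlgebra K Q} (hf : f ∈ filtration K Q 1) :
    character K v f = 0 := by
  have : filtration K Q 1 ≤ LinearMap.ker (character K v).toLinearMap := by
    rw [filtration, Submodule.span_le]
    rintro _ ⟨⟨a, b, s⟩, hs, rfl⟩
    cases s with
    | nil => exact absurd hs (by simp)
    | cons s e =>
      change character K v _ = 0
      rw [character, lift_ofPath, pathValue, zero_mul]
  exact this hf

theorem sub_sum_mem_filtration (f : PathAlgebra K Q) :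
    f - ∑ v : Q, character K v f • vertex K v ∈ filtration K Q 1 := by
  classical
  induction f using induction_paths with
  | zero => simp
  | add f g hf hg =>
    have := add_mem hf hg
    simp only [map_add, add_smul, Finset.sum_add_distrib]
    convert this using 1
    abel
  | smul c s =>
    have : ofPath K s - ∑ v : Q, character K v (ofPath K s) • vertex K v ∈
        filtration K Q 1 := by
      obtain ⟨a, b, s⟩ := s
      cases s with
      | nil =>
        have : (∑ v : Q, character K v (vertex K a) • vertex K v) = vertex K a := by
          simp [character_vertex]
        change vertex K a - (∑ v : Q, character K v (vertex K a) • vertex K v) ∈ _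
        rw [this, sub_self]
        exact zero_mem _
      | cons s e =>
        have hm : ofPath K ⟨a, b, s.cons e⟩ ∈ filtration K Q 1 :=
          ofPath_mem_filtration (by simp)
        simp only [character_of_mem_filtration _ hm, zero_smul, Finset.sum_const_zero, sub_zero]
        exact hm
    have h2 := Submodule.smul_mem _ c this
    rw [smul_sub, Finset.smul_sum] at h2
    simpa only [map_smul, smul_assoc] using h2

theorem mem_filtration_one_iff {f : PathAlgebra K Q} :
    f ∈ filtration K Q 1 ↔ ∀ v, character K v f = 0 := by
  refine ⟨fun h v => character_of_mem_filtration v h, fun h => ?_⟩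
  simpa [h] using sub_sum_mem_filtration f

variable (K Q) in
theorem completeOrthogonalIdempotents_vertex :
    CompleteOrthogonalIdempotents (vertex K : Q → PathAlgebra K Q) where
  idem _ := vertex_mul_ofPath _
  ortho _ _ h := vertex_mul_ofPath_of_ne (s := ⟨_, _, .nil⟩) h
  complete := rfl

end Character

end PathAlgebra

/-! ### Nilpotency: paths in a Hasse diagram are short -/

namespace HasseQuiver

open PathAlgebra

variable {P : Type w} [PartialOrder P]

open Classical in
theorem card_filter_lt_of_lt [Fintype P] {a b : P} (h : a < b) :
    (Finset.univ.filter fun z : P => z < a).card <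
      (Finset.univ.filter fun z : P => z < b).card := by
  apply Finset.card_lt_card
  rw [Finset.ssubset_iff_of_subset]
  · exact ⟨a, by simpa using h, by simp⟩
  · intro z hz
    simp only [Finset.mem_filter, Finset.mem_univ, true_and] at hz ⊢
    exact hz.trans h

open Classical in
theorem card_filter_lt_lt_card [Fintype P] (a : P) :
    (Finset.univ.filter fun z : P => z < a).card < Fintype.card P :=
  Finset.card_lt_univ_of_notMem (x := a) (by simp)

/-- Along each arrow the number of elements strictly below the current vertex increases, and this
number always stays below |P|. -/
theorem length_lt_card [Fintype P] {a b : HasseQuiver P} (s : Quiver.Path a b) :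
    s.length < Fintype.card P := by
  classical
  have key : s.length + (Finset.univ.filter fun z : P => @LT.lt P _ z a).card ≤
      (Finset.univ.filter fun z : P => @LT.lt P _ z b).card := by
    induction s with
    | nil => exact (Nat.zero_add _).le
    | @cons b c s e ih =>
      have hlt := card_filter_lt_of_lt e.down.lt
      rw [Quiver.Path.length_cons]
      omega
  have h2 := card_filter_lt_lt_card (P := P) b
  omega

end HasseQuiver

/-! ### Stripping the first arrow of a path -/

namespace PathAlgebra

variable {K : Type u} [Field K] {Q : Type w} [Quiver.{x} Q]

open Classical in
/-- Strip the first arrow of a path if it goes from `p` to `z`, and return zero otherwise. -/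
noncomputable def stripPath (K : Type u) [Field K] {Q : Type w} [Quiver.{x} Q] (p z : Q)
    {a : Q} : ∀ {b : Q}, Quiver.Path a b → PathAlgebra K Q
  | _, .nil => 0
  | b, .cons s e => if s.length = 0 then (if a = p ∧ b = z then vertex K b else 0)
      else arrow K e * stripPath K p z s

variable (p z : Q)

open Classical in
theorem stripPath_cons {a b c : Q} (s : Quiver.Path a b) (e : b ⟶ c) :
    stripPath K p z (s.cons e) =
      if s.length = 0 then (if a = p ∧ c = z then vertex K c else 0)
      else arrow K e * stripPath K p z s := rfl

theorem vertex_mul_stripPath {a b : Q} (s : Quiver.Path a b) :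
    vertex K b * stripPath K p z s = stripPath K p z s := by
  cases s with
  | nil => exact mul_zero' K _
  | cons s e =>
    rw [stripPath_cons]
    split_ifs
    · exact vertex_mul_ofPath _
    · exact mul_zero' K _
    · rw [← mul_assoc', arrow, vertex_mul_ofPath]

theorem stripPath_mul_vertex {a b : Q} (s : Quiver.Path a b) :
    stripPath K p z s * vertex K z = stripPath K p z s := by
  induction s with
  | nil => exact zero_mul' K _
  | cons s e ih =>
    rw [stripPath_cons]
    split_ifs with h1 h2
    · rw [← h2.2]
      exact vertex_mul_ofPath _
    · exact zero_mul' K _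
    · rw [mul_assoc', ih]

theorem stripPath_mem_filtration {a b : Q} (s : Quiver.Path a b) :
    stripPath K p z s ∈ filtration K Q (s.length - 1) := by
  induction s with
  | nil => exact zero_mem _
  | cons s e ih =>
    rw [stripPath_cons]
    split_ifs with h1 h2
    · exact ofPath_mem_filtration (by simp [h1])
    · exact zero_mem _
    · refine filtration_mono ?_ (mul_mem_filtration (arrow_mem_filtration e) ih)
      rw [Quiver.Path.length_cons]
      omega

theorem stripPath_comp {a b c : Q} (s : Quiver.Path a b) (t : Quiver.Path b c)
    (hs : s.length ≠ 0) : stripPath K p z (s.comp t) = ofPath K ⟨b, c, t⟩ * stripPath K p z s := by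
  induction t with
  | nil => exact (vertex_mul_stripPath p z s).symm
  | cons t e ih =>
    rw [Quiver.Path.comp_cons, stripPath_cons,
      if_neg (by rw [Quiver.Path.length_comp]; omega), ih, ofPath_cons, mul_assoc']

/-- A path of positive length starting at p has exactly one first arrow. With at most one arrow
between two vertices, the target z identifies it, so one summand gives the path back. -/
theorem sum_stripPath_mul_arrow [∀ a b : Q, Subsingleton (a ⟶ b)] [Fintype (Quiver.Star p)]
    {a b : Q} (s : Quiver.Path a b) (hs : s.length ≠ 0) :
    ∑ i : Quiver.Star p, stripPath K p i.1 s * arrow K i.2 =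
      ofPath K ⟨a, b, s⟩ * vertex K p := by
  induction s with
  | nil => exact absurd rfl hs
  | @cons b c s e ih =>
    by_cases h0 : s.length = 0
    · obtain rfl := Quiver.Path.eq_of_length_zero s h0
      obtain rfl := Quiver.Path.eq_nil_of_length_zero s h0
      by_cases hp : a = p
      · subst hp
        rw [ofPath_mul_vertex, Finset.sum_eq_single (⟨c, e⟩ : Quiver.Star a)]
        · rw [stripPath_cons, if_pos h0, if_pos ⟨rfl, rfl⟩]
          exact vertex_mul_ofPath _
        · rintro ⟨z, e'⟩ _ hz
          rw [stripPath_cons, if_pos h0, if_neg, zero_mul']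
          rintro ⟨-, rfl⟩
          exact hz (by rw [Subsingleton.elim e e'])
        · simp
      · rw [ofPath_mul_vertex_of_ne (by exact hp)]
        refine Finset.sum_eq_zero fun z _ => ?_
        rw [stripPath_cons, if_pos h0, if_neg fun h => hp h.1, zero_mul']
    · rw [ofPath_cons, mul_assoc', ← ih h0, mul_eq_mulLin, map_sum]
      refine Finset.sum_congr rfl fun z _ => ?_
      rw [stripPath_cons, if_neg h0, mul_assoc', ← mul_eq_mulLin]

/-- The linear extension of `stripPath`. -/
noncomputable def strip : PathAlgebra K Q →ₗ[K] PathAlgebra K Q :=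
  lin fun s => stripPath K p z s.2.2

theorem strip_ofPath (s : QuiverPath Q) :
    strip p z (ofPath K s) = stripPath K p z s.2.2 := lin_ofPath _ _

theorem eq_of_mem_filtration {M : Type*} [AddCommGroup M] [Module K M] {n : ℕ}
    {f g : PathAlgebra K Q →ₗ[K] M}
    (h : ∀ (a b : Q) (s : Quiver.Path a b), n ≤ s.length →
      f (ofPath K ⟨a, b, s⟩) = g (ofPath K ⟨a, b, s⟩)) {m : PathAlgebra K Q}
    (hm : m ∈ filtration K Q n) : f m = g m := by
  have : filtration K Q n ≤ LinearMap.eqLocus f g := by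
    rw [filtration, Submodule.span_le]
    rintro _ ⟨s, hs, rfl⟩
    exact h _ _ _ hs
  exact this hm

/-- Stripping acts on the right end of a product, so it commutes with left multiplication. Paths of
positive length are needed: if `m` is an empty path, the first arrow belongs to `f`. -/
theorem strip_mul (f : PathAlgebra K Q) {m : PathAlgebra K Q}
    (hm : m ∈ filtration K Q 1) : strip p z (f * m) = f * strip p z m := by
  induction f using induction_paths with
  | zero => rw [zero_mul', zero_mul', map_zero]
  | add f g hf hg => rw [add_mul', add_mul', map_add, hf, hg]
  | smul c t =>
    rw [smul_mul', smul_mul', map_smul]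
    congr 1
    refine eq_of_mem_filtration
      (f := (strip p z).comp (mulLin K (ofPath K t)))
      (g := (mulLin K (ofPath K t)).comp (strip p z)) ?_ hm
    intro a b s hs
    rw [LinearMap.comp_apply, LinearMap.comp_apply, ← mul_eq_mulLin, ← mul_eq_mulLin]
    obtain ⟨b', c, t⟩ := t
    rw [ofPath_mul_ofPath, strip_ofPath]
    by_cases h : b' = b
    · subst h
      rw [pathProd_comp, strip_ofPath]
      exact stripPath_comp p z s t (by omega)
    · rw [pathProd_of_ne K (by exact h), map_zero, ← ofPath_mul_vertex, mul_assoc',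
        ← vertex_mul_stripPath p z s, ← mul_assoc' K (vertex K b'), show vertex K b' * vertex K b = 0 from
          vertex_mul_ofPath_of_ne (s := ⟨b, b, .nil⟩) h, zero_mul', mul_zero']

theorem strip_mul_vertex (m : PathAlgebra K Q) :
    strip p z m * vertex K z = strip p z m := by
  refine eq_of_mem_filtration (n := 0)
      (f := ((mulLin K).flip (vertex K z)).comp (strip p z))
      (g := strip p z) ?_ (mem_filtration_zero m)
  intro a b s _
  rw [LinearMap.comp_apply, LinearMap.flip_apply, ← mul_eq_mulLin, strip_ofPath,
    stripPath_mul_vertex]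

theorem strip_mem_filtration {n : ℕ} {m : PathAlgebra K Q}
    (hm : m ∈ filtration K Q (n + 1)) : strip p z m ∈ filtration K Q n := by
  refine (Submodule.span_le (p := (filtration K Q n).comap (strip p z))).2 ?_ hm
  rintro _ ⟨s, hs, rfl⟩
  change strip p z (ofPath K s) ∈ filtration K Q n
  rw [strip_ofPath]
  exact filtration_mono (Nat.le_sub_one_of_lt hs) (stripPath_mem_filtration p z s.2.2)

theorem stripPath_of_ne {a b : Q} (s : Quiver.Path a b) (ha : a ≠ p) :
    stripPath K p z s = 0 := by
  induction s with
  | nil => rfl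
  | cons s e ih =>
    rw [stripPath_cons, ih, mul_zero', if_neg (fun h => ha h.1 : ¬ (a = p ∧ _ = z)), ite_self]

open Classical in
theorem strip_mul_vertex_right (v : Q) (m : PathAlgebra K Q) :
    strip p z (m * vertex K v) = if v = p then strip p z m else 0 := by
  induction m using induction_paths with
  | zero => simp [zero_mul']
  | add f g hf hg =>
    rw [add_mul', map_add, hf, hg, map_add]
    split_ifs
    · rfl
    · exact add_zero 0
  | smul c s =>
    obtain ⟨a, b, s⟩ := s
    rw [smul_mul', map_smul, map_smul]
    by_cases hv : a = v
    · subst hv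
      rw [ofPath_mul_vertex]
      split_ifs with h
      · rfl
      · rw [strip_ofPath, stripPath_of_ne p z s h, smul_zero]
    · rw [ofPath_mul_vertex_of_ne (by exact hv), map_zero, smul_zero]
      split_ifs with h
      · rw [strip_ofPath, stripPath_of_ne p z s (by rw [← h]; exact hv), smul_zero]
      · rfl

theorem sum_strip_mul_arrow [∀ a b : Q, Subsingleton (a ⟶ b)] [Fintype (Quiver.Star p)]
    {m : PathAlgebra K Q} (hm : m ∈ filtration K Q 1) :
    ∑ i : Quiver.Star p, strip p i.1 m * arrow K i.2 = m * vertex K p := by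
  have := eq_of_mem_filtration (n := 1)
      (f := ∑ i : Quiver.Star p, ((mulLin K).flip (arrow K i.2)).comp (strip p i.1))
      (g := (mulLin K).flip (vertex K p)) (fun a b s hs => by
        rw [LinearMap.sum_apply, LinearMap.flip_apply, ← mul_eq_mulLin,
          ← sum_stripPath_mul_arrow p s (by omega)]
        refine Finset.sum_congr rfl fun i _ => ?_
        rw [LinearMap.comp_apply, LinearMap.flip_apply, ← mul_eq_mulLin, strip_ofPath]) hm
  rw [LinearMap.sum_apply] at this
  exact this

open Classical in
theorem strip_arrow {z' : Q} (e : p ⟶ z') :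
    strip p z (arrow K e) = if z' = z then vertex K z' else 0 := by
  rw [arrow, strip_ofPath]
  change stripPath K p z (Quiver.Path.nil.cons e) = _
  rw [stripPath_cons, if_pos Quiver.Path.length_nil]
  by_cases hz : z' = z
  · rw [if_pos ⟨rfl, hz⟩, if_pos hz]
  · rw [if_neg fun h => hz h.2, if_neg hz]

end PathAlgebra

open PathAlgebra

/-- A surjection from a path algebra whose kernel lies in the square of the arrow ideal,
compatible with split systems of idempotents. -/
structure IsPathPresentation {K : Type u} [Field K] {A : Type v} [Ring A] [Algebra K A]
    {Q : Type w} [Quiver.{x} Q] [Fintype Q] (φ : PathAlgebra K Q →ₐ[K] A) (η : Q → A)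
    (χ : Q → A →ₐ[K] K) : Prop where
  split : IsSplitSystem η χ
  surjective : Function.Surjective φ
  map_vertex (p : Q) : φ (vertex K p) = η p
  chi_map (p : Q) (f : PathAlgebra K Q) : χ p (φ f) = character K p f
  mem_filtration_of_map_eq_zero (f : PathAlgebra K Q) : φ f = 0 → f ∈ filtration K Q 2

namespace PathAlgebra

variable {K : Type u} [Field K] {Q : Type w} [Quiver.{x} Q]

theorem arrow_mul_vertex {a b : Q} (e : a ⟶ b) : arrow K e * vertex K a = arrow K e :=
  ofPath_mul_vertex _

theorem vertex_mul_arrow {a b : Q} (e : a ⟶ b) : vertex K b * arrow K e = arrow K e :=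
  vertex_mul_ofPath _

end PathAlgebra

/-! ### The second syzygy of a simple module and Ext² -/

namespace IsPathPresentation

variable {K : Type u} [Field K] {A : Type v} [Ring A] [Algebra K A]
  {Q : Type w} [Quiver.{x} Q] [Fintype Q] {φ : PathAlgebra K Q →ₐ[K] A} {η : Q → A}
  {χ : Q → A →ₐ[K] K}

theorem map_mem_jacobson_iff (h : IsPathPresentation φ η χ) {f : PathAlgebra K Q} :
    φ f ∈ Ring.jacobson A ↔ f ∈ filtration K Q 1 := by
  rw [h.split.mem_jacobson_iff, mem_filtration_one_iff]
  simp only [h.chi_map]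

theorem map_arrow_mul (h : IsPathPresentation φ η χ) {a b : Q} (e : a ⟶ b) :
    φ (arrow K e) * η a = φ (arrow K e) := by
  rw [← h.map_vertex, ← map_mul, arrow_mul_vertex]

variable {p : Q} {S : ModuleCat.{v} A} (σ : CharModuleEquiv (χ p) S) {ι : Type} [Fintype ι]
  (e : ι ≃ Quiver.Star p)

/-- The projective cover of `rad(A) η_p`. -/
noncomputable def radicalCover (h : IsPathPresentation φ η χ) :
    leftIdealSum (fun i => η (e i).1) →ₗ[A] LinearMap.ker (IsSplitSystem.cover (η := η) σ) where
  toFun v := ⟨⟨∑ i, v.1 i * φ (arrow K (e i).2), by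
      rw [mem_leftIdealOf (h.split.complete.idem p), Finset.sum_mul]
      exact Finset.sum_congr rfl fun i _ => by rw [mul_assoc, h.map_arrow_mul]⟩,
    (h.split.mem_ker_cover_iff σ).2 (sum_mem fun i _ => Ideal.mul_mem_left _ _
      (h.map_mem_jacobson_iff.2 (arrow_mem_filtration _)))⟩
  map_add' v w := by
    ext
    simp [add_mul, Finset.sum_add_distrib]
  map_smul' c v := by
    ext
    simp [mul_assoc, Finset.mul_sum]

variable (h : IsPathPresentation φ η χ)

theorem radicalCover_apply (v : leftIdealSum (fun i => η (e i).1)) :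
    ((radicalCover σ e h v).1 : A) = ∑ i, v.1 i * φ (arrow K (e i).2) := rfl

theorem mem_ker_radicalCover {v : leftIdealSum (fun i => η (e i).1)} :
    v ∈ LinearMap.ker (radicalCover σ e h) ↔ ∑ i, v.1 i * φ (arrow K (e i).2) = 0 := by
  rw [LinearMap.mem_ker, ← radicalCover_apply σ e h v, ← Submodule.coe_eq_zero,
    ← Submodule.coe_eq_zero]

omit [Fintype ι] in
include h in
theorem map_strip_mem (f : PathAlgebra K Q) :
    (fun i => φ (strip p (e i).1 f)) ∈ leftIdealSum (fun i => η (e i).1) := fun i => by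
  change φ _ * η _ = φ _
  rw [← h.map_vertex, ← map_mul]
  exact congrArg φ (strip_mul_vertex p _ f)

variable [∀ a b : Q, Subsingleton (a ⟶ b)]

theorem sum_strip_mul_arrow_equiv {m : PathAlgebra K Q} (hm : m ∈ filtration K Q 1) :
    ∑ i, strip p (e i).1 m * arrow K (e i).2 = m * vertex K p := by
  let _ : Fintype (Quiver.Star p) := Fintype.ofEquiv _ e
  rw [← sum_strip_mul_arrow p hm]
  exact e.sum_comp (fun j : Quiver.Star p => strip p j.1 m * arrow K j.2)

include h in
theorem sum_map_strip {m : PathAlgebra K Q} (hm : m ∈ filtration K Q 1) :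
    ∑ i, φ (strip p (e i).1 m) * φ (arrow K (e i).2) = φ m * η p := by
  rw [← h.map_vertex, ← map_mul, ← sum_strip_mul_arrow_equiv e hm, map_sum]
  exact Finset.sum_congr rfl fun i _ => (map_mul φ _ _).symm

/-- Together with `sum_strip_mul_arrow_equiv` this says that J ε_p is the direct sum of the left
modules KQ ε_z, one for each arrow z ← p, with stripping as the coordinate maps. -/
theorem strip_sum_arrow (c : ι → PathAlgebra K Q) (i : ι) :
    strip p (e i).1 (∑ j, c j * arrow K (e j).2) = c i * vertex K (e i).1 := by
  classical
  rw [map_sum, Finset.sum_eq_single i]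
  · rw [strip_mul p _ _ (arrow_mem_filtration _), strip_arrow, if_pos rfl]
  · intro j _ hj
    rw [strip_mul p _ _ (arrow_mem_filtration _), strip_arrow, if_neg, mul_zero]
    intro hij
    apply hj
    apply e.injective
    generalize e i = E at hij
    generalize e j = F at hij
    obtain ⟨a, f⟩ := E
    obtain ⟨b, g⟩ := F
    obtain rfl : b = a := hij
    rw [Subsingleton.elim f g]
  · simp

theorem radicalCover_surjective : Function.Surjective (radicalCover σ e h) := by
  rintro ⟨⟨a, ha⟩, hk⟩
  obtain ⟨m, rfl⟩ := h.surjective a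
  have hm : m ∈ filtration K Q 1 :=
    h.map_mem_jacobson_iff.1 ((h.split.mem_ker_cover_iff σ).1 hk)
  refine ⟨⟨_, h.map_strip_mem e m⟩, ?_⟩
  ext
  rw [radicalCover_apply]
  exact (h.sum_map_strip e hm).trans ((mem_leftIdealOf (h.split.complete.idem p)).1 ha)

/-- Elements of the second syzygy lift to the kernel of the presentation. -/
theorem exists_lift_of_mem_ker {v : leftIdealSum (fun i => η (e i).1)}
    (hv : v ∈ LinearMap.ker (radicalCover σ e h)) :
    ∃ m : PathAlgebra K Q, φ m = 0 ∧ ∀ i, φ (strip p (e i).1 m) = v.1 i := by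
  choose c hc using fun i => h.surjective (v.1 i)
  refine ⟨∑ j, c j * arrow K (e j).2, ?_, fun i => ?_⟩
  · rw [map_sum, ← (mem_ker_radicalCover σ e h).1 hv]
    exact Finset.sum_congr rfl fun i _ => by rw [map_mul, hc]
  · rw [strip_sum_arrow, map_mul, hc, h.map_vertex]
    exact v.2 i

/-- Minimality of the second step: a syzygy lifts to an element of ker φ ⊆ J². Stripping one arrow
leaves its coordinates in J, where every character vanishes. -/
theorem charSpace_ker_radicalCover {q : Q} (f : leftIdealSum (fun i => η (e i).1) →+ K)
    (hf : f ∈ charSpace (χ q) (leftIdealSum (fun i => η (e i).1)))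
    (v : leftIdealSum (fun i => η (e i).1)) (hv : v ∈ LinearMap.ker (radicalCover σ e h)) :
    f v = 0 := by
  classical
  obtain ⟨m, hm, hmv⟩ := exists_lift_of_mem_ker σ e h hv
  have hu (i : ι) : (Pi.single i (η (e i).1) : ι → A) ∈ leftIdealSum (fun i => η (e i).1) := by
    intro j
    by_cases hj : j = i
    · subst hj
      simp [(h.split.complete.idem _).eq]
    · simp [hj]
  -- The elements η_z placed in one coordinate generate the direct sum of the left ideals.
  have hsum : v = ∑ i, v.1 i • (⟨_, hu i⟩ : leftIdealSum (fun i => η (e i).1)) := by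
    ext j
    rw [AddSubmonoidClass.coe_finsetSum, Finset.sum_apply, Finset.sum_eq_single j]
    · simpa using (v.2 j).symm
    · intro i _ hi
      simp [Ne.symm hi]
    · simp
  rw [hsum, map_sum]
  refine Finset.sum_eq_zero fun i _ => ?_
  rw [hf, ← hmv, h.chi_map, character_of_mem_filtration q
    (strip_mem_filtration p _ (h.mem_filtration_of_map_eq_zero m hm)), zero_mul]

/-- The map from the kernel of the presentation to the second syzygy. -/
noncomputable def kerToSyzygy : RingHom.ker φ →+ LinearMap.ker (radicalCover σ e h) where
  toFun m := ⟨⟨_, h.map_strip_mem e m.1⟩, (mem_ker_radicalCover σ e h).2 (by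
    rw [h.sum_map_strip e (filtration_mono one_le_two (h.mem_filtration_of_map_eq_zero _ m.2)),
      show φ m.1 = 0 from m.2, zero_mul])⟩
  map_zero' := by
    ext
    simp
  map_add' m m' := by
    ext
    simp

theorem kerToSyzygy_apply (m : RingHom.ker φ) (i : ι) :
    (kerToSyzygy σ e h m).1.1 i = φ (strip p (e i).1 m.1) := rfl

theorem kerToSyzygy_surjective : Function.Surjective (kerToSyzygy σ e h) := by
  rintro ⟨v, hv⟩
  obtain ⟨m, hm, hmv⟩ := exists_lift_of_mem_ker σ e h hv
  refine ⟨⟨m, hm⟩, ?_⟩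
  ext i
  exact hmv i

-- Write b as ∑ χ_v(b) ε_v plus an element j of J. Stripping m j only affects j and leaves the
-- factor m, which φ kills; among the m ε_v only v = p survives.
omit [∀ a b : Q, Subsingleton (a ⟶ b)] in
theorem map_strip_mul (b m : PathAlgebra K Q) (hm : φ m = 0) (z : Q) :
    φ (strip p z (m * b)) = algebraMap K A (character K p b) * φ (strip p z m) := by
  classical
  have hb := sub_sum_mem_filtration b
  set j := b - ∑ v : Q, character K v b • vertex K v with hj
  have hb' : m * b = (∑ v : Q, character K v b • (m * vertex K v)) + m * j := by
    rw [hj, mul_sub, Finset.mul_sum]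
    simp only [mul_smul_comm]
    abel
  rw [hb', map_add, map_add, strip_mul p z m hb, map_mul, hm, zero_mul, add_zero, map_sum,
    ← Algebra.smul_def]
  simp only [map_smul, strip_mul_vertex_right]
  simp

/-- On the syzygy the right action degenerates to the character at p; this is why functionals on the
syzygy pull back to bi-equivariant ones. -/
theorem kerToSyzygy_mul_mul (a b : PathAlgebra K Q) (m m' : RingHom.ker φ)
    (hm : m'.1 = a * m.1 * b) : kerToSyzygy σ e h m' =
      φ (algebraMap K _ (character K p b) * a) • kerToSyzygy σ e h m := by
  ext i
  have hm0 : φ m.1 = 0 := m.2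
  have hm2 := filtration_mono one_le_two
    (h.mem_filtration_of_map_eq_zero _ (show φ (m.1 * b) = 0 by rw [map_mul, hm0, zero_mul]))
  change φ (strip p (e i).1 m'.1) = φ (algebraMap K _ (character K p b) * a) *
    φ (strip p (e i).1 m.1)
  rw [hm, mul_assoc, strip_mul p _ _ hm2, map_mul, map_strip_mul b m.1 hm0, map_mul,
    AlgHom.commutes, ← mul_assoc, Algebra.commutes]

/-- A bi-equivariant functional vanishes on the kernel of the projection to the syzygy. -/
theorem bicharSpace_apply_eq_zero {q : Q} (g : RingHom.ker φ →+ K)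
    (hg : g ∈ bicharSpace (character K q) (character K p) (RingHom.ker φ)) (m : RingHom.ker φ)
    (hm : kerToSyzygy σ e h m = 0) : g m = 0 := by
  have hm1 := filtration_mono one_le_two (h.mem_filtration_of_map_eq_zero _ m.2)
  have hz (i : ι) : φ (strip p (e i).1 m.1) = 0 := by
    rw [← kerToSyzygy_apply σ e h, hm]
    rfl
  have h1 := hg 1 (vertex K p) m ⟨m.1 * vertex K p, Ideal.mul_mem_right _ _ m.2⟩
    (by rw [one_mul])
  rw [map_one, one_mul, character_vertex, if_pos rfl, one_mul] at h1
  rw [← h1]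
  -- If all stripped parts lie in ker φ, then m ε_p lies in (ker φ) J, where the character on the
  -- right gives zero.
  have h2 : (⟨m.1 * vertex K p, Ideal.mul_mem_right _ _ m.2⟩ : RingHom.ker φ) =
      ∑ i, ⟨strip p (e i).1 m.1 * arrow K (e i).2, Ideal.mul_mem_right _ _ (hz i)⟩ := by
    ext
    rw [AddSubmonoidClass.coe_finsetSum]
    exact (sum_strip_mul_arrow_equiv e hm1).symm
  rw [h2, map_sum]
  refine Finset.sum_eq_zero fun i _ => ?_
  rw [hg 1 (arrow K (e i).2) ⟨_, hz i⟩ _ (by rw [one_mul]),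
    character_of_mem_filtration _ (arrow_mem_filtration _), mul_zero, zero_mul]

theorem comp_kerToSyzygy_mem {q : Q} (f : LinearMap.ker (radicalCover σ e h) →+ K)
    (hf : f ∈ charSpace (χ q) (LinearMap.ker (radicalCover σ e h))) :
    f.comp (kerToSyzygy σ e h) ∈
      bicharSpace (character K q) (character K p) (RingHom.ker φ) := by
  intro a b m m' hm
  rw [AddMonoidHom.comp_apply, kerToSyzygy_mul_mul σ e h a b m m' hm, hf, h.chi_map, map_mul,
    AlgHom.commutes, mul_comm (algebraMap K K _)]
  rfl

/-- Functionals on the second syzygy are functionals on the kernel of the presentation. -/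
noncomputable def charSpaceSyzygyEquiv (q : Q) :
    charSpace (χ q) (LinearMap.ker (radicalCover σ e h)) ≃ₗ[K]
      bicharSpace (character K q) (character K p) (RingHom.ker φ) :=
  LinearEquiv.ofBijective
    { toFun f := ⟨f.1.comp (kerToSyzygy σ e h), comp_kerToSyzygy_mem σ e h f.1 f.2⟩
      map_add' f g := rfl
      map_smul' c f := rfl }
    (by
      constructor
      · intro f g hfg
        ext v
        obtain ⟨m, rfl⟩ := kerToSyzygy_surjective σ e h v
        exact DFunLike.congr_fun (congrArg Subtype.val hfg) m
      · intro g
        let f := AddMonoidHom.liftOfSurjective (kerToSyzygy σ e h)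
          (kerToSyzygy_surjective σ e h) ⟨g.1, fun m hm =>
            bicharSpace_apply_eq_zero σ e h g.1 g.2 m hm⟩
        have hf (m : RingHom.ker φ) : f (kerToSyzygy σ e h m) = g.1 m :=
          AddMonoidHom.liftOfRightInverse_comp_apply _ _ _ _ m
        refine ⟨⟨f, fun a v => ?_⟩, ?_⟩
        · obtain ⟨m, rfl⟩ := kerToSyzygy_surjective σ e h v
          obtain ⟨c, rfl⟩ := h.surjective a
          have := kerToSyzygy_mul_mul σ e h c 1 m ⟨c * m.1, Ideal.mul_mem_left _ _ m.2⟩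
            (by rw [mul_one])
          rw [map_one, map_one, one_mul] at this
          rw [← this, hf, hf, g.2 c 1 m _ (by rw [mul_one]), map_one, mul_one, h.chi_map]
        · ext m
          exact hf m)

/-- `Ext²` between simple modules in terms of the relations. -/
theorem nonempty_extTwoEquiv (h : IsPathPresentation φ η χ) (σ : CharModuleEquiv (χ p) S) [Finite (Quiver.Star p)] {q : Q} {T : ModuleCat.{v} A}
    (τ : CharModuleEquiv (χ q) T) :
    Nonempty (Abelian.Ext.{v} S T 2 ≃ₗ[K]
      bicharSpace (character K q) (character K p) (RingHom.ker φ)) := by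
  obtain ⟨n, ⟨e⟩⟩ := Finite.exists_equiv_fin (Quiver.Star p)
  have := projective_leftIdealSum (u := fun i => η (e.symm i).1)
    fun i => h.split.complete.idem _
  exact ⟨(h.split.extTwoEquivCharSpace σ τ (radicalCover σ e.symm h)
    (radicalCover_surjective σ e.symm h) (charSpace_ker_radicalCover σ e.symm h)).trans
    (charSpaceSyzygyEquiv σ e.symm h q)⟩

end IsPathPresentation

/-! ### Bi-equivariant functionals on ideals -/

section Functionals

variable {K : Type u} [Field K] {A : Type v} [Ring A] [Algebra K A]

/-- A space of functionals that is separated by one evaluation is one-dimensional. -/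
theorem nonempty_equiv_of_apply_ne_zero {I : Type*} [AddCommGroup I]
    {W : Submodule K (I →+ K)} {g : I →+ K} (hg : g ∈ W) {r : I} (hr : g r ≠ 0)
    (hW : ∀ f ∈ W, f r = 0 → f = 0) : Nonempty (W ≃ₗ[K] K) := by
  let ev : W →ₗ[K] K :=
    { toFun f := f.1 r
      map_add' f g := rfl
      map_smul' c f := rfl }
  refine ⟨LinearEquiv.ofBijective ev ⟨?_, fun c => ?_⟩⟩
  · rw [injective_iff_map_eq_zero]
    exact fun f hf => Subtype.ext (hW f.1 f.2 hf)
  · refine ⟨(c * (g r)⁻¹) • ⟨g, hg⟩, ?_⟩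
    change c * (g r)⁻¹ * g r = c
    field_simp

theorem eq_zero_of_apply_eq_zero {I : Type*} [AddCommGroup I] {W : Submodule K (I →+ K)}
    (e : W ≃ₗ[K] K) {f g : I →+ K} (hf : f ∈ W) (hg : g ∈ W) {r : I} (hr : g r ≠ 0)
    (hfr : f r = 0) : f = 0 := by
  have hne : e ⟨g, hg⟩ ≠ 0 := by
    rw [Ne, map_eq_zero_iff e e.injective]
    intro h
    have : g = 0 := congrArg Subtype.val h
    exact hr (by rw [this]; rfl)
  have h1 : (⟨f, hf⟩ : W) = (e ⟨f, hf⟩ * (e ⟨g, hg⟩)⁻¹) • ⟨g, hg⟩ := by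
    apply e.injective
    rw [map_smul, smul_eq_mul]
    field_simp
  have h2 : f = (e ⟨f, hf⟩ * (e ⟨g, hg⟩)⁻¹) • g := congrArg Subtype.val h1
  have h3 : (e ⟨f, hf⟩ * (e ⟨g, hg⟩)⁻¹) * g r = 0 := by
    rw [← hfr]
    exact (DFunLike.congr_fun h2 r).symm
  rcases mul_eq_zero.1 h3 with h | h
  · rw [h2, h, zero_smul]
  · exact absurd h hr

/-- The functional `m ↦ f (e m e')` is bi-equivariant if `f` vanishes on `J I + I J`. -/
theorem exists_mem_bicharSpace {χ ψ : A →ₐ[K] K} {e e' : A} (J : Set A)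
    (he : ∀ a, e * a - algebraMap K A (χ a) * e ∈ J)
    (he' : ∀ b, b * e' - algebraMap K A (ψ b) * e' ∈ J) (I : Ideal A) [I.IsTwoSided]
    (f : A →ₗ[K] K) (hl : ∀ j ∈ J, ∀ m ∈ I, f (j * m) = 0)
    (hr : ∀ j ∈ J, ∀ m ∈ I, f (m * j) = 0) :
    ∃ g ∈ bicharSpace χ ψ I, ∀ m : I, g m = f (e * m * e') := by
  refine ⟨⟨⟨fun m => f (e * m * e'), by simp⟩, fun m m' => by simp [mul_add, add_mul]⟩, ?_,
    fun m => rfl⟩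
  intro a b m m' hm
  change f (e * m' * e') = χ a * ψ b * f (e * m * e')
  -- Modulo `J`, `e * a` is a scalar multiple of `e` and `b * e'` one of `e'`; `f` does not see the
  -- error terms.
  have h1 := hl _ (he a) (m.1 * (b * e')) (Ideal.mul_mem_right _ _ m.2)
  have h2 := hr _ (he' b) (e * m.1) (Ideal.mul_mem_left _ _ m.2)
  rw [sub_mul, map_sub, sub_eq_zero] at h1
  rw [mul_sub, map_sub, sub_eq_zero] at h2
  calc f (e * m' * e') = f (e * a * (m.1 * (b * e'))) := by rw [hm]; simp only [mul_assoc]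
    _ = χ a * f (e * m.1 * (b * e')) := by
      rw [h1, ← Algebra.smul_def, smul_mul_assoc, map_smul, smul_eq_mul]
      simp only [mul_assoc]
    _ = χ a * ψ b * f (e * m * e') := by
      rw [h2, ← Algebra.smul_def, mul_smul_comm, map_smul, smul_eq_mul, mul_assoc, mul_assoc]

/-- The functional is only assumed additive; its `K`-linearity comes from equivariance under
`algebraMap`. -/
theorem eq_zero_of_mem_bicharSpace_of_span {χ ψ : A →ₐ[K] K} {I : Ideal A} {f : I →+ K}
    (hf : f ∈ bicharSpace χ ψ I) {s : Set A} (hs : ∀ a ∈ s, ∃ h : a ∈ I, f ⟨a, h⟩ = 0)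
    {m : I} (hm : m.1 ∈ Submodule.span K s) : f m = 0 := by
  let N : Submodule K A :=
    { carrier := {a | ∃ h : a ∈ I, f ⟨a, h⟩ = 0}
      zero_mem' := ⟨zero_mem I, map_zero f⟩
      add_mem' := by
        rintro a b ⟨ha, ha'⟩ ⟨hb, hb'⟩
        refine ⟨add_mem ha hb, ?_⟩
        have := map_add f ⟨a, ha⟩ ⟨b, hb⟩
        rw [ha', hb', add_zero] at this
        exact this
      smul_mem' := by
        rintro c a ⟨ha, ha'⟩
        have hca : c • a ∈ I := by
          rw [Algebra.smul_def]
          exact I.mul_mem_left _ ha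
        refine ⟨hca, ?_⟩
        rw [hf (algebraMap K A c) 1 ⟨a, ha⟩ ⟨c • a, hca⟩
          (by rw [mul_one]; exact Algebra.smul_def c a), ha', mul_zero] }
  obtain ⟨h, h'⟩ := (Submodule.span_le (p := N)).2 hs hm
  exact h'

end Functionals

namespace PathAlgebra

variable {K : Type u} [Field K] {Q : Type w} [Quiver.{x} Q] [Fintype Q]

omit [Fintype Q] in
theorem coeff_eq_zero_of_mem_filtration {n : ℕ} {m : PathAlgebra K Q}
    (hm : m ∈ filtration K Q n) {t : QuiverPath Q} (ht : t.2.2.length < n) : coeff t m = 0 :=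
  mem_filtration_iff.1 hm t ht

omit [Fintype Q] in
open Classical in
theorem coeff_vertex_mul (t : QuiverPath Q) (v : Q) (m : PathAlgebra K Q) :
    coeff t (vertex K v * m) = if v = t.2.1 then coeff t m else 0 := by
  induction m using induction_paths with
  | zero => simp [mul_zero']
  | add f g hf hg =>
    rw [mul_add', map_add, hf, hg, map_add]
    split_ifs
    · rfl
    · exact add_zero 0
  | smul c s =>
    obtain ⟨a, b, s⟩ := s
    rw [mul_smul', map_smul, map_smul]
    by_cases hv : v = b
    · subst hv
      rw [vertex_mul_ofPath, coeff_ofPath]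
      split_ifs with h1 h2
      · rfl
      · exact absurd (by rw [← h1]) h2
      · rfl
      · exact smul_zero c
    · rw [vertex_mul_ofPath_of_ne (by exact hv), map_zero, smul_zero, coeff_ofPath]
      split_ifs with h1 h2
      · exact absurd (h1.trans (by rw [← h2])) hv
      · exact (smul_zero c).symm
      · rfl

omit [Fintype Q] in
open Classical in
theorem coeff_mul_vertex (t : QuiverPath Q) (v : Q) (m : PathAlgebra K Q) :
    coeff t (m * vertex K v) = if v = t.1 then coeff t m else 0 := by
  induction m using induction_paths with
  | zero => simp [zero_mul']
  | add f g hf hg =>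
    rw [add_mul', map_add, hf, hg, map_add]
    split_ifs
    · rfl
    · exact add_zero 0
  | smul c s =>
    obtain ⟨a, b, s⟩ := s
    rw [smul_mul', map_smul, map_smul]
    by_cases hv : a = v
    · subst hv
      rw [ofPath_mul_vertex, coeff_ofPath]
      split_ifs with h1 h2
      · rfl
      · exact absurd (by rw [← h1]) h2
      · rfl
      · exact smul_zero c
    · rw [ofPath_mul_vertex_of_ne (by exact hv), map_zero, smul_zero, coeff_ofPath]
      split_ifs with h1 h2
      · exact absurd (by rw [h1, ← h2] : a = v) hv
      · exact (smul_zero c).symm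
      · rfl

/-- Modulo J, a is a combination of empty paths, and multiplying m by an element of J produces only
paths longer than t. -/
theorem coeff_mul_left (t : QuiverPath Q) (a : PathAlgebra K Q) {m : PathAlgebra K Q}
    (hm : m ∈ filtration K Q t.2.2.length) :
    coeff t (a * m) = character K t.2.1 a * coeff t m := by
  classical
  have hj := sub_sum_mem_filtration a
  set j := a - ∑ v : Q, character K v a • vertex K v with hjdef
  have ha : a = (∑ v : Q, character K v a • vertex K v) + j := by rw [hjdef]; abel
  have hjm : coeff t (j * m) = 0 :=
    coeff_eq_zero_of_mem_filtration (mul_mem_filtration hj hm) (by omega)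
  conv_lhs => rw [ha]
  rw [add_mul, map_add, hjm, add_zero, Finset.sum_mul, map_sum]
  simp only [smul_mul_assoc, map_smul, coeff_vertex_mul]
  simp

theorem coeff_mul_right (t : QuiverPath Q) (a : PathAlgebra K Q) {m : PathAlgebra K Q}
    (hm : m ∈ filtration K Q t.2.2.length) :
    coeff t (m * a) = character K t.1 a * coeff t m := by
  classical
  have hj := sub_sum_mem_filtration a
  set j := a - ∑ v : Q, character K v a • vertex K v with hjdef
  have ha : a = (∑ v : Q, character K v a • vertex K v) + j := by rw [hjdef]; abel
  have hjm : coeff t (m * j) = 0 :=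
    coeff_eq_zero_of_mem_filtration (mul_mem_filtration hm hj) (by omega)
  conv_lhs => rw [ha]
  rw [mul_add, map_add, hjm, add_zero, Finset.mul_sum, map_sum]
  simp only [mul_smul_comm, map_smul, coeff_mul_vertex]
  simp

/-- The coefficient of a path of length `n` as a functional on an ideal inside the `n`-th step
of the filtration. -/
theorem exists_coeff_mem_bicharSpace (t : QuiverPath Q) (I : Ideal (PathAlgebra K Q))
    (hI : ∀ m ∈ I, m ∈ filtration K Q t.2.2.length) :
    ∃ g ∈ bicharSpace (character K t.2.1) (character K t.1) I, ∀ m : I, g m = coeff t m.1 := by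
  refine ⟨⟨⟨fun m => coeff t m.1, by simp⟩, fun m m' => by simp⟩, ?_, fun m => rfl⟩
  intro a b m m' hm
  change coeff t m'.1 = _ * coeff t m.1
  rw [hm, coeff_mul_right t b (mul_mem_filtration_left a (hI m m.2)),
    coeff_mul_left t a (hI m m.2)]
  ring

/-- A bi-equivariant functional on the ideal generated by `R` is determined by its values
on `R`. -/
theorem eq_zero_of_mem_bicharSpace_of_idealOf {χ ψ : PathAlgebra K Q →ₐ[K] K}
    {R : Set (PathAlgebra K Q)} {I : Ideal (PathAlgebra K Q)} [I.IsTwoSided]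
    (hI : ∀ m ∈ I, m ∈ idealOf R) {f : I →+ K} (hf : f ∈ bicharSpace χ ψ I)
    (hR : ∀ r ∈ R, ∃ h : r ∈ I, f ⟨r, h⟩ = 0) : f = 0 := by
  ext m
  refine eq_zero_of_mem_bicharSpace_of_span hf ?_ (mem_span_of_mem_idealOf R (hI m m.2))
  rintro _ ⟨s, t, r, hr, rfl⟩
  obtain ⟨h, h'⟩ := hR r hr
  refine ⟨Ideal.mul_mem_right _ _ (Ideal.mul_mem_left _ _ h), ?_⟩
  rw [hf (ofPath K s) (ofPath K t) ⟨r, h⟩ _ rfl, h', mul_zero]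

end PathAlgebra

namespace IsPathPresentation

variable {K : Type u} [Field K] {A : Type v} [Ring A] [Algebra K A]
  {Q : Type w} [Quiver.{x} Q] [Fintype Q] {φ : PathAlgebra K Q →ₐ[K] A} {η : Q → A}
  {χ : Q → A →ₐ[K] K} (h : IsPathPresentation φ η χ)

/-- A path of length at least two is an arrow times an element of J, and characters vanish on
arrows. -/
theorem apply_eq_zero_of_mem_filtration_two {p q : Q} {f : filtrationIdeal K Q 1 →+ K}
    (hf : f ∈ bicharSpace (character K q) (character K p) (filtrationIdeal K Q 1))
    (m : filtrationIdeal K Q 1) (hm : m.1 ∈ filtration K Q 2) : f m = 0 := by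
  refine eq_zero_of_mem_bicharSpace_of_span hf ?_ hm
  rintro _ ⟨⟨a, b, s⟩, hs, rfl⟩
  cases s with
  | nil => exact absurd hs (by simp)
  | cons s e =>
    have hs' : ofPath K ⟨a, _, s⟩ ∈ filtrationIdeal K Q 1 :=
      ofPath_mem_filtration (Nat.le_of_succ_le_succ hs)
    rw [ofPath_cons]
    refine ⟨Ideal.mul_mem_left _ _ hs', ?_⟩
    rw [hf (arrow K e) 1 ⟨_, hs'⟩ _ (by rw [mul_one]),
      character_of_mem_filtration _ (arrow_mem_filtration e), zero_mul, zero_mul]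

/-- The presentation, restricted to the radicals. -/
noncomputable def radicalMap : filtrationIdeal K Q 1 →+ Ring.jacobson A where
  toFun m := ⟨φ m.1, h.map_mem_jacobson_iff.2 m.2⟩
  map_zero' := by
    ext
    simp
  map_add' m m' := by
    ext
    simp

theorem radicalMap_surjective : Function.Surjective (radicalMap h) := by
  rintro ⟨a, ha⟩
  obtain ⟨m, rfl⟩ := h.surjective a
  exact ⟨⟨m, h.map_mem_jacobson_iff.1 ha⟩, rfl⟩

theorem comp_radicalMap_mem {p q : Q} (f : Ring.jacobson A →+ K)
    (hf : f ∈ bicharSpace (χ q) (χ p) (Ring.jacobson A)) : f.comp (radicalMap h) ∈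
      bicharSpace (character K q) (character K p) (filtrationIdeal K Q 1) := by
  intro a b m m' hm
  have := hf (φ a) (φ b) (radicalMap h m) (radicalMap h m') (by simp [radicalMap, hm])
  rw [h.chi_map, h.chi_map] at this
  exact this

/-- Functionals on the radical are functionals on the arrow ideal. -/
noncomputable def bicharSpaceRadicalEquiv (p q : Q) :
    bicharSpace (χ q) (χ p) (Ring.jacobson A) ≃ₗ[K]
      bicharSpace (character K q) (character K p) (filtrationIdeal K Q 1) :=
  LinearEquiv.ofBijective
    { toFun f := ⟨f.1.comp (radicalMap h), comp_radicalMap_mem h f.1 f.2⟩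
      map_add' f g := rfl
      map_smul' c f := rfl }
    (by
      constructor
      · intro f g hfg
        ext v
        obtain ⟨m, rfl⟩ := radicalMap_surjective h v
        exact DFunLike.congr_fun (congrArg Subtype.val hfg) m
      · intro g
        -- The functional descends to rad A because ker φ lies in J², where it vanishes.
        let f := AddMonoidHom.liftOfSurjective (radicalMap h) (radicalMap_surjective h)
          ⟨g.1, fun m hm => apply_eq_zero_of_mem_filtration_two g.2 m
            (h.mem_filtration_of_map_eq_zero _ (congrArg Subtype.val hm))⟩
        have hf (m : filtrationIdeal K Q 1) : f (radicalMap h m) = g.1 m :=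
          AddMonoidHom.liftOfRightInverse_comp_apply _ _ _ _ m
        refine ⟨⟨f, fun a b v v' hv => ?_⟩, ?_⟩
        · obtain ⟨m, rfl⟩ := radicalMap_surjective h v
          obtain ⟨c, rfl⟩ := h.surjective a
          obtain ⟨d, rfl⟩ := h.surjective b
          have hv' : v' = radicalMap h ⟨c * m.1 * d,
              Ideal.mul_mem_right _ _ (Ideal.mul_mem_left _ _ m.2)⟩ := by
            ext
            simp [hv, radicalMap]
          rw [hv', hf, hf, g.2 c d m _ rfl, h.chi_map, h.chi_map]
        · ext m
          exact hf m)

end IsPathPresentation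

namespace PathAlgebra

theorem apply_eq_zero_of_vertex_ne {K : Type u} [Field K] {Q : Type w} [Quiver.{x} Q]
    [Fintype Q] {p q p' q' : Q} {I : Ideal (PathAlgebra K Q)} {f : I →+ K}
    (hf : f ∈ bicharSpace (character K q) (character K p) I) (m : I)
    (hm : m.1 = vertex K q' * m.1 * vertex K p') (hne : ¬ (p' = p ∧ q' = q)) : f m = 0 := by
  have := hf (vertex K q') (vertex K p') m m hm
  rw [character_vertex, character_vertex] at this
  rw [this]
  by_cases h1 : p' = p
  · rw [if_neg fun h2 => hne ⟨h1, h2⟩, zero_mul, zero_mul]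
  · rw [if_neg h1, mul_zero, zero_mul]

end PathAlgebra

/-! ### Functionals on the arrow ideal and on the ideal of relations -/

namespace HasseQuiver

variable {P : Type w} [PartialOrder P]

instance subsingleton_hom (a b : HasseQuiver P) : Subsingleton (a ⟶ b) :=
  inferInstanceAs (Subsingleton (PLift (@CovBy P _ a b)))

instance finite_star [Fintype P] (p : HasseQuiver P) : Finite (Quiver.Star p) :=
  inferInstanceAs (Finite (Σ q : HasseQuiver P, (p ⟶ q)))

/-- The path `q ← z ← p`. -/
def twoStep {p z q : P} (hz : p ⋖ z) (hz' : z ⋖ q) : QuiverPath (HasseQuiver P) :=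
  ⟨p, q, (hom hz).toPath.cons (hom hz')⟩

theorem twoStep_injective {p z z' q : P} {hz : p ⋖ z} {hz' : z ⋖ q} {hy : p ⋖ z'} {hy' : z' ⋖ q}
    (h : twoStep hz hz' = twoStep hy hy') : z = z' := by
  have h1 := eq_of_heq (Sigma.mk.inj h).2
  have h2 := eq_of_heq (Sigma.mk.inj h1).2
  have h3 := Quiver.Path.obj_eq_of_cons_eq_cons h2
  exact h3

variable (K : Type u) [Field K]

theorem ofPath_twoStep {p z q : P} (hz : p ⋖ z) (hz' : z ⋖ q) :
    ofPath K (twoStep hz hz') = arrow K (hom hz') * arrow K (hom hz) :=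
  ofPath_cons _ _

variable [Fintype P] {p q : P}

open Classical in
theorem rankTwoRelation_eq (p q : P) : rankTwoRelation K p q =
    ∑ z : P, if h : p ⋖ z ∧ z ⋖ q then ofPath K (twoStep h.1 h.2) else 0 := rfl

theorem rankTwoRelation_induction {M : PathAlgebra K (HasseQuiver P) → Prop} (h0 : M 0)
    (hadd : ∀ a b, M a → M b → M (a + b))
    (h : ∀ (z : P) (hz : p ⋖ z) (hz' : z ⋖ q), M (ofPath K (twoStep hz hz'))) :
    M (rankTwoRelation K p q) := by
  rw [rankTwoRelation_eq]
  refine Finset.sum_induction _ M hadd h0 fun z _ => ?_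
  split_ifs with hz
  · exact h z hz.1 hz.2
  · exact h0

theorem rankTwoRelation_mem_degreePart (p q : P) :
    rankTwoRelation K p q ∈ degreePart K (HasseQuiver P) 2 :=
  rankTwoRelation_induction K (zero_mem _) (fun _ _ => add_mem)
    fun _ _ _ => Submodule.subset_span ⟨_, rfl, rfl⟩

theorem rankTwoRelation_mem_filtration (p q : P) :
    rankTwoRelation K p q ∈ filtration K (HasseQuiver P) 2 :=
  rankTwoRelation_induction K (zero_mem _) (fun _ _ => add_mem)
    fun _ _ _ => ofPath_mem_filtration le_rfl

theorem vertex_mul_rankTwoRelation (p q : P) :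
    vertex K (Q := HasseQuiver P) q * rankTwoRelation K p q = rankTwoRelation K p q :=
  rankTwoRelation_induction K (M := fun r => vertex K (Q := HasseQuiver P) q * r = r)
    (mul_zero' K _) (fun a b ha hb => by rw [mul_add, ha, hb])
    fun _ _ _ => vertex_mul_ofPath _

theorem rankTwoRelation_mul_vertex (p q : P) :
    rankTwoRelation K p q * vertex K (Q := HasseQuiver P) p = rankTwoRelation K p q :=
  rankTwoRelation_induction K (M := fun r => r * vertex K (Q := HasseQuiver P) p = r)
    (zero_mul' K _) (fun a b ha hb => by rw [add_mul, ha, hb])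
    fun _ _ _ => ofPath_mul_vertex _

theorem coeff_rankTwoRelation {z : P} (hz : p ⋖ z) (hz' : z ⋖ q) :
    coeff (twoStep hz hz') (rankTwoRelation K p q) = 1 := by
  classical
  rw [rankTwoRelation_eq, map_sum, Finset.sum_eq_single z]
  · rw [dif_pos ⟨hz, hz'⟩, coeff_ofPath, if_pos rfl]
  · intro y _ hy
    split_ifs with h
    · rw [coeff_ofPath, if_neg fun h' => hy (twoStep_injective h')]
    · exact map_zero _
  · simp

open Classical in
theorem map_rankTwoRelation {A : Type v} [Ring A] [Algebra K A]
    (φ : PathAlgebra K (HasseQuiver P) →ₐ[K] A) : φ (rankTwoRelation K p q) =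
        ∑ z : P, if h : p ⋖ z ∧ z ⋖ q then
        φ (arrow K (hom (P := P) h.2)) * φ (arrow K (hom (P := P) h.1)) else 0 := by
  rw [rankTwoRelation_eq, map_sum]
  refine Finset.sum_congr rfl fun z _ => ?_
  split_ifs
  · rw [ofPath_twoStep, map_mul]
  · exact map_zero _

theorem idealOf_hasseRelations_le {m : PathAlgebra K (HasseQuiver P)}
    (hm : m ∈ idealOf (hasseRelations K P)) : m ∈ filtration K (HasseQuiver P) 2 := by
  have : idealOf (hasseRelations K P) ≤ filtrationIdeal K (HasseQuiver P) 2 := idealOf_le (by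
    rintro _ ⟨p, q, -, rfl⟩
    exact rankTwoRelation_mem_filtration K p q)
  exact this hm

/-- A bi-equivariant functional belonging to `(p, q)` vanishes on the other relations. -/
theorem bicharSpace_apply_rankTwoRelation_of_ne {I : Ideal (PathAlgebra K (HasseQuiver P))}
    {f : I →+ K} {p' q' : P}
    (hf : f ∈ bicharSpace (character K (Q := HasseQuiver P) q)
      (character K (Q := HasseQuiver P) p) I) (hr : rankTwoRelation K p' q' ∈ I)
    (hne : ¬ (p' = p ∧ q' = q)) : f ⟨rankTwoRelation K p' q', hr⟩ = 0 :=
  apply_eq_zero_of_vertex_ne hf ⟨_, hr⟩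
    (by rw [vertex_mul_rankTwoRelation, rankTwoRelation_mul_vertex]) hne

/-- The coefficient of a path of length two detects the relation of an interval of rank two. -/
theorem exists_bicharSpace_apply_ne_zero (hpq : RankEq p q 2)
    {I : Ideal (PathAlgebra K (HasseQuiver P))}
    (hI : ∀ m ∈ I, m ∈ filtration K (HasseQuiver P) 2) (hr : rankTwoRelation K p q ∈ I) :
    ∃ g ∈ bicharSpace (character K (Q := HasseQuiver P) q)
      (character K (Q := HasseQuiver P) p) I, g ⟨rankTwoRelation K p q, hr⟩ ≠ 0 := by
  obtain ⟨z, hpz, hzq⟩ := hpq.exists_between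
  obtain ⟨hz, hz'⟩ := hpq.covBy_of_lt hpz hzq
  obtain ⟨g, hg, hg'⟩ := exists_coeff_mem_bicharSpace (K := K) (twoStep hz hz') I hI
  refine ⟨g, hg, ?_⟩
  rw [hg', coeff_rankTwoRelation]
  exact one_ne_zero

theorem rankTwoRelation_mem_idealOf (hpq : RankEq p q 2) :
    rankTwoRelation K p q ∈ idealOf (hasseRelations K P) :=
  subset_idealOf _ ⟨p, q, hpq, rfl⟩

/-- A functional is determined by its values on R, and the vertices at the ends kill every relation
except r_{p,q}. The coefficient of a path of length two shows that the value there can be nonzero.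
-/
theorem bicharSpace_idealOf_equiv (hpq : RankEq p q 2)
    {I : Ideal (PathAlgebra K (HasseQuiver P))} [I.IsTwoSided]
    (hI : I = idealOf (hasseRelations K P)) :
    Nonempty (bicharSpace (character K (Q := HasseQuiver P) q)
      (character K (Q := HasseQuiver P) p) I ≃ₗ[K] K) := by
  have hr : rankTwoRelation K p q ∈ I := hI ▸ rankTwoRelation_mem_idealOf K hpq
  obtain ⟨g, hg, hg'⟩ := exists_bicharSpace_apply_ne_zero K hpq (I := I)
    (fun m hm => idealOf_hasseRelations_le K (hI ▸ hm)) hr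
  refine nonempty_equiv_of_apply_ne_zero hg hg' fun f hf hfr => ?_
  refine eq_zero_of_mem_bicharSpace_of_idealOf (R := hasseRelations K P)
    (fun m hm => hI ▸ hm) hf ?_
  rintro _ ⟨p', q', h', rfl⟩
  refine ⟨hI ▸ rankTwoRelation_mem_idealOf K h', ?_⟩
  by_cases hne : p' = p ∧ q' = q
  · obtain ⟨rfl, rfl⟩ := hne
    exact hfr
  · exact bicharSpace_apply_rankTwoRelation_of_ne K hf _ hne

theorem bicharSpace_idealOf_subsingleton (hpq : ¬ RankEq p q 2)
    {I : Ideal (PathAlgebra K (HasseQuiver P))} [I.IsTwoSided]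
    (hI : I = idealOf (hasseRelations K P)) :
    Subsingleton (bicharSpace (character K (Q := HasseQuiver P) q)
      (character K (Q := HasseQuiver P) p) I) := by
  refine subsingleton_of_forall_eq 0 fun f => Subtype.ext ?_
  refine eq_zero_of_mem_bicharSpace_of_idealOf (R := hasseRelations K P)
    (fun m hm => hI ▸ hm) f.2 ?_
  rintro _ ⟨p', q', h', rfl⟩
  refine ⟨hI ▸ rankTwoRelation_mem_idealOf K h', ?_⟩
  refine bicharSpace_apply_rankTwoRelation_of_ne K f.2 _ ?_
  rintro ⟨rfl, rfl⟩
  exact hpq h'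

theorem mem_arrowIdeal_of_mem {m : PathAlgebra K (HasseQuiver P)}
    (hm : m ∈ filtrationIdeal K (HasseQuiver P) 1) : m ∈ idealOf
      {f | ∃ (a b : HasseQuiver P) (e : a ⟶ b), f = arrow K e} := by
  rw [← arrowIdeal_pow_eq, Submodule.pow_one] at hm
  exact hm

theorem bicharSpace_apply_arrow_of_ne {f : filtrationIdeal K (HasseQuiver P) 1 →+ K}
    {p q p' q' : HasseQuiver P}
    (hf : f ∈ bicharSpace (character K q) (character K p) (filtrationIdeal K (HasseQuiver P) 1))
    (e : p' ⟶ q') (hne : ¬ (p' = p ∧ q' = q)) :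
    f ⟨arrow K e, arrow_mem_filtration e⟩ = 0 :=
  apply_eq_zero_of_vertex_ne hf ⟨_, arrow_mem_filtration e⟩
    (by rw [vertex_mul_arrow, arrow_mul_vertex]) hne

/-- The same argument with the arrows as generators of J, and the coefficient of an arrow as the
functional. -/
theorem bicharSpace_arrow_equiv (hpq : p ⋖ q) :
    Nonempty (bicharSpace (character K (Q := HasseQuiver P) q)
      (character K (Q := HasseQuiver P) p) (filtrationIdeal K (HasseQuiver P) 1) ≃ₗ[K] K) := by
  obtain ⟨g, hg, hg'⟩ := exists_coeff_mem_bicharSpace (K := K)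
    (⟨p, q, (hom hpq).toPath⟩ : QuiverPath (HasseQuiver P))
    (filtrationIdeal K (HasseQuiver P) 1) (fun m hm => hm)
  refine nonempty_equiv_of_apply_ne_zero hg
    (r := ⟨arrow K (hom (P := P) hpq), arrow_mem_filtration _⟩) ?_ fun f hf hfr => ?_
  · have h1 : coeff (⟨p, q, (hom hpq).toPath⟩ : QuiverPath (HasseQuiver P))
        (ofPath K ⟨p, q, (hom hpq).toPath⟩) = 1 := by
      rw [coeff_ofPath, if_pos rfl]
    exact fun h0 => one_ne_zero (h1.symm.trans ((hg' _).symm.trans h0))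
  · refine eq_zero_of_mem_bicharSpace_of_idealOf (fun m hm => mem_arrowIdeal_of_mem K hm) hf ?_
    rintro _ ⟨p', q', e, rfl⟩
    refine ⟨arrow_mem_filtration e, ?_⟩
    by_cases hne : p' = p ∧ q' = q
    · obtain ⟨rfl, rfl⟩ := hne
      rw [Subsingleton.elim e (hom (P := P) hpq)]
      exact hfr
    · exact bicharSpace_apply_arrow_of_ne K hf e hne

theorem bicharSpace_arrow_subsingleton (hpq : ¬ p ⋖ q) :
    Subsingleton (bicharSpace (character K (Q := HasseQuiver P) q)
      (character K (Q := HasseQuiver P) p) (filtrationIdeal K (HasseQuiver P) 1)) := by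
  refine subsingleton_of_forall_eq 0 fun f => Subtype.ext ?_
  refine eq_zero_of_mem_bicharSpace_of_idealOf (fun m hm => mem_arrowIdeal_of_mem K hm) f.2 ?_
  rintro _ ⟨p', q', e, rfl⟩
  refine ⟨arrow_mem_filtration e, bicharSpace_apply_arrow_of_ne K f.2 e ?_⟩
  rintro ⟨rfl, rfl⟩
  exact hpq e.down

end HasseQuiver

open HasseQuiver

/-! ### Peirce decompositions -/

namespace CompleteOrthogonalIdempotents

variable {A : Type v} [Ring A] {ι : Type w} [Fintype ι] {η : ι → A}
  (h : CompleteOrthogonalIdempotents η)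

include h

theorem mul_mul_mul_eq_sum (a b e f : A) :
    e * (a * b) * f = ∑ z, (e * a * η z) * (η z * b * f) := by
  have (z : ι) : (e * a * η z) * (η z * b * f) = (e * a) * (η z * (b * f)) := by
    calc _ = e * a * (η z * η z * (b * f)) := by simp only [mul_assoc]
      _ = _ := by rw [(h.idem z).eq]
  simp only [this]
  rw [← Finset.mul_sum, ← Finset.sum_mul, h.complete, one_mul]
  simp only [mul_assoc]

theorem mem_of_forall_mul_mul_mem {σ : Type*} [SetLike σ A] [AddSubmonoidClass σ A] {s : σ}
    {a : A} (ha : ∀ p q, η q * a * η p ∈ s) : a ∈ s := by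
  have : a = ∑ q, ∑ p, η q * a * η p := by
    simp only [← Finset.mul_sum, h.complete, mul_one]
    rw [← Finset.sum_mul, h.complete, one_mul]
  rw [this]
  exact sum_mem fun q _ => sum_mem fun p _ => ha p q

end CompleteOrthogonalIdempotents

theorem toSpanSingleton_comp_self {A : Type v} [Ring A] {x : A} (hx : x * x = 0) :
    LinearMap.toSpanSingleton A A x ∘ₗ LinearMap.toSpanSingleton A A x = 0 := by
  ext
  simp [hx]

/-! ### Recognizing the Jacobson radical -/

section NilpotentRadical

variable {K : Type u} [Field K] {B : Type v} [Ring B] [Algebra K B] {P : Type w} [Fintype P]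

theorem mem_jacobson_of_forall_isNilpotent {b : B} (hb : ∀ a : B, IsNilpotent (a * b)) :
    b ∈ Ring.jacobson B := by
  rw [← Ideal.jacobson_bot, Ideal.mem_jacobson_iff]
  intro y
  obtain ⟨u, hu⟩ := (IsNilpotent.isUnit_add_one (hb y))
  refine ⟨(u⁻¹ : Bˣ), ?_⟩
  have h1 : (↑u⁻¹ : B) * (y * b + 1) = 1 := by rw [← hu, Units.inv_mul]
  rw [Ideal.mem_bot, mul_assoc, sub_eq_zero]
  rw [mul_add, mul_one] at h1
  exact h1

/-- If χ(b) ≠ 0, then χ kills 1 - χ(b)⁻¹ b, which therefore has no left inverse. -/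
theorem AlgHom.apply_eq_zero_of_mem_jacobson (χ : B →ₐ[K] K) {b : B}
    (hb : b ∈ Ring.jacobson B) : χ b = 0 := by
  by_contra hne
  rw [← Ideal.jacobson_bot, Ideal.mem_jacobson_iff] at hb
  obtain ⟨z, hz⟩ := hb (-algebraMap K B (χ b)⁻¹)
  have := congrArg χ (Ideal.mem_bot.1 hz)
  simp [hne] at this

end NilpotentRadical

/-! ### The converse: the algebra KQ(P)/(R) -/

section Converse

variable (K : Type u) [Field K] (P : Type w) [PartialOrder P] [Fintype P]

/-- The projection onto the quotient by the relations. -/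
noncomputable def hasseProjection :
    PathAlgebra K (HasseQuiver P) →ₐ[K] BoundQuiverAlgebra K (hasseRelations K P) :=
  Ideal.Quotient.mkₐ K (idealOf (hasseRelations K P))

theorem hasseProjection_surjective : Function.Surjective (hasseProjection K P) :=
  Ideal.Quotient.mkₐ_surjective K _

theorem hasseProjection_eq_zero_iff {f : PathAlgebra K (HasseQuiver P)} :
    hasseProjection K P f = 0 ↔ f ∈ idealOf (hasseRelations K P) :=
  Ideal.Quotient.eq_zero_iff_mem

theorem ker_hasseProjection :
    RingHom.ker (hasseProjection K P) = idealOf (hasseRelations K P) := by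
  ext f
  exact hasseProjection_eq_zero_iff K P

/-- The characters of the quotient. -/
noncomputable def hasseCharacter (p : HasseQuiver P) :
    BoundQuiverAlgebra K (hasseRelations K P) →ₐ[K] K :=
  Ideal.Quotient.liftₐ _ (character K p) fun _ hf =>
    character_of_mem_filtration p (filtration_mono one_le_two (idealOf_hasseRelations_le K hf))

theorem hasseCharacter_projection (p : HasseQuiver P) (f : PathAlgebra K (HasseQuiver P)) :
    hasseCharacter K P p (hasseProjection K P f) = character K p f := rfl

variable {K P} in
theorem pow_mem_filtration {Q : Type w} [Quiver.{x} Q] [Fintype Q] {f : PathAlgebra K Q}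
    (hf : f ∈ filtration K Q 1) (n : ℕ) : f ^ n ∈ filtration K Q n := by
  induction n with
  | zero => exact mem_filtration_zero _
  | succ n ih => exact mul_mem_filtration ih hf

variable {K P} in
theorem eq_zero_of_mem_filtration_card {f : PathAlgebra K (HasseQuiver P)}
    (hf : f ∈ filtration K (HasseQuiver P) (Fintype.card P)) : f = 0 := by
  apply ext_coeff
  intro s
  rw [map_zero]
  exact coeff_eq_zero_of_mem_filtration hf (length_lt_card s.2.2)

/-- An element killed by all characters lifts to J. All its left multiples then lift to J as well,
so they are nilpotent because J to the power |P| is zero. -/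
theorem hasse_isSplitSystem :
    IsSplitSystem (fun p : HasseQuiver P => hasseProjection K P (vertex K p))
      (hasseCharacter K P) where
  complete := by
    have := (completeOrthogonalIdempotents_vertex K (HasseQuiver P)).map
      (hasseProjection K P).toRingHom
    exact this
  chi_self p := by
    rw [hasseCharacter_projection, character_vertex, if_pos rfl]
  mem_jacobson_iff a := by
    refine ⟨fun h p => AlgHom.apply_eq_zero_of_mem_jacobson _ h, fun h => ?_⟩
    obtain ⟨f, rfl⟩ := hasseProjection_surjective K P a
    have hf : f ∈ filtration K (HasseQuiver P) 1 := mem_filtration_one_iff.2 fun p => h p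
    refine mem_jacobson_of_forall_isNilpotent fun b => ?_
    obtain ⟨g, rfl⟩ := hasseProjection_surjective K P b
    refine ⟨Fintype.card P, ?_⟩
    rw [← map_mul, ← map_pow, eq_zero_of_mem_filtration_card
      (pow_mem_filtration (mul_mem_filtration_left g hf) _), map_zero]

theorem hasse_isPathPresentation :
    IsPathPresentation (hasseProjection K P)
      (fun p : HasseQuiver P => hasseProjection K P (vertex K p)) (hasseCharacter K P) where
  split := hasse_isSplitSystem K P
  surjective := hasseProjection_surjective K P
  map_vertex _ := rfl
  chi_map _ _ := rfl
  mem_filtration_of_map_eq_zero _ hf :=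
    idealOf_hasseRelations_le K ((hasseProjection_eq_zero_iff K P).1 hf)

instance finite_paths_of_length {Q : Type w} [Quiver.{x} Q] [Finite Q]
    [∀ a b : Q, Subsingleton (a ⟶ b)] (n : ℕ) :
    Finite {s : QuiverPath Q // s.2.2.length = n} := by
  induction n with
  | zero =>
    refine Finite.of_injective (β := Q) (fun s => s.1.1) ?_
    rintro ⟨⟨a, b, s⟩, hs⟩ ⟨⟨a', b', s'⟩, hs'⟩ (rfl : a = a')
    cases s with
    | cons s e => exact absurd hs (Nat.succ_ne_zero _)
    | nil =>
      cases s' with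
      | cons s e => exact absurd hs' (Nat.succ_ne_zero _)
      | nil => rfl
  | succ n ih =>
    let F : {s : QuiverPath Q // s.2.2.length = n + 1} →
        {s : QuiverPath Q // s.2.2.length = n} × Q
      | ⟨⟨a, b, .cons s e⟩, h⟩ => (⟨⟨a, _, s⟩, Nat.succ.inj h⟩, b)
    refine Finite.of_injective F ?_
    rintro ⟨⟨a, b, s⟩, hs⟩ ⟨⟨a', b', s'⟩, hs'⟩ h
    cases s with
    | nil => exact absurd hs.symm (Nat.succ_ne_zero _)
    | cons s e =>
      cases s' with
      | nil => exact absurd hs'.symm (Nat.succ_ne_zero _)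
      | cons s' e' =>
        obtain ⟨h1, h2⟩ := Prod.mk.inj h
        have h1' := Subtype.mk.inj h1
        cases h1'
        obtain rfl : b = b' := h2
        rw [Subtype.mk.injEq, Subsingleton.elim e e']

instance finite_hassePath : Finite (QuiverPath (HasseQuiver P)) := by
  have : Finite (HasseQuiver P) := inferInstanceAs (Finite P)
  refine Finite.of_injective (β := Σ n : Fin (Fintype.card P),
    {s : QuiverPath (HasseQuiver P) // s.2.2.length = n})
    (fun s => ⟨⟨_, length_lt_card s.2.2⟩, ⟨s, rfl⟩⟩) ?_
  intro s t h
  have := congrArg (fun x : (Σ n : Fin (Fintype.card P),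
    {s : QuiverPath (HasseQuiver P) // s.2.2.length = n}) => x.2.1) h
  exact this

instance finiteDimensional_hassePathAlgebra :
    FiniteDimensional K (PathAlgebra K (HasseQuiver P)) :=
  inferInstanceAs (FiniteDimensional K (QuiverPath (HasseQuiver P) →₀ K))

theorem hasse_isSplitBasic [Nonempty P] :
    IsSplitBasic K (BoundQuiverAlgebra K (hasseRelations K P)) := by
  classical
  have hs := hasse_isSplitSystem K P
  refine ⟨Module.Finite.of_surjective (hasseProjection K P).toLinearMap
    (hasseProjection_surjective K P), Fintype.card P, Fintype.card_pos, ?_⟩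
  let e : HasseQuiver P ≃ Fin (Fintype.card P) := Fintype.equivFin P
  let F : BoundQuiverAlgebra K (hasseRelations K P) →ₐ[K] (Fin (Fintype.card P) → K) :=
    AlgHom.pi fun i => hasseCharacter K P (e.symm i)
  have hF : Function.Surjective F := by
    intro c
    refine ⟨∑ i, c i • hasseProjection K P (vertex K (e.symm i)), ?_⟩
    ext j
    change hasseCharacter K P (e.symm j) _ = c j
    simp only [map_sum, map_smul, hasseCharacter_projection, character_vertex]
    simp [e.symm.injective.eq_iff]
  have hk : Ring.jacobson (BoundQuiverAlgebra K (hasseRelations K P)) = RingHom.ker F := by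
    ext a
    rw [hs.mem_jacobson_iff, RingHom.mem_ker, funext_iff]
    exact ⟨fun h i => h _, fun h p => by
      have := h (e p)
      change hasseCharacter K P (e.symm (e p)) a = 0 at this
      rwa [e.symm_apply_apply] at this⟩
  exact ⟨(Ideal.quotientEquivAlgOfEq K hk).trans (Ideal.quotientKerAlgEquivOfSurjective hF)⟩

open Classical in
/-- The sum of all arrows. -/
noncomputable def arrowSum : PathAlgebra K (HasseQuiver P) :=
  ∑ p : P, ∑ q : P, if h : p ⋖ q then arrow K (hom (P := P) h) else 0

open Classical in
theorem vertex_mul_arrowSum_mul_vertex (p q : P) :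
    vertex K (Q := HasseQuiver P) q * arrowSum K P * vertex K (Q := HasseQuiver P) p =
      if h : p ⋖ q then arrow K (hom (P := P) h) else 0 := by
  have key (a b : P) : vertex K (Q := HasseQuiver P) q *
      (if h : a ⋖ b then arrow K (hom (P := P) h) else 0) * vertex K (Q := HasseQuiver P) p =
      if a = p ∧ b = q then (if h : a ⋖ b then arrow K (hom (P := P) h) else 0) else 0 := by
    split_ifs with h h' h'
    · obtain ⟨rfl, rfl⟩ := h'
      exact (congrArg (· * _) (vertex_mul_arrow _)).trans (arrow_mul_vertex _)
    · by_cases hb : b = q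
      · have ha : a ≠ p := fun ha => h' ⟨ha, hb⟩
        rw [mul_assoc]
        exact (congrArg (_ * ·) (ofPath_mul_vertex_of_ne ha)).trans (mul_zero _)
      · exact (congrArg (· * _) (vertex_mul_ofPath_of_ne (Ne.symm hb))).trans (zero_mul _)
    all_goals rw [mul_zero, zero_mul]
  simp only [arrowSum, Finset.mul_sum, Finset.sum_mul, key]
  rw [Finset.sum_eq_single p, Finset.sum_eq_single q]
  · rw [if_pos ⟨rfl, rfl⟩]
  · exact fun b _ hb => if_neg fun h => hb h.2
  · simp
  · exact fun b _ hb => Finset.sum_eq_zero fun c _ => if_neg fun h => hb h.1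
  · simp

/-- Inserting 1 = ∑ ε_z between the factors leaves exactly the paths q ← z ← p. -/
theorem vertex_mul_arrowSum_sq_mul_vertex (p q : P) :
    vertex K (Q := HasseQuiver P) q * (arrowSum K P * arrowSum K P) *
      vertex K (Q := HasseQuiver P) p = rankTwoRelation K p q := by
  classical
  refine ((completeOrthogonalIdempotents_vertex K
    (HasseQuiver P)).mul_mul_mul_eq_sum _ _ _ _).trans ?_
  rw [rankTwoRelation_eq]
  refine Finset.sum_congr rfl fun (z : P) _ => ?_
  refine (congrArg₂ (· * ·) (vertex_mul_arrowSum_mul_vertex K P z q)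
    (vertex_mul_arrowSum_mul_vertex K P p z)).trans ?_
  by_cases h1 : p ⋖ z
  · by_cases h2 : z ⋖ q
    · rw [dif_pos h1, dif_pos h2, dif_pos ⟨h1, h2⟩]
      exact (ofPath_twoStep K h1 h2).symm
    · rw [dif_neg h2, dif_neg (c := p ⋖ z ∧ z ⋖ q) fun h => h2 h.2, zero_mul]
  · rw [dif_neg h1, dif_neg (c := p ⋖ z ∧ z ⋖ q) fun h => h1 h.1, mul_zero]

variable {P} in
-- Either two consecutive covers lead from p to q, and gradedness makes [p, q] an interval of rank
-- two, or the sum is empty.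
theorem rankTwoRelation_mem_of_isGradedPoset (hP : IsGradedPoset P) (p q : P) :
    rankTwoRelation K p q ∈ idealOf (hasseRelations K P) := by
  by_cases h : ∃ z : P, p ⋖ z ∧ z ⋖ q
  · obtain ⟨z, h1, h2⟩ := h
    exact rankTwoRelation_mem_idealOf K (hP.rankEq_two h1 h2)
  · rw [rankTwoRelation_eq, Finset.sum_eq_zero]
    · exact zero_mem _
    · exact fun z _ => dif_neg fun hz => h ⟨z, hz⟩

theorem arrowSum_mul_arrowSum_mem (hP : IsGradedPoset P) :
    arrowSum K P * arrowSum K P ∈ idealOf (hasseRelations K P) :=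
  (completeOrthogonalIdempotents_vertex K (HasseQuiver P)).mem_of_forall_mul_mul_mem fun p q => by
    refine (congrArg (· ∈ idealOf (hasseRelations K P))
      (vertex_mul_arrowSum_sq_mul_vertex K P p q)).mpr ?_
    exact rankTwoRelation_mem_of_isGradedPoset K hP p q

theorem hasseProjection_arrowSum_mul_self (hP : IsGradedPoset P) :
    hasseProjection K P (arrowSum K P) * hasseProjection K P (arrowSum K P) = 0 := by
  rw [← map_mul]
  exact (hasseProjection_eq_zero_iff K P).2 (arrowSum_mul_arrowSum_mem K P hP)

/-- The component is the arrow q ← p or zero, and arrows survive in the quotient because the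
relations lie in J². -/
theorem hasseProjection_vertex_mul_arrowSum (p q : P) :
    hasseProjection K P (vertex K (Q := HasseQuiver P) q) * hasseProjection K P (arrowSum K P) *
      hasseProjection K P (vertex K (Q := HasseQuiver P) p) = 0 ↔ ¬ p ⋖ q := by
  classical
  rw [← map_mul, ← map_mul, vertex_mul_arrowSum_mul_vertex]
  split_ifs with hpq
  · refine iff_of_false (fun h0 => ?_) (not_not_intro hpq)
    have h2 := coeff_eq_zero_of_mem_filtration
      ((hasse_isPathPresentation K P).mem_filtration_of_map_eq_zero _ h0)
      (t := ⟨p, q, (hom hpq).toPath⟩) one_lt_two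
    exact one_ne_zero (((coeff_ofPath _ _).trans (if_pos rfl)).symm.trans h2)
  · exact iff_of_true (map_zero _) hpq

section Ext

variable {K P} {p q : P} {S T : ModuleCat.{max u w} (BoundQuiverAlgebra K (hasseRelations K P))}
  (σ : CharModuleEquiv (hasseCharacter K P p) S) (τ : CharModuleEquiv (hasseCharacter K P q) T)

include σ τ

theorem hasse_extOne : (RankEq p q 1 → Nonempty (Abelian.Ext.{max u w} S T 1 ≃ₗ[K] K)) ∧
    (¬ RankEq p q 1 → Subsingleton (Abelian.Ext.{max u w} S T 1)) := by
  have h := hasse_isPathPresentation K P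
  have E := (h.split.extOneEquiv (p := p) (q := q) σ τ).trans (h.bicharSpaceRadicalEquiv p q)
  refine ⟨fun hpq => ?_, fun hpq => ?_⟩
  · exact (bicharSpace_arrow_equiv K (rankEq_one_iff.1 hpq)).map E.trans
  · have := bicharSpace_arrow_subsingleton K (mt rankEq_one_iff.2 hpq)
    exact E.injective.subsingleton

theorem hasse_extTwo : (RankEq p q 2 → Nonempty (Abelian.Ext.{max u w} S T 2 ≃ₗ[K] K)) ∧
    (¬ RankEq p q 2 → Subsingleton (Abelian.Ext.{max u w} S T 2)) := by
  have h := hasse_isPathPresentation K P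
  have := finite_star (P := P) p
  obtain ⟨E⟩ := h.nonempty_extTwoEquiv (Q := HasseQuiver P) (p := p) (q := q) σ τ
  refine ⟨fun hpq => ?_, fun hpq => ?_⟩
  · exact (bicharSpace_idealOf_equiv K hpq (ker_hasseProjection K P)).map E.trans
  · have := bicharSpace_idealOf_subsingleton K hpq (ker_hasseProjection K P)
    exact E.injective.subsingleton

end Ext

theorem hasse_hasHasseDifferential (hP : IsGradedPoset P) :
    HasHasseDifferential K (BoundQuiverAlgebra K (hasseRelations K P)) P := by
  have hs := hasse_isSplitSystem K P
  refine ⟨fun p => ModuleCat.of _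
    (leftIdealOf (hasseProjection K P (vertex K (Q := HasseQuiver P) p)) ⧸
    radPart (hasseProjection K P (vertex K (Q := HasseQuiver P) p))),
    hs.isSimpleLabelling, fun p q => ?_, fun p q => ?_,
    fun p => hasseProjection K P (vertex K (Q := HasseQuiver P) p), hs.complete,
    fun p => hs.isPrimitiveIdempotent p, fun p => ⟨LinearEquiv.refl _ _⟩,
    LinearMap.toSpanSingleton _ _ (hasseProjection K P (arrowSum K P)), ?_, fun p => ?_,
    fun p q hpq => ?_⟩
  · obtain ⟨σ⟩ := hs.nonempty_charModuleEquiv p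
    obtain ⟨τ⟩ := hs.nonempty_charModuleEquiv q
    exact hasse_extOne σ τ
  · obtain ⟨σ⟩ := hs.nonempty_charModuleEquiv p
    obtain ⟨τ⟩ := hs.nonempty_charModuleEquiv q
    exact hasse_extTwo σ τ
  · exact toSpanSingleton_comp_self (hasseProjection_arrowSum_mul_self K P hP)
  · exact (hasseProjection_vertex_mul_arrowSum K P p p).2 (lt_irrefl p ∘ CovBy.lt)
  · exact fun h0 => (hasseProjection_vertex_mul_arrowSum K P p q).1 h0 (rankEq_one_iff.1 hpq)

end Converse

/-! ### Powers of the radical -/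

section Rad

variable (K : Type u) [Field K] (A : Type v) [Ring A] [Algebra K A]

/-- The Jacobson radical as a subspace. -/
def radSubspace : Submodule K A := (Ring.jacobson A).restrictScalars K

variable {K A}

theorem mem_radSubspace {a : A} : a ∈ radSubspace K A ↔ a ∈ Ring.jacobson A := Iff.rfl

/-- The exponent is `n + 1` because the zeroth power of a subspace is the line of scalars, which is
not an ideal in general. -/
theorem mul_mem_radSubspace_pow_left (a : A) {m : A} {n : ℕ} (hm : m ∈ radSubspace K A ^ (n + 1)) :
    a * m ∈ radSubspace K A ^ (n + 1) := by
  rw [pow_succ'] at hm ⊢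
  refine Submodule.mul_induction_on hm (fun b hb c hc => ?_) fun b c hb hc => ?_
  · rw [← mul_assoc]
    exact Submodule.mul_mem_mul (mem_radSubspace.2 (Ideal.mul_mem_left _ a hb)) hc
  · rw [mul_add]
    exact add_mem hb hc

theorem mul_mem_radSubspace_pow_right (a : A) {m : A} {n : ℕ}
    (hm : m ∈ radSubspace K A ^ (n + 1)) : m * a ∈ radSubspace K A ^ (n + 1) := by
  rw [pow_succ] at hm ⊢
  refine Submodule.mul_induction_on hm (fun b hb c hc => ?_) fun b c hb hc => ?_
  · rw [mul_assoc]
    exact Submodule.mul_mem_mul hb (mem_radSubspace.2 (Ideal.mul_mem_right a _ hc))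
  · rw [add_mul]
    exact add_mem hb hc

theorem exists_radSubspace_pow_eq_bot [FiniteDimensional K A] :
    ∃ n : ℕ, radSubspace K A ^ (n + 1) = ⊥ := by
  have : IsArtinianRing A := IsArtinianRing.of_finite K A
  obtain ⟨n, hn⟩ := IsArtinianRing.isNilpotent_jacobson_bot (R := A)
  rw [Ideal.jacobson_bot] at hn
  have key (k : ℕ) : radSubspace K A ^ (k + 1) ≤
      (Ring.jacobson A ^ (k + 1)).restrictScalars K := by
    induction k with
    | zero => rw [zero_add, pow_one, Submodule.pow_one]; exact le_rfl
    | succ k ih =>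
      rw [pow_succ, Submodule.mul_le]
      intro a ha b hb
      rw [Submodule.pow_succ]
      exact Ideal.mul_mem_mul (ih ha) hb
  refine ⟨n, ?_⟩
  rw [eq_bot_iff]
  refine (key n).trans ?_
  rw [Submodule.pow_succ, hn]
  intro a ha
  simpa using ha

end Rad

/-! ### Triangularity of the radical -/

namespace IsSplitSystem

variable {K : Type u} [Field K] {A : Type v} [Ring A] [Algebra K A]
  {P : Type w} [Fintype P] {η : P → A} {χ : P → A →ₐ[K] K} (h : IsSplitSystem η χ)

include h

theorem mul_sub_mem_jacobson' (q : P) (a : A) :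
    η q * a - algebraMap K A (χ q a) * η q ∈ Ring.jacobson A := by
  rw [h.mem_jacobson_iff]
  intro z
  by_cases hz : z = q
  · subst hz
    simp [h.chi_self]
  · simp [h.chi_of_ne hz]

/-- Functionals on `rad / rad²` are bi-equivariant after compression by idempotents. -/
theorem exists_mem_bicharSpace_of_le_ker (p q : P) {f : A →ₗ[K] K}
    (hf : radSubspace K A ^ 2 ≤ LinearMap.ker f) :
    ∃ g ∈ bicharSpace (χ q) (χ p) (Ring.jacobson A),
      ∀ m : Ring.jacobson A, g m = f (η q * m * η p) := by
  rw [pow_two] at hf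
  exact exists_mem_bicharSpace (Ring.jacobson A : Set A) (h.mul_sub_mem_jacobson' q)
    (h.mul_sub_mem_jacobson p) _ f
    (fun j hj m hm => hf (Submodule.mul_mem_mul (mem_radSubspace.2 hj) (mem_radSubspace.2 hm)))
    (fun j hj m hm => hf (Submodule.mul_mem_mul (mem_radSubspace.2 hm) (mem_radSubspace.2 hj)))

/-- Otherwise a linear functional killing rad² but not η_q m η_p would yield a nonzero
bi-equivariant functional on the radical. -/
theorem mul_mul_mem_sq {p q : P} (hs : Subsingleton (bicharSpace (χ q) (χ p) (Ring.jacobson A)))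
    {m : A} (hm : m ∈ Ring.jacobson A) : η q * m * η p ∈ radSubspace K A ^ 2 := by
  by_contra hn
  obtain ⟨f, hf, hker⟩ := Submodule.exists_le_ker_of_notMem hn
  obtain ⟨g, hg, hgf⟩ := h.exists_mem_bicharSpace_of_le_ker p q hker
  have h0 : g = 0 := congrArg Subtype.val (Subsingleton.elim (⟨g, hg⟩ : bicharSpace _ _ _) 0)
  apply hf
  rw [← hgf ⟨m, hm⟩, h0]
  rfl

/-- Since y is outside rad², some bi-equivariant functional is nonzero at y. In a one-dimensional
space every functional killing y is then zero, so nothing separates η_q m η_p from the span of y and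
rad². -/
theorem mul_mul_mem_span_sup {p q : P} (e : bicharSpace (χ q) (χ p) (Ring.jacobson A) ≃ₗ[K] K)
    {y : A} (hy : y ∈ Ring.jacobson A) (hyq : η q * y = y) (hyp : y * η p = y)
    (hy2 : y ∉ radSubspace K A ^ 2) {m : A} (hm : m ∈ Ring.jacobson A) :
    η q * m * η p ∈ Submodule.span K {y} ⊔ radSubspace K A ^ 2 := by
  by_contra hn
  obtain ⟨f, hf, hker⟩ := Submodule.exists_le_ker_of_notMem hn
  obtain ⟨f₂, hf₂, hker₂⟩ := Submodule.exists_le_ker_of_notMem hy2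
  obtain ⟨g, hg, hgf⟩ := h.exists_mem_bicharSpace_of_le_ker p q (le_sup_right.trans hker)
  obtain ⟨g₂, hg₂, hgf₂⟩ := h.exists_mem_bicharSpace_of_le_ker p q hker₂
  have h1 : g ⟨y, hy⟩ = 0 := by
    rw [hgf]
    change f (η q * y * η p) = 0
    rw [hyq, hyp]
    exact hker (le_sup_left (a := Submodule.span K {y}) (Submodule.mem_span_singleton_self y))
  have h2 : g₂ ⟨y, hy⟩ ≠ 0 := by
    rw [hgf₂]
    change f₂ (η q * y * η p) ≠ 0
    rwa [hyq, hyp]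
  apply hf
  rw [← hgf ⟨m, hm⟩, eq_zero_of_apply_eq_zero e hg hg₂ h2 h1]
  rfl

variable [PartialOrder P]
  (hs : ∀ p q, ¬ p ⋖ q → Subsingleton (bicharSpace (χ q) (χ p) (Ring.jacobson A)))

include hs

/-- Split a product b c at an intermediate idempotent η_z. If p < z, then z < q fails and induction
improves the factor b by one power; otherwise p ⋖ z fails and the factor c lies in rad². Either way
one power is gained. -/
theorem mul_mul_mem_pow_succ (n : ℕ) {p q : P} (hpq : ¬ p < q) {m : A}
    (hm : m ∈ radSubspace K A ^ (n + 1)) : η q * m * η p ∈ radSubspace K A ^ (n + 2) := by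
  induction n generalizing p q m with
  | zero =>
    rw [zero_add, pow_one] at hm
    exact h.mul_mul_mem_sq (hs p q fun h' => hpq h'.lt) hm
  | succ n ih =>
    rw [pow_succ] at hm
    refine Submodule.mul_induction_on hm (fun b hb c hc => ?_) fun b c hb hc => ?_
    · rw [h.complete.mul_mul_mul_eq_sum]
      refine sum_mem fun z _ => ?_
      by_cases hpz : p < z
      · rw [pow_succ]
        exact Submodule.mul_mem_mul (ih (fun hzq => hpq (hpz.trans hzq)) hb) (mem_radSubspace.2
          (Ideal.mul_mem_right _ _ (Ideal.mul_mem_left _ _ hc)))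
      · rw [show n + 1 + 2 = (n + 1) + 2 from rfl, pow_add]
        exact Submodule.mul_mem_mul (mul_mem_radSubspace_pow_right _
          (mul_mem_radSubspace_pow_left _ hb)) (h.mul_mul_mem_sq (hs p z fun h' => hpz h'.lt) hc)
    · rw [mul_add, add_mul]
      exact add_mem hb hc

variable [FiniteDimensional K A]

/-- Compression by η_q and η_p is idempotent, so the gain of one power can be repeated until the
nilpotent radical is exhausted. -/
theorem mul_mul_eq_zero {p q : P} (hpq : ¬ p < q) {m : A} (hm : m ∈ Ring.jacobson A) :
    η q * m * η p = 0 := by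
  have key (n : ℕ) : η q * m * η p ∈ radSubspace K A ^ (n + 1) := by
    induction n with
    | zero =>
      rw [zero_add, pow_one]
      exact Ideal.mul_mem_right _ _ (Ideal.mul_mem_left _ _ hm)
    | succ n ih =>
      have := h.mul_mul_mem_pow_succ hs n hpq ih
      rwa [← mul_assoc, ← mul_assoc, (h.complete.idem q).eq, mul_assoc _ (η p),
        (h.complete.idem p).eq] at this
  obtain ⟨n, hn⟩ := exists_radSubspace_pow_eq_bot (K := K) (A := A)
  simpa [hn] using key n

/-- A nonzero product through η_z would require p < z < q, which a cover excludes. -/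
theorem mul_mul_eq_zero_of_covBy {p q : P} (hpq : p ⋖ q) {m : A}
    (hm : m ∈ radSubspace K A ^ 2) : η q * m * η p = 0 := by
  rw [pow_two] at hm
  refine Submodule.mul_induction_on hm (fun b hb c hc => ?_) fun b c hb hc => ?_
  · rw [h.complete.mul_mul_mul_eq_sum]
    refine Finset.sum_eq_zero fun z _ => ?_
    by_cases hpz : p < z
    · rw [h.mul_mul_eq_zero hs (hpq.2 hpz) hb, zero_mul]
    · rw [h.mul_mul_eq_zero hs hpz hc, mul_zero]
  · rw [mul_add, add_mul, hb, hc, add_zero]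

end IsSplitSystem

/-! ### The homomorphism defined by the Peirce components of one element -/

namespace IsSplitSystem

variable {K : Type u} [Field K] {A : Type v} [Ring A] [Algebra K A]
  {Q : Type w} [Quiver.{x} Q] [Fintype Q] {η : Q → A} {χ : Q → A →ₐ[K] K}

/-- The homomorphism from the path algebra that sends an arrow `a ⟶ b` to the Peirce component
`η b * y * η a` of a fixed element `y`. -/
noncomputable def peirceHom (h : IsSplitSystem η χ) (y : A) : PathAlgebra K Q →ₐ[K] A :=
  lift (η := η) (X := fun a b _ => η b * y * η a) h.complete
    fun a b _ => by rw [← mul_assoc, ← mul_assoc, (h.complete.idem b).eq]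

variable (h : IsSplitSystem η χ) {y : A}

theorem peirceHom_vertex (a : Q) : h.peirceHom y (vertex K a) = η a := lift_vertex _ _ _

theorem peirceHom_arrow {a b : Q} (e : a ⟶ b) : h.peirceHom y (arrow K e) = η b * y * η a :=
  lift_arrow _ _ (fun a _ _ => by rw [mul_assoc, (h.complete.idem a).eq]) _

theorem peirceHom_cons {a b c : Q} (s : Quiver.Path a b) (e : b ⟶ c) :
    h.peirceHom y (ofPath K ⟨a, c, s.cons e⟩) =
      (η c * y * η b) * h.peirceHom y (ofPath K ⟨a, b, s⟩) := by
  rw [ofPath_cons, map_mul, peirceHom_arrow]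

section

variable (hy : ∀ a b : Q, (a ⟶ b) → η b * y * η a ∈ Ring.jacobson A)

include hy

theorem peirceHom_mem_jacobson {m : PathAlgebra K Q} (hm : m ∈ filtration K Q 1) :
    h.peirceHom y m ∈ Ring.jacobson A := by
  have : filtration K Q 1 ≤ (radSubspace K A).comap (h.peirceHom y).toLinearMap := by
    rw [filtration, Submodule.span_le]
    rintro _ ⟨⟨a, b, s⟩, hs, rfl⟩
    cases s with
    | nil => exact absurd hs (by simp)
    | cons s e =>
      change h.peirceHom y _ ∈ Ring.jacobson A
      rw [peirceHom_cons]
      exact Ideal.mul_mem_right _ _ (hy _ _ e)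
  exact this hm

theorem peirceHom_mem_sq {m : PathAlgebra K Q} (hm : m ∈ filtration K Q 2) :
    h.peirceHom y m ∈ radSubspace K A ^ 2 := by
  have : filtration K Q 2 ≤ (radSubspace K A ^ 2).comap (h.peirceHom y).toLinearMap := by
    rw [filtration, Submodule.span_le]
    rintro _ ⟨⟨a, b, s⟩, hs, rfl⟩
    cases s with
    | nil => exact absurd hs (by simp)
    | cons s e =>
      change h.peirceHom y _ ∈ radSubspace K A ^ 2
      rw [peirceHom_cons, pow_two]
      exact Submodule.mul_mem_mul (hy _ _ e) (h.peirceHom_mem_jacobson hy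
        (ofPath_mem_filtration (Nat.le_of_succ_le_succ hs)))
  exact this hm

theorem chi_peirceHom (p : Q) (f : PathAlgebra K Q) :
    χ p (h.peirceHom y f) = character K p f := by
  have : (χ p).toLinearMap ∘ₗ (h.peirceHom y).toLinearMap = (character K p).toLinearMap := by
    refine linearMap_ext ?_
    rintro ⟨a, b, s⟩
    change χ p (h.peirceHom y _) = character K p _
    cases s with
    | nil =>
      refine (congrArg (χ p) (h.peirceHom_vertex a)).trans ?_
      refine Eq.trans ?_ (character_vertex p a).symm
      split_ifs with hp
      · rw [hp, h.chi_self]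
      · exact h.chi_of_ne (Ne.symm hp)
    | cons s e =>
      have hm : ofPath K ⟨a, b, s.cons e⟩ ∈ filtration K Q 1 := ofPath_mem_filtration (by simp)
      rw [character_of_mem_filtration _ hm]
      exact (h.mem_jacobson_iff _).1 (h.peirceHom_mem_jacobson hy hm) p
  exact LinearMap.congr_fun this f

theorem peirceHom_surjective [FiniteDimensional K A]
    (hr : ∀ a b : Q, ∀ m ∈ Ring.jacobson A, η b * m * η a ∈
      Submodule.span K {z | ∃ e : a ⟶ b, z = h.peirceHom y (arrow K e)} ⊔ radSubspace K A ^ 2) :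
    Function.Surjective (h.peirceHom y) := by
  set V : Submodule K A := (filtration K Q 1).map (h.peirceHom y).toLinearMap with hV
  have hVr : V ≤ radSubspace K A := by
    rintro _ ⟨m, hm, rfl⟩
    exact h.peirceHom_mem_jacobson hy hm
  have hVV : V * V ≤ V := by
    rw [Submodule.mul_le]
    rintro _ ⟨m, hm, rfl⟩ _ ⟨m', hm', rfl⟩
    have hmm : m * m' ∈ filtration K Q 1 := mul_mem_filtration_left m hm'
    exact Submodule.mem_map.2 ⟨m * m', hmm, map_mul (h.peirceHom y) m m'⟩
  have h1 : radSubspace K A ≤ V ⊔ radSubspace K A ^ 2 := by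
    intro m hm
    refine h.complete.mem_of_forall_mul_mul_mem fun a b => ?_
    refine (sup_le_sup_right ?_ (radSubspace K A ^ 2) :) (hr a b m hm)
    rw [Submodule.span_le]
    rintro _ ⟨e, rfl⟩
    exact ⟨_, arrow_mem_filtration e, rfl⟩
  have h2 (n : ℕ) : radSubspace K A ≤ V ⊔ radSubspace K A ^ (n + 1) := by
    induction n with
    | zero => simp
    | succ n ih =>
      -- With r the radical: r² ⊆ (V + rⁿ⁺¹) r, and V r ⊆ V (V + rⁿ⁺¹) ⊆ V + rⁿ⁺².
      refine h1.trans (sup_le le_sup_left ?_)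
      rw [pow_two]
      refine (mul_le_mul' ih le_rfl).trans ?_
      rw [Submodule.sup_mul, ← pow_succ]
      refine sup_le ?_ le_sup_right
      refine (mul_le_mul' le_rfl ih).trans ?_
      rw [Submodule.mul_sup]
      refine sup_le_sup hVV ?_
      rw [pow_succ' _ (n + 1)]
      exact mul_le_mul' hVr le_rfl
  obtain ⟨n, hn⟩ := exists_radSubspace_pow_eq_bot (K := K) (A := A)
  have h3 : radSubspace K A ≤ V := by simpa [hn] using h2 n
  intro a
  -- Every element is a combination of the idempotents plus a radical element, and both parts are
  -- now in the image.
  have h4 : a - ∑ p, algebraMap K A (χ p a) * η p ∈ Ring.jacobson A := by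
    have : a - ∑ p, algebraMap K A (χ p a) * η p =
        ∑ p, (a * η p - algebraMap K A (χ p a) * η p) := by
      rw [Finset.sum_sub_distrib, ← Finset.mul_sum, h.complete.complete, mul_one]
    rw [this]
    exact sum_mem fun p _ => h.mul_sub_mem_jacobson p a
  obtain ⟨m, -, hm⟩ := h3 h4
  refine ⟨m + ∑ p, χ p a • vertex K p, ?_⟩
  have hm' : h.peirceHom y m = a - ∑ p, algebraMap K A (χ p a) * η p := hm
  have hv (p : Q) : h.peirceHom y (χ p a • vertex K p) = algebraMap K A (χ p a) * η p := by
    rw [map_smul, peirceHom_vertex, Algebra.smul_def]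
  rw [map_add, map_sum, hm', Finset.sum_congr rfl fun p _ => hv p, sub_add_cancel]

variable [∀ a b : Q, Subsingleton (a ⟶ b)]

theorem mem_filtration_two_of_peirceHom_eq_zero
    (hsq : ∀ a b : Q, (a ⟶ b) → ∀ m ∈ radSubspace K A ^ 2, η b * m * η a = 0)
    (hne : ∀ a b : Q, (a ⟶ b) → η b * y * η a ≠ 0) {f : PathAlgebra K Q}
    (hf : h.peirceHom y f = 0) : f ∈ filtration K Q 2 := by
  have hf1 : f ∈ filtration K Q 1 := mem_filtration_one_iff.2 fun p => by
    rw [← h.chi_peirceHom hy, hf, map_zero]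
  rw [mem_filtration_iff]
  rintro ⟨a, b, s⟩ hs
  cases s with
  | nil => exact mem_filtration_iff.1 hf1 _ Nat.zero_lt_one
  | cons s e =>
    cases s with
    | cons s e' => exact absurd hs (by simp)
    | nil =>
      -- On J, the compression of the image by η_b and η_a sees only the coefficient of the arrow a
      -- ⟶ b: longer paths go to rad², which this compression kills, and other arrows to other
      -- Peirce components.
      have key := eq_of_mem_filtration (n := 1) (M := A)
        (f := (LinearMap.mulLeftRight K (η b, η a)).comp (h.peirceHom y).toLinearMap)
        (g := (coeff (⟨a, b, e.toPath⟩ : QuiverPath Q)).smulRight (η b * y * η a)) ?_ hf1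
      · have key' : η b * h.peirceHom y f * η a =
          coeff (⟨a, b, e.toPath⟩ : QuiverPath Q) f • (η b * y * η a) := by
          simpa using key
        rw [hf, mul_zero, zero_mul] at key'
        exact (smul_eq_zero.1 key'.symm).resolve_right (hne a b e)
      · intro a' b' s hs
        suffices η b * h.peirceHom y (ofPath K ⟨a', b', s⟩) * η a =
          coeff (⟨a, b, e.toPath⟩ : QuiverPath Q) (ofPath K ⟨a', b', s⟩) • (η b * y * η a) by
          simpa using this
        classical
        rw [coeff_ofPath]
        cases s with
        | nil => exact absurd hs (by simp)
        | cons s e' =>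
          cases s with
          | cons s e'' =>
            rw [hsq a b e _ (h.peirceHom_mem_sq hy (ofPath_mem_filtration (by simp))), if_neg,
              zero_smul]
            intro h'
            have := congrArg (fun s : QuiverPath Q => s.2.2.length) h'
            simp at this
          | nil =>
            have h1 : h.peirceHom y (ofPath K ⟨a', b', Quiver.Path.nil.cons e'⟩) =
              η b' * y * η a' := h.peirceHom_arrow e'
            rw [h1]
            by_cases hab : a' = a ∧ b' = b
            · obtain ⟨rfl, rfl⟩ := hab
              rw [Subsingleton.elim e e', if_pos (c := (⟨a', b', Quiver.Path.nil.cons e'⟩ :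
                QuiverPath Q) = ⟨a', b', e'.toPath⟩) rfl, one_smul, ← mul_assoc, ← mul_assoc,
                (h.complete.idem b').eq, mul_assoc _ (η a'), (h.complete.idem a').eq]
            · rw [if_neg, zero_smul]
              · by_cases hb : b' = b
                · have ha : a' ≠ a := fun ha => hab ⟨ha, hb⟩
                  rw [mul_assoc, mul_assoc _ (η a'), h.complete.ortho ha, mul_zero, mul_zero]
                · rw [← mul_assoc, ← mul_assoc, h.complete.ortho (Ne.symm hb), zero_mul,
                    zero_mul, zero_mul]
              · intro h'
                exact hab ⟨congrArg (fun s : QuiverPath Q => s.1) h',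
                  congrArg (fun s : QuiverPath Q => s.2.1) h'⟩

theorem isPathPresentation_peirceHom [FiniteDimensional K A]
    (hr : ∀ a b : Q, ∀ m ∈ Ring.jacobson A, η b * m * η a ∈
      Submodule.span K {z | ∃ e : a ⟶ b, z = h.peirceHom y (arrow K e)} ⊔ radSubspace K A ^ 2)
    (hsq : ∀ a b : Q, (a ⟶ b) → ∀ m ∈ radSubspace K A ^ 2, η b * m * η a = 0)
    (hne : ∀ a b : Q, (a ⟶ b) → η b * y * η a ≠ 0) :
    IsPathPresentation (h.peirceHom y) η χ where
  split := h
  surjective := h.peirceHom_surjective hy hr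
  map_vertex := h.peirceHom_vertex
  chi_map := h.chi_peirceHom hy
  mem_filtration_of_map_eq_zero _ := h.mem_filtration_two_of_peirceHom_eq_zero hy hsq hne

end

end IsSplitSystem

namespace PathAlgebra

variable {K : Type u} [Field K] {Q : Type w} [Quiver.{x} Q] [Fintype Q]

theorem vertex_mul_sub_mem_filtration (q : Q) (a : PathAlgebra K Q) :
    vertex K q * a - algebraMap K _ (character K q a) * vertex K q ∈ filtration K Q 1 := by
  rw [mem_filtration_one_iff]
  intro v
  simp only [map_sub, map_mul, character_vertex, AlgHom.commutes]
  split_ifs with hv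
  · simp [hv]
  · simp

theorem mul_vertex_sub_mem_filtration (p : Q) (a : PathAlgebra K Q) :
    a * vertex K p - algebraMap K _ (character K p a) * vertex K p ∈ filtration K Q 1 := by
  rw [mem_filtration_one_iff]
  intro v
  simp only [map_sub, map_mul, character_vertex, AlgHom.commutes]
  split_ifs with hv
  · simp [hv]
  · simp

end PathAlgebra

/-! ### The kernel is generated by the relations -/

section Kernel

variable {K : Type u} [Field K] {P : Type w} [PartialOrder P] [Fintype P]

/-- An ideal that contains the relations, and on which the bi-equivariant functionals are as for
the ideal of the relations, is generated by the relations. -/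
theorem eq_idealOf_hasseRelations {I : Ideal (PathAlgebra K (HasseQuiver P))} [I.IsTwoSided]
    (hI : ∀ m ∈ I, m ∈ filtration K (HasseQuiver P) 2) (hR : hasseRelations K P ⊆ I)
    (h2 : ∀ p q : P, RankEq p q 2 → Nonempty (bicharSpace (character K (Q := HasseQuiver P) q)
      (character K (Q := HasseQuiver P) p) I ≃ₗ[K] K))
    (h0 : ∀ p q : P, ¬ RankEq p q 2 → Subsingleton (bicharSpace
      (character K (Q := HasseQuiver P) q) (character K (Q := HasseQuiver P) p) I)) :
    idealOf (hasseRelations K P) = I := by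
  refine le_antisymm (idealOf_le hR) ?_
  -- T k is (R) + (J^k ∩ I). If I ⊆ T k, then JI + IJ ⊆ T (k + 1), so a functional killing T (k + 1)
  -- has bi-equivariant compressions on I.
  set T : ℕ → Submodule K (PathAlgebra K (HasseQuiver P)) := fun k =>
    (idealOf (hasseRelations K P)).restrictScalars K ⊔
      (filtration K (HasseQuiver P) k ⊓ I.restrictScalars K) with hT
  have hstep (k : ℕ) (hk : I.restrictScalars K ≤ T k) : I.restrictScalars K ≤ T (k + 1) := by
    intro y hy
    by_contra hn
    obtain ⟨f, hf, hker⟩ := Submodule.exists_le_ker_of_notMem hn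
    have hl : ∀ j ∈ (filtration K (HasseQuiver P) 1 : Set (PathAlgebra K (HasseQuiver P))),
        ∀ m ∈ I, f (j * m) = 0 := by
      intro j hj m hm
      apply hker
      obtain ⟨i, hi, m', hm', rfl⟩ := Submodule.mem_sup.1 (hk hm)
      rw [mul_add]
      refine Submodule.add_mem_sup (Ideal.mul_mem_left _ j hi) ⟨?_, Ideal.mul_mem_left _ j hm'.2⟩
      have := mul_mem_filtration hj hm'.1
      rwa [add_comm] at this
    have hr : ∀ j ∈ (filtration K (HasseQuiver P) 1 : Set (PathAlgebra K (HasseQuiver P))),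
        ∀ m ∈ I, f (m * j) = 0 := by
      intro j hj m hm
      apply hker
      obtain ⟨i, hi, m', hm', rfl⟩ := Submodule.mem_sup.1 (hk hm)
      rw [add_mul]
      exact Submodule.add_mem_sup (Ideal.mul_mem_right j _ hi)
        ⟨mul_mem_filtration hm'.1 hj, Ideal.mul_mem_right j _ hm'.2⟩
    apply hf
    change y ∈ LinearMap.ker f
    refine (completeOrthogonalIdempotents_vertex K
      (HasseQuiver P)).mem_of_forall_mul_mul_mem fun p q => ?_
    obtain ⟨g, hg, hgf⟩ := exists_mem_bicharSpace
      (filtration K (HasseQuiver P) 1 : Set (PathAlgebra K (HasseQuiver P)))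
      (vertex_mul_sub_mem_filtration q) (mul_vertex_sub_mem_filtration p) I f hl hr
    suffices g = 0 by
      rw [LinearMap.mem_ker, ← hgf ⟨y, hy⟩, this]
      rfl
    by_cases hpq : @RankEq P _ p q 2
    · obtain ⟨e⟩ := h2 p q hpq
      have hrI : rankTwoRelation K (P := P) p q ∈ I := hR ⟨p, q, hpq, rfl⟩
      obtain ⟨g', hg', hne⟩ := exists_bicharSpace_apply_ne_zero K hpq hI hrI
      -- The compressed functional vanishes at r_{p,q}, where another member of the one-dimensional
      -- space does not, so it is zero.
      refine eq_zero_of_apply_eq_zero e hg hg' hne ((hgf _).trans ?_)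
      have h1 : vertex K q * rankTwoRelation K (P := P) p q * vertex K p =
          rankTwoRelation K (P := P) p q :=
        (congrArg (· * _) (vertex_mul_rankTwoRelation K (P := P) p q)).trans
          (rankTwoRelation_mul_vertex K (P := P) p q)
      refine (congrArg f h1).trans (hker ?_)
      exact Submodule.mem_sup_left (rankTwoRelation_mem_idealOf K hpq)
    · have := h0 p q hpq
      exact congrArg Subtype.val (Subsingleton.elim (⟨g, hg⟩ : bicharSpace _ _ _) 0)
  have hall (k : ℕ) : I.restrictScalars K ≤ T k := by
    induction k with
    | zero => exact fun m hm => Submodule.mem_sup_right ⟨mem_filtration_zero m, hm⟩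
    | succ k ih => exact hstep k ih
  intro m hm
  -- For k = |P| no paths of length k remain, and T k is (R).
  obtain ⟨i, hi, m', hm', rfl⟩ := Submodule.mem_sup.1 (hall (Fintype.card P) hm)
  rw [eq_zero_of_mem_filtration_card hm'.1, add_zero]
  exact hi

end Kernel

/-! ### Admissibility and degree of the relations -/

section Relations

variable {K : Type u} [Field K] {P : Type w} [PartialOrder P] [Fintype P]

theorem isAdmissible_idealOf_hasseRelations :
    IsAdmissible (idealOf (hasseRelations K P)) := by
  -- J to the power |P| is already zero; adding 2 secures the bound n ≥ 2.
  refine ⟨Fintype.card P + 2, by omega, ?_, ?_⟩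
  · rw [arrowIdeal_pow_eq]
    intro f hf
    rw [eq_zero_of_mem_filtration_card (filtration_mono (Nat.le_add_right _ _) hf)]
    exact zero_mem _
  · rw [arrowIdeal_pow_eq]
    exact fun f hf => idealOf_hasseRelations_le K hf

theorem isSystemOfRelations_hasseRelations :
    IsSystemOfRelations (hasseRelations K P) (idealOf (hasseRelations K P)) := by
  refine ⟨?_, ?_, rfl⟩
  · refine (Set.finite_range fun s : P × P => rankTwoRelation K s.1 s.2).subset ?_
    rintro _ ⟨p, q, -, rfl⟩
    exact ⟨(p, q), rfl⟩
  · rintro _ ⟨p, q, hpq, rfl⟩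
    refine ⟨p, q, _, rankTwoRelation_mem_idealOf K hpq, ?_⟩
    exact ((congrArg (· * _) (vertex_mul_rankTwoRelation K p q)).trans
      (rankTwoRelation_mul_vertex K p q)).symm

theorem hasseRelations_subset_degreePart :
    hasseRelations K P ⊆ degreePart K (HasseQuiver P) 2 := by
  rintro _ ⟨p, q, -, rfl⟩
  exact rankTwoRelation_mem_degreePart K p q

end Relations

/-! ### Homogeneity -/

namespace PathAlgebra

variable {K : Type u} [Field K] {Q : Type w} [Quiver.{x} Q] [Fintype Q]

/-- The degree `n` component as a linear map. -/
noncomputable def componentLin (n : ℕ) : PathAlgebra K Q →ₗ[K] PathAlgebra K Q where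
  toFun := component n
  map_add' _ _ := Finsupp.filter_add
  map_smul' _ _ := Finsupp.filter_smul

theorem component_ofPath (n : ℕ) (s : QuiverPath Q) :
    component n (ofPath K s) = if s.2.2.length = n then ofPath K s else 0 := by
  classical
  split_ifs with h
  · exact Finsupp.filter_single_of_pos _ h
  · exact Finsupp.filter_single_of_neg _ h

theorem component_of_mem_degreePart (n : ℕ) {d : ℕ} {f : PathAlgebra K Q}
    (hf : f ∈ degreePart K Q d) : component n f = if d = n then f else 0 := by
  have : degreePart K Q d ≤ LinearMap.eqLocus (componentLin n)
      (if d = n then LinearMap.id else 0) := by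
    rw [degreePart, Submodule.span_le]
    rintro _ ⟨s, rfl, rfl⟩
    refine (component_ofPath n s).trans ?_
    split_ifs <;> rfl
  refine (this hf).trans ?_
  split_ifs <;> rfl

theorem mul_mem_degreePart {d d' : ℕ} {f g : PathAlgebra K Q} (hf : f ∈ degreePart K Q d)
    (hg : g ∈ degreePart K Q d') : f * g ∈ degreePart K Q (d + d') := by
  have key : degreePart K Q d * degreePart K Q d' ≤ degreePart K Q (d + d') := by
    rw [degreePart, degreePart, Submodule.span_mul_span, Submodule.span_le]
    rintro _ ⟨_, ⟨⟨b, c, t⟩, rfl, rfl⟩, _, ⟨⟨a, b', s⟩, rfl, rfl⟩, rfl⟩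
    change ofPath K _ * ofPath K _ ∈ degreePart K Q _
    rw [ofPath_mul_ofPath]
    by_cases hb : b = b'
    · subst hb
      rw [pathProd_comp]
      refine Submodule.subset_span ⟨_, ?_, rfl⟩
      rw [Quiver.Path.length_comp, add_comm]
    · rw [pathProd_of_ne K hb]
      exact zero_mem _
  exact key (Submodule.mul_mem_mul hf hg)

theorem ofPath_mem_degreePart (s : QuiverPath Q) : ofPath K s ∈ degreePart K Q s.2.2.length :=
  Submodule.subset_span ⟨s, rfl, rfl⟩

/-- An ideal generated by elements of degree `d` is homogeneous. -/
theorem isHomogeneousIdeal_idealOf {d : ℕ} {R : Set (PathAlgebra K Q)}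
    (hR : R ⊆ degreePart K Q d) : IsHomogeneousIdeal (idealOf R) := by
  intro f hf n
  have : Submodule.span K {g | ∃ s t : QuiverPath Q, ∃ r ∈ R, g = ofPath K s * r * ofPath K t} ≤
      ((idealOf R).restrictScalars K).comap (componentLin n) := by
    rw [Submodule.span_le]
    rintro _ ⟨s, t, r, hr, rfl⟩
    change component n _ ∈ idealOf R
    rw [component_of_mem_degreePart n (mul_mem_degreePart (mul_mem_degreePart
      (ofPath_mem_degreePart s) (hR hr)) (ofPath_mem_degreePart t))]
    split_ifs
    · exact Ideal.mul_mem_right _ _ (Ideal.mul_mem_left _ _ (subset_idealOf _ hr))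
    · exact zero_mem _
  exact this (mem_span_of_mem_idealOf R hf)

end PathAlgebra

/-! ### Assembling the presentation -/

section Presentation

variable {K : Type u} [Field K] {A : Type v} [Ring A] [Algebra K A]
  {P : Type w} [PartialOrder P] [Fintype P] {η : P → A} {χ : P → A →ₐ[K] K}
  [FiniteDimensional K A] {y : A}

/-- For a cover p ⋖ q, rad² has no component between η_q and η_p, so the nonzero η_q y η_p lies
outside rad² and spans its component modulo rad². The other components of the radical lie in rad².
-/
theorem isPathPresentation_of_extOne (h : IsSplitSystem (P := HasseQuiver P) η χ)
    (he : ∀ p q, p ⋖ q → Nonempty (bicharSpace (χ q) (χ p) (Ring.jacobson A) ≃ₗ[K] K))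
    (hs : ∀ p q, ¬ p ⋖ q → Subsingleton (bicharSpace (χ q) (χ p) (Ring.jacobson A)))
    (hy : ∀ p q, p ⋖ q → η q * y * η p ≠ 0) :
    IsPathPresentation (Q := HasseQuiver P) (h.peirceHom y) η χ := by
  have h' : IsSplitSystem η χ := h
  have hmem (p q : P) (hpq : p ≠ q) : η q * y * η p ∈ Ring.jacobson A :=
    h'.mem_jacobson_of_chi (p := p) (by rw [mul_assoc, (h'.complete.idem p).eq])
      (by rw [map_mul, map_mul, h'.chi_of_ne hpq, zero_mul, zero_mul])
  have hsq (p q : P) (hpq : p ⋖ q) (m : A) (hm : m ∈ radSubspace K A ^ 2) :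
      η q * m * η p = 0 := h'.mul_mul_eq_zero_of_covBy hs hpq hm
  refine h.isPathPresentation_peirceHom (fun p q e => hmem p q e.down.ne) ?_
    (fun p q e => hsq p q e.down) (fun p q e => hy p q e.down)
  intro p q m hm
  by_cases hpq : @CovBy P _ p q
  · obtain ⟨e⟩ := he p q hpq
    have hq : η q * (η q * y * η p) = η q * y * η p := by
      rw [← mul_assoc, ← mul_assoc, (h'.complete.idem q).eq]
    have hp : η q * y * η p * η p = η q * y * η p := by
      rw [mul_assoc, (h'.complete.idem p).eq]
    have hn : η q * y * η p ∉ radSubspace K A ^ 2 := fun hn => hy p q hpq (by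
      rw [← hsq p q hpq _ hn, hq, hp])
    refine (sup_le_sup_right (Submodule.span_mono ?_) (radSubspace K A ^ 2) :)
      (h'.mul_mul_mem_span_sup e (hmem p q hpq.ne) hq hp hn hm)
    rintro _ rfl
    exact ⟨hom (P := P) hpq, (h.peirceHom_arrow _).symm⟩
  · exact Submodule.mem_sup_right (h'.mul_mul_mem_sq (hs p q hpq) hm)

/-- This is η_q y² η_p = 0 expanded along 1 = ∑ η_z. In an interval of rank two, p < z < q already
means p ⋖ z ⋖ q, and triangularity kills all other terms. -/
theorem peirceHom_rankTwoRelation (h : IsSplitSystem (P := HasseQuiver P) η χ)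
    (hs : ∀ p q, ¬ p ⋖ q → Subsingleton (bicharSpace (χ q) (χ p) (Ring.jacobson A)))
    (hyy : y * y = 0) (hyp : ∀ p, η p * y * η p = 0) {p q : P} (hpq : RankEq p q 2) :
    h.peirceHom y (rankTwoRelation K p q) = 0 := by
  classical
  have h' : IsSplitSystem η χ := h
  -- Diagonal components of y vanish by assumption; off-diagonal ones lie in the radical, where
  -- triangularity applies.
  have hz (p q : P) (hpq : ¬ p < q) : η q * y * η p = 0 := by
    by_cases hne : p = q
    · rw [← hne, hyp]
    · have := h'.mul_mul_eq_zero hs hpq (m := η q * y * η p)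
        (h'.mem_jacobson_of_chi (p := p) (by rw [mul_assoc, (h'.complete.idem p).eq])
          (by rw [map_mul, map_mul, h'.chi_of_ne hne, zero_mul, zero_mul]))
      rwa [← mul_assoc, ← mul_assoc, (h'.complete.idem q).eq, mul_assoc _ (η p),
        (h'.complete.idem p).eq] at this
  have h0 : η q * (y * y) * η p = 0 := by rw [hyy, mul_zero, zero_mul]
  refine Eq.trans ?_ h0
  rw [map_rankTwoRelation, h'.complete.mul_mul_mul_eq_sum]
  refine Finset.sum_congr rfl fun z _ => ?_
  by_cases h1 : p < z
  · by_cases h2 : z < q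
    · rw [dif_pos (hpq.covBy_of_lt h1 h2)]
      exact congrArg₂ (· * ·) (h.peirceHom_arrow _) (h.peirceHom_arrow _)
    · rw [dif_neg fun hc => h2 hc.2.lt, hz z q h2, zero_mul]
  · rw [dif_neg fun hc => h1 hc.1.lt, hz p z h1, mul_zero]

/-- Recognition of the algebra of a graded poset. -/
theorem nonempty_algEquiv_of_hasHasseDifferential (hA : IsSplitBasic K A)
    (hd : HasHasseDifferential K A P) :
    Nonempty (A ≃ₐ[K] BoundQuiverAlgebra K (hasseRelations K P)) := by
  obtain ⟨S, hS, hext1, hext2, η, hη, -, hηS, d, hdd, hdp, hdq⟩ := hd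
  obtain ⟨χ, h, hσ⟩ := isSplitSystem_of_isSplitBasic hA hS.1 hη hηS
  have σ (p : P) : CharModuleEquiv (χ p) (S p) := (hσ p).some
  -- An endomorphism of the left regular module is right multiplication by its value at 1.
  have hd1 (a : A) : d a = a * d 1 := by rw [← smul_eq_mul, ← map_smul, smul_eq_mul, mul_one]
  have hs (p q : P) (hpq : ¬ p ⋖ q) :
      Subsingleton (bicharSpace (χ q) (χ p) (Ring.jacobson A)) :=
    have := (hext1 p q).2 (mt rankEq_one_iff.1 hpq)
    (h.extOneEquiv (σ p) (σ q)).symm.injective.subsingleton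
  have hyy : d 1 * d 1 = 0 := by
    rw [← hd1]
    exact LinearMap.congr_fun hdd 1
  have hyp (p : P) : η p * d 1 * η p = 0 := by rw [← hd1, hdp]
  let h' : IsSplitSystem (P := HasseQuiver P) η χ := h
  have H : IsPathPresentation (Q := HasseQuiver P) (h'.peirceHom (d 1)) η χ := by
    refine isPathPresentation_of_extOne h' (fun p q hpq => ?_) hs fun p q hpq => ?_
    · exact ((hext1 p q).1 (rankEq_one_iff.2 hpq)).map (h.extOneEquiv (σ p) (σ q)).symm.trans
    · rw [← hd1]
      exact hdq p q (rankEq_one_iff.2 hpq)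
  have E (p q : P) := haveI := finite_star (P := P) p
    H.nonempty_extTwoEquiv (Q := HasseQuiver P) (p := p) (q := q) (σ p) (σ q)
  have hker : idealOf (hasseRelations K P) = RingHom.ker (h'.peirceHom (d 1)) := by
    refine eq_idealOf_hasseRelations (fun m hm => H.mem_filtration_of_map_eq_zero m hm) ?_
      (fun p q hpq => ?_) fun p q hpq => ?_
    · rintro _ ⟨p, q, hpq, rfl⟩
      exact peirceHom_rankTwoRelation h' hs hyy hyp hpq
    · obtain ⟨e⟩ := E p q
      exact ((hext2 p q).1 hpq).map e.symm.trans
    · obtain ⟨e⟩ := E p q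
      have := (hext2 p q).2 hpq
      exact e.symm.injective.subsingleton
  exact ⟨((Ideal.quotientEquivAlgOfEq K hker).trans
    (Ideal.quotientKerAlgEquivOfSurjective H.surjective)).symm⟩

end Presentation

/-! ### The theorem -/

theorem theoremt (K : Type u) [Field K] (P : Type w) [PartialOrder P] [Fintype P] [Nonempty P]
    (hP : IsGradedPoset P) :
    (∀ (A : Type v) [Ring A] [Algebra K A], IsSplitBasic K A → HasHasseDifferential K A P →
      IsQuiverPresentation K A (HasseQuiver P) (hasseRelations K P) ∧
        PathAlgebra.IsHomogeneousIdeal (PathAlgebra.idealOf (hasseRelations K P)) ∧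
        hasseRelations K P ⊆ PathAlgebra.degreePart K (HasseQuiver P) 2 ∧
        IsQuadraticAlgebra.{u, v, w, 0} K A) ∧
    (IsSplitBasic K (BoundQuiverAlgebra K (hasseRelations K P)) ∧
      HasHasseDifferential K (BoundQuiverAlgebra K (hasseRelations K P)) P) := by
  refine ⟨fun A _ _ hA hd => ?_, hasse_isSplitBasic K P, hasse_hasHasseDifferential K P hP⟩
  have := hA.1
  have e := nonempty_algEquiv_of_hasHasseDifferential hA hd
  exact ⟨⟨isAdmissible_idealOf_hasseRelations, isSystemOfRelations_hasseRelations, e⟩,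
    isHomogeneousIdeal_idealOf hasseRelations_subset_degreePart, hasseRelations_subset_degreePart,
    HasseQuiver P, inferInstance, inferInstance, hasseRelations K P,
    fun a b => inferInstanceAs (Finite (PLift _)), hasseRelations_subset_degreePart, e⟩
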